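/- Let $k\ge 2$. A $k$-uniform hypergraph with loops $H$ consists of a finite vertex set $V(H)$ and a set $E(H)$ of $k$-element multisets of vertices. A labeled copy of $F$ in $H$ is an injection $V(F)\to V(H)$ that maps every edge of $F$ to an edge of $H$. Let $\pi$ be a proper partition of $k$, i.e. an unordered list of $t\ge 2$ positive integers with sum $k$, and let $(k_1,\dots,k_t)$ be an ordering of $\pi$. Eigenvalues. Let $H$ be a $k$-uniform hypergraph with loops on $n$ vertices and $W=\mathbb R^{V(H)}$. The adjacency map $\tau:W^k\to\mathbb R$ is the $k$-linear map with $\tau(e_{v_1},\dots,e_{v_k})=1$ if $\{v_1,\dots,v_k\}\in E(H)$ (as a multiset) and $0$ otherwise, and $J:W^k\to\mathbb R$ is the $k$-linear map with value $1$ on all tuples of standard basis vectors. A $k$-linear map $\sigma$ on $W$ induces the $t$-linear map $\sigma_\pi:W^{\otimes k_1}\times\cdots\times W^{\otimes k_t}\to\mathbb R$ with $\sigma_\pi(b_{1,1}\otimes\cdots\otimes b_{1,k_1},\dots,b_{t,1}\otimes\cdots\otimes b_{t,k_t})=\sigma(b_{1,1},\dots,b_{t,k_t})$ for standard basis vectors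 $b_{i,j}$. With $\|\phi\|=\sup\{|\phi(x_1,\dots,x_t)|:\|x_i\|_2=1\}$, put $\lambda_{1,\pi}(H)=\|\tau_\pi\|$ and $\lambda_{2,\pi}(H)=\big\|\tau_\pi-\tfrac{k!\,|E(H)|}{n^k}J_\pi\big\|$. $\pi$-linear hypergraphs. A $k$-uniform hypergraph $F$ (without loops) is $\pi$-linear if its edges can be ordered $E_1,\dots,E_m$ so that every $E_i$ has a partition into sets $A_{i,1},\dots,A_{i,t}$ with $|A_{i,s}|=k_s$ such that for every $j<i$ there is an $s$ with $E_j\cap E_i\subseteq A_{i,s}$. Cycles. The step of type $(k_1,\dots,k_t)$ has the vertex set $(A\times[k_1])\,\dot\cup\,(B_2\times[k_2])\,\dot\cup\cdots\dot\cup\,(B_t\times[k_t])$, where $A=\{0,1\}^{t-1}$ and every $B_j$ is a copy of $\{0,1\}^{t-2}$. It has one edge for every $a\in A$, namely $(\{a\}\times[k_1])\cup\bigcup_{j=2}^{t}(\{b_j\}\times[k_j])$, where $b_j\in B_j$ is $a$ with its $(j-1)$-st bit removed. For $\ell\ge 1$ the cycle $C_{\pi,4\ell}$ is obtained from $2\ell$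 disjoint copies $T_1,\dots,T_{2\ell}$ of the step by identifying, for all $i$ (cyclically), $x\in\{0,1\}^{t-2}$ and $c\in[k_1]$, the vertex $(x1,c)$ of $T_i$ with the vertex $(x0,c)$ of $T_{i+1}$. Theorem. Let $0<p<1$ be fixed and let $\{H_n\}$ be a sequence of $k$-uniform hypergraphs with loops such that $|V(H_n)|=n$ and $|E(H_n)|\ge p\binom nk+o(n^k)$. Let $\pi$ be a proper partition of $k$ and let $\ell\ge 1$. Then the following properties are equivalent, where in each property any ordering $(k_1,\dots,k_t)$ of $\pi$ may be used (possibly different orderings in different properties). 1. $\mathtt{Eig}[\pi]$: $\lambda_{1,\pi}(H_n)=pn^{k/2}+o(n^{k/2})$ and $\lambda_{2,\pi}(H_n)=o(n^{k/2})$. 2. $\mathtt{Expand}[\pi]$: for all $S_i\subseteq\binom{V(H_n)}{k_i}$, $1\le i\le t$, we have $e(S_1,\dots,S_t)=p\prod_{i=1}^t|S_i|+o(n^k)$ uniformly in the $S_i$, where $e(S_1,\dots,S_t)$ is the number of tuples $(s_1,\dots,s_t)$ with $s_i\in S_i$ such that $s_1\cup\dots\cup s_t$ is a hyperedge. 3.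 $\mathtt{Count}[\pi\text{-linear}]$: for every $k$-uniform $\pi$-linear hypergraph $F$ with $f$ vertices and $m$ edges, the number of labeled copies of $F$ in $H_n$ is $p^mn^f+o(n^f)$. 4. $\mathtt{Cycle}_4[\pi]$: the number of labeled copies of $C_{\pi,4}$ in $H_n$ is at most $p^{|E(C_{\pi,4})|}n^{|V(C_{\pi,4})|}+o(n^{|V(C_{\pi,4})|})$. 5. $\mathtt{Cycle}_{4\ell}[\pi]$: the number of labeled copies of $C_{\pi,4\ell}$ in $H_n$ is at most $p^{|E(C_{\pi,4\ell})|}n^{|V(C_{\pi,4\ell})|}+o(n^{|V(C_{\pi,4\ell})|})$. -/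

import Mathlib

open Filter Asymptotics Finset

/-- A `k`-uniform hypergraph with loops on the vertex set `V`: a collection of `k`-element
multisets of vertices. -/
structure LoopHypergraph (V : Type*) (k : ℕ) where
  /-- the edge set -/
  edges : Set (Sym V k)

/-- An ordering `(k₁, …, k_t)` of the (unordered) partition `π` of `k` into `t` parts. -/
structure PartOrdering {k : ℕ} (π : Nat.Partition k) (t : ℕ) where
  /-- the sizes of the parts, in order -/
  part : Fin t → ℕ
  map_part : (univ : Finset (Fin t)).val.map part = π.parts

theorem PartOrdering.sum_part {k t : ℕ} {π : Nat.Partition k} (κ : PartOrdering π t) :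
    ∑ i, κ.part i = k := by
  have h := π.parts_sum
  rw [← κ.map_part] at h
  exact h

theorem PartOrdering.card_slots {k t : ℕ} {π : Nat.Partition k} (κ : PartOrdering π t) :
    Fintype.card (Σ i, Fin (κ.part i)) = k := by
  simp [κ.sum_part]

/-- The `k` slots, split into consecutive blocks of lengths `k₁, …, k_t`. -/
def PartOrdering.slotEquiv {k t : ℕ} {π : Nat.Partition k} (κ : PartOrdering π t) :
    (Σ i, Fin (κ.part i)) ≃ Fin k :=
  finSigmaFinEquiv.trans (finCongr κ.sum_part)

/-- The multiset of the values of a family that is indexed by `k` indices. -/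
def symOfFamily {V ι : Type*} [Fintype ι] {k : ℕ} (h : Fintype.card ι = k) (g : ι → V) :
    Sym V k :=
  ⟨(univ : Finset ι).val.map g, by simpa using h⟩

namespace LoopHypergraph

/-- The labeled copies of `F` in `H`: the edge-preserving injections `V(F) → V(H)`. -/
def labeledCopies {U V : Type*} {k : ℕ} (F : LoopHypergraph U k) (H : LoopHypergraph V k) :
    Set (U → V) :=
  {α | Function.Injective α ∧ ∀ e ∈ F.edges, Sym.map α e ∈ H.edges}

/-- No edge has a repeated vertex, i.e. a `k`-uniform hypergraph in the usual sense. -/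
def Loopless {V : Type*} {k : ℕ} (F : LoopHypergraph V k) : Prop :=
  ∀ e ∈ F.edges, (e : Multiset V).Nodup

end LoopHypergraph

section Multilinear

/-- The multilinear map with value `c u` on the tuple `(e_{u i})_i` of standard basis vectors,
extended linearly in every argument. -/
noncomputable def multilinearOfBasis {ι : Type*} [Fintype ι] [DecidableEq ι] {B : ι → Type*}
    [∀ i, Fintype (B i)] (c : (∀ i, B i) → ℝ) :
    MultilinearMap ℝ (fun i => EuclideanSpace ℝ (B i)) ℝ :=
  ∑ u : ∀ i, B i, c u •
    (MultilinearMap.mkPiAlgebra ℝ ι ℝ).compLinearMap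
      (fun i => (EuclideanSpace.proj (u i) : EuclideanSpace ℝ (B i) →L[ℝ] ℝ).toLinearMap)

theorem multilinearOfBasis_apply {ι : Type*} [Fintype ι] [DecidableEq ι] {B : ι → Type*}
    [∀ i, Fintype (B i)] (c : (∀ i, B i) → ℝ) (x : ∀ i, EuclideanSpace ℝ (B i)) :
    multilinearOfBasis c x = ∑ u : ∀ i, B i, c u * ∏ i, x i (u i) := by
  simp [multilinearOfBasis]

/-- The spectral norm of a multilinear map: the supremum of `|φ(x₁, …, x_t)|` over all tuples of
unit vectors. -/
noncomputable def multilinearSpectralNorm {ι : Type*} {E : ι → Type*} [∀ i, NormedAddCommGroup (E i)]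
    [∀ i, NormedSpace ℝ (E i)] (φ : MultilinearMap ℝ E ℝ) : ℝ :=
  sSup {c : ℝ | ∃ x : ∀ i, E i, (∀ i, ‖x i‖ = 1) ∧ c = |φ x|}

open Classical in
/-- The adjacency map of `H`, a `k`-linear map on `ℝ^V`. -/
noncomputable def adjacencyMap {V : Type*} [Fintype V] {k : ℕ} (H : LoopHypergraph V k) :
    MultilinearMap ℝ (fun _ : Fin k => EuclideanSpace ℝ V) ℝ :=
  multilinearOfBasis (B := fun _ : Fin k => V)
    (fun v => if symOfFamily (Fintype.card_fin k) v ∈ H.edges then 1 else 0)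

/-- The `k`-linear all-ones map `J`. -/
noncomputable def allOnesMap (V : Type*) [Fintype V] (k : ℕ) :
    MultilinearMap ℝ (fun _ : Fin k => EuclideanSpace ℝ V) ℝ :=
  multilinearOfBasis (B := fun _ : Fin k => V) (fun _ => 1)

open Classical in
/-- The `t`-linear map `σ_κ` on `W^{⊗k₁} × ⋯ × W^{⊗k_t}` that is induced by a `k`-linear map `σ`
on `W = ℝ^V`. The space `W^{⊗m}` with its Euclidean norm is `EuclideanSpace ℝ (Fin m → V)`: the
coordinate `b : Fin m → V` belongs to the basis vector `e_{b 0} ⊗ ⋯ ⊗ e_{b (m-1)}`. -/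
noncomputable def groupSlots {V : Type*} [Fintype V] {k t : ℕ} {π : Nat.Partition k}
    (κ : PartOrdering π t)
    (σ : MultilinearMap ℝ (fun _ : Fin k => EuclideanSpace ℝ V) ℝ) :
    MultilinearMap ℝ (fun i : Fin t => EuclideanSpace ℝ (Fin (κ.part i) → V)) ℝ :=
  multilinearOfBasis (B := fun i : Fin t => Fin (κ.part i) → V)
    (fun b => σ (fun j =>
      EuclideanSpace.single (b (κ.slotEquiv.symm j).1 (κ.slotEquiv.symm j).2) (1 : ℝ)))

/-- The largest eigenvalue `λ_{1,π}(H)`, computed with the ordering `κ` of `π`. -/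
noncomputable def lambda1 {V : Type*} [Fintype V] {k t : ℕ} {π : Nat.Partition k}
    (κ : PartOrdering π t) (H : LoopHypergraph V k) : ℝ :=
  multilinearSpectralNorm (groupSlots κ (adjacencyMap H))

/-- The second largest eigenvalue `λ_{2,π}(H)`, computed with the ordering `κ` of `π`. -/
noncomputable def lambda2 {V : Type*} [Fintype V] {k t : ℕ} {π : Nat.Partition k}
    (κ : PartOrdering π t) (H : LoopHypergraph V k) : ℝ :=
  multilinearSpectralNorm (groupSlots κ (adjacencyMap H) -
    ((k.factorial : ℝ) * (H.edges.ncard : ℝ) / (Fintype.card V : ℝ) ^ k) •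
      groupSlots κ (allOnesMap V k))

end Multilinear

section Linear

/-- `F` is `π`-linear: its edges can be ordered as `E₁, …, E_m` such that every `E_i` has a
partition into sets `A₁, …, A_t` of sizes `k₁, …, k_t` with the property that for every `j < i`
the intersection `E_j ∩ E_i` is contained in one of these sets. -/
def IsPiLinear {V : Type*} {k t : ℕ} {π : Nat.Partition k} (κ : PartOrdering π t)
    (F : LoopHypergraph V k) : Prop :=
  ∃ (m : ℕ) (E : Fin m → Sym V k), Function.Injective E ∧ Set.range E = F.edges ∧
    ∀ i, ∃ A : Fin t → Finset V,
      (∀ s, (A s).card = κ.part s) ∧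
      (∀ s s', s ≠ s' → Disjoint (A s) (A s')) ∧
      (∀ v, v ∈ E i ↔ ∃ s, v ∈ A s) ∧
      ∀ j, j < i → ∃ s, ∀ v, v ∈ E j → v ∈ E i → v ∈ A s

end Linear

section Expand

open Classical in
/-- `e(S₁, …, S_t)`: the number of tuples `(s₁, …, s_t)` with `s_i ∈ S_i` whose union is a
hyperedge. -/
noncomputable def edgeTuples {V : Type*} {k t : ℕ} (H : LoopHypergraph V k)
    (S : Fin t → Finset (Finset V)) : ℕ :=
  Set.ncard {s : Fin t → Finset V | (∀ i, s i ∈ S i) ∧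
    ∃ e ∈ H.edges, (e : Multiset V) = (univ.biUnion s).val}

end Expand

section Cycles

/-- The vertices of the step of type `(k₁, …, k_t)`, where `t = r + 2`: the set `A × [k₁]` with `A`
the binary strings of length `t - 1`, and the sets `B_j × [k_j]`, `2 ≤ j ≤ t`, with `B_j` a copy of
the binary strings of length `t - 2`. The index `j : Fin (r + 1)` (from `0`) stands for
`B_{j+2}`, of part size `κ.part j.succ`. -/
abbrev StepVertex {k r : ℕ} {π : Nat.Partition k} (κ : PartOrdering π (r + 2)) : Type :=
  ((Fin (r + 1) → Bool) × Fin (κ.part 0)) ⊕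
    (Σ j : Fin (r + 1), (Fin r → Bool) × Fin (κ.part j.succ))

/-- The vertices of the edge of the step that belongs to the string `a ∈ A`: the blown-up vertex
`a` and, for every `j`, the blown-up vertex of `B_{j+2}` whose string is `a` without its bit at
position `j`. -/
def stepEdgeVertex {k r : ℕ} {π : Nat.Partition k} (κ : PartOrdering π (r + 2))
    (a : Fin (r + 1) → Bool) : (Σ i : Fin (r + 2), Fin (κ.part i)) → StepVertex κ :=
  fun x => Fin.cases (motive := fun i => Fin (κ.part i) → StepVertex κ)
    (fun c => Sum.inl (a, c)) (fun j c => Sum.inr ⟨j, (Fin.removeNth j a, c)⟩) x.1 x.2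

/-- The step of type `(k₁, …, k_t)`. -/
def stepHypergraph {k r : ℕ} {π : Nat.Partition k} (κ : PartOrdering π (r + 2)) :
    LoopHypergraph (StepVertex κ) k where
  edges := Set.range fun a => symOfFamily κ.card_slots (stepEdgeVertex κ a)

/-- The vertices of the cycle that is made of `s` steps. Every step `i` has its own copies of the
`B`-vertices. Of the `A`-vertices, only those whose string ends with zero are kept in each step
(coded by the string without this last zero); a vertex of step `i` whose string ends with one is
identified with the corresponding one of the next step. -/
abbrev CycleVertex {k r : ℕ} {π : Nat.Partition k} (κ : PartOrdering π (r + 2)) (s : ℕ) : Type :=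
  (Fin s × (Fin r → Bool) × Fin (κ.part 0)) ⊕
    (Fin s × (Σ j : Fin (r + 1), (Fin r → Bool) × Fin (κ.part j.succ)))

/-- The map of the `i`-th step into the cycle of `s` steps. It identifies the vertex of step `i`
with string `x1` and the vertex of step `i + 1` (cyclically) with string `x0`. -/
def glueStep {k r : ℕ} {π : Nat.Partition k} (κ : PartOrdering π (r + 2)) (s : ℕ) (i : Fin s) :
    StepVertex κ → CycleVertex κ s
  | Sum.inl (a, c) =>
      Sum.inl (if a (Fin.last r) then finRotate s i else i, Fin.init a, c)
  | Sum.inr b => Sum.inr (i, b)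

/-- The cycle of type `(k₁, …, k_t)` and length `2 s`: `s` steps, glued cyclically along their
attach tuples. -/
def cycleHypergraph {k r : ℕ} {π : Nat.Partition k} (κ : PartOrdering π (r + 2)) (s : ℕ) :
    LoopHypergraph (CycleVertex κ s) k where
  edges := {e | ∃ i : Fin s, ∃ e' ∈ (stepHypergraph κ).edges, e = Sym.map (glueStep κ s i) e'}

end Cycles

section Properties

/-- `Eig[π]`: `λ_{1,π}(H_n) = p n^{k/2} + o(n^{k/2})` and `λ_{2,π}(H_n) = o(n^{k/2})`. -/
def PropEig {k t : ℕ} {π : Nat.Partition k} (κ : PartOrdering π t) (p : ℝ)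
    {V : ℕ → Type*} [∀ n, Fintype (V n)] (H : ∀ n, LoopHypergraph (V n) k) : Prop :=
  ((fun n : ℕ => lambda1 κ (H n) - p * (n : ℝ) ^ ((k : ℝ) / 2))
      =o[atTop] fun n : ℕ => (n : ℝ) ^ ((k : ℝ) / 2)) ∧
  ((fun n : ℕ => lambda2 κ (H n)) =o[atTop] fun n : ℕ => (n : ℝ) ^ ((k : ℝ) / 2))

/-- `Expand[π]`: `e(S₁, …, S_t) = p |S₁| ⋯ |S_t| + o(n^k)`, uniformly over all choices of sets
`S_i` of `k_i`-element vertex sets. -/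
def PropExpand {k t : ℕ} {π : Nat.Partition k} (κ : PartOrdering π t) (p : ℝ)
    {V : ℕ → Type*} (H : ∀ n, LoopHypergraph (V n) k) : Prop :=
  ∃ err : ℕ → ℝ, (err =o[atTop] fun n : ℕ => (n : ℝ) ^ k) ∧
    ∀ n, ∀ S : Fin t → Finset (Finset (V n)), (∀ i, ∀ s ∈ S i, s.card = κ.part i) →
      |(edgeTuples (H n) S : ℝ) - p * ∏ i, ((S i).card : ℝ)| ≤ err n

/-- `Count[π-linear]`: every `k`-uniform `π`-linear hypergraph `F` with `f` vertices and `m` edges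
has `p^m n^f + o(n^f)` labeled copies in `H_n`. -/
def PropCount {k t : ℕ} {π : Nat.Partition k} (κ : PartOrdering π t) (p : ℝ)
    {V : ℕ → Type*} (H : ∀ n, LoopHypergraph (V n) k) : Prop :=
  ∀ (f : ℕ) (F : LoopHypergraph (Fin f) k), F.Loopless → IsPiLinear κ F →
    (fun n : ℕ => ((F.labeledCopies (H n)).ncard : ℝ) - p ^ F.edges.ncard * (n : ℝ) ^ f)
      =o[atTop] fun n : ℕ => (n : ℝ) ^ f

/-- `Cycle_{4ℓ}[π]`: the number of labeled copies of the cycle `C` of length `4ℓ` in `H_n` is at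
most `p^{|E(C)|} n^{|V(C)|} + o(n^{|V(C)|})`. -/
def PropCycle {k r : ℕ} {π : Nat.Partition k} (κ : PartOrdering π (r + 2)) (ℓ : ℕ) (p : ℝ)
    {V : ℕ → Type*} (H : ∀ n, LoopHypergraph (V n) k) : Prop :=
  ∃ err : ℕ → ℝ,
    (err =o[atTop] fun n : ℕ => (n : ℝ) ^ Fintype.card (CycleVertex κ (2 * ℓ))) ∧
    ∀ n, (((cycleHypergraph κ (2 * ℓ)).labeledCopies (H n)).ncard : ℝ) ≤
      p ^ (cycleHypergraph κ (2 * ℓ)).edges.ncard *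
        (n : ℝ) ^ Fintype.card (CycleVertex κ (2 * ℓ)) + err n

end Properties

/-! All five properties are compared with one condition, `IsQuasirandom`: the edge indicator, read
as a function `blockTensor` of `t` blocks of vertices, differs from `p` by something that has
correlation `o(1)` with every product of `[0, 1]`-valued functions of the single blocks. Everything
is written with averages over all maps or tuples; passing to injective ones costs only `n ^ f` minus
a falling factorial.

Quasirandomness gives Count by deleting edges one at a time: all values outside the last edge are
frozen, and by `π`-linearity every earlier edge then depends on one block of the last edge only, so
the discrepancy bound applies (`abs_expect_mul_prod_le`). The cycles are `π`-linear, so Count gives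
their densities.

The hard direction is from cycles to quasirandomness (`discrepancy_of_cycle_density`). The density
of the cycle is the normalised trace of the `2ℓ`-th power of a symmetric step matrix. The edge
density and Cauchy–Schwarz bound the Rayleigh quotient of the constant vector from below by about `q
= p ^ 2 ^ (t - 1)`. The trace bound then leaves almost nothing orthogonal to it
(`closed_walk_bound`). Testing the matrix on products `∏ f (y a)` shows that the contraction of the
tensor along any `f` in the first block has box mean at most about `(p * 𝔼 f) ^ 2 ^ (t - 1)`. Using
both `f` and `1 - f` determines the mean of the contraction, and a tensor whose box mean is nearly
minimal for its mean has small discrepancy (`boxControlsDiscrepancy`).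

Expand is the same discrepancy for indicator functions of families of sets, which are the extremal
test functions of a multilinear form. Eig follows from the discrepancy by truncating unit vectors
(`abs_sum_mul_prod_le_of_cut_bound`). Conversely, the spectral norm bounds the discrepancy directly,
and `lambda1` gives the upper bound on the edge density.

Different orderings of `π` are reconciled through Count, since being `π`-linear does not depend on
the ordering. -/

open scoped BigOperators

/-! ### Averages over products and over functions on binary strings. -/

section Expectation

theorem expect_prod_type {α β : Type*} [Fintype α] [Fintype β] (f : α × β → ℝ) :
    𝔼 x, f x = 𝔼 a, 𝔼 b, f (a, b) := by
  rw [← Finset.univ_product_univ, Finset.expect_product]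

theorem abs_expect_le_expect_abs {α : Type*} [Fintype α] (f : α → ℝ) :
    |𝔼 x, f x| ≤ 𝔼 x, |f x| :=
  Finset.abs_expect_le _ _

theorem expect_snoc {t : ℕ} {X : Fin (t + 1) → Type*} [∀ i, Fintype (X i)]
    (f : (∀ i, X i) → ℝ) :
    𝔼 b, f b = 𝔼 x : X (Fin.last t), 𝔼 b : ∀ i : Fin t, X i.castSucc, f (Fin.snoc b x) := by
  rw [← expect_prod_type (fun z : X (Fin.last t) × (∀ i : Fin t, X i.castSucc) =>
    f (Fin.snoc z.2 z.1))]
  exact (Fintype.expect_equiv (Fin.snocEquiv X) _ _ fun _ => rfl).symm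

theorem expect_cons {t : ℕ} {X : Fin (t + 1) → Type*} [∀ i, Fintype (X i)]
    (f : (∀ i, X i) → ℝ) :
    𝔼 b, f b = 𝔼 x : X 0, 𝔼 b : ∀ i : Fin t, X i.succ, f (Fin.cons x b) := by
  rw [← expect_prod_type (fun z : X 0 × (∀ i : Fin t, X i.succ) => f (Fin.cons z.1 z.2))]
  exact (Fintype.expect_equiv (Fin.consEquiv X) _ _ fun _ => rfl).symm

/-- A function on binary strings of length `t + 1`, as two functions on strings of length `t`
according to the last bit. -/
def splitLastBit (t : ℕ) (Z : Type*) :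
    ((Fin (t + 1) → Bool) → Z) ≃ ((Fin t → Bool) → Z) × ((Fin t → Bool) → Z) where
  toFun x := (fun a => x (Fin.snoc a false), fun a => x (Fin.snoc a true))
  invFun y a := if a (Fin.last t) then y.2 (Fin.init a) else y.1 (Fin.init a)
  left_inv x := by
    funext a
    have := Fin.snoc_init_self a
    by_cases h : a (Fin.last t) = true
    · simp only [h, if_true]; rw [← h, this]
    · simp only [h]; rw [Bool.not_eq_true] at h; rw [← h, this]; simp [h]
  right_inv y := by ext a <;> simp

theorem prod_splitLastBit {t : ℕ} (f : (Fin (t + 1) → Bool) → ℝ) :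
    ∏ a, f a = (∏ a : Fin t → Bool, f (Fin.snoc a false)) * ∏ a : Fin t → Bool, f (Fin.snoc a true) := by
  rw [← Equiv.prod_comp (Fin.snocEquiv fun _ : Fin (t + 1) => Bool), Fintype.prod_prod_type,
    Fintype.prod_bool, mul_comm]
  rfl

theorem expect_splitLastBit {t : ℕ} {Z : Type*} [Fintype Z] (f : ((Fin (t + 1) → Bool) → Z) → ℝ) :
    𝔼 x, f x = 𝔼 y : (Fin t → Bool) → Z, 𝔼 z : (Fin t → Bool) → Z,
      f ((splitLastBit t Z).symm (y, z)) := by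
  rw [← expect_prod_type (fun w => f ((splitLastBit t Z).symm w))]
  exact Fintype.expect_equiv (splitLastBit t Z) _ _ fun x => by simp

theorem splitLastBit_symm_snoc_false {t : ℕ} {Z : Type*} (y z : (Fin t → Bool) → Z) (a) :
    (splitLastBit t Z).symm (y, z) (Fin.snoc a false) = y a := by simp [splitLastBit]

theorem splitLastBit_symm_snoc_true {t : ℕ} {Z : Type*} (y z : (Fin t → Bool) → Z) (a) :
    (splitLastBit t Z).symm (y, z) (Fin.snoc a true) = z a := by simp [splitLastBit]

theorem sq_expect_le {α : Type*} [Fintype α] (f : α → ℝ) : (𝔼 x, f x) ^ 2 ≤ 𝔼 x, f x ^ 2 := by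
  rcases isEmpty_or_nonempty α
  · simp
  · simpa [Fintype.expect_const] using
      Finset.expect_mul_sq_le_sq_mul_sq (univ : Finset α) f (fun _ => (1 : ℝ))

theorem expect_mem_Icc {α : Type*} [Fintype α] {f : α → ℝ} (h : ∀ x, f x ∈ Set.Icc (0 : ℝ) 1) :
    𝔼 x, f x ∈ Set.Icc (0 : ℝ) 1 := by
  rcases isEmpty_or_nonempty α
  · simp
  · exact ⟨Finset.expect_nonneg fun x _ => (h x).1,
      Finset.expect_le univ_nonempty fun x _ => (h x).2⟩

end Expectation

/-! ### The box functional and its Cauchy–Schwarz inequality. -/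

section Box

/-- The box functional of a family `g`, indexed by the binary strings of length `t`, of functions
of `t` variables: the mean of the product of all `g a`, where the `j`-th arguments of `g a` and
`g a'` are the same variable when `a` and `a'` agree outside of position `j`, and independent
variables otherwise. -/
noncomputable def boxMean : (t : ℕ) → (X : Fin t → Type*) → [∀ i, Fintype (X i)] →
    ((Fin t → Bool) → (∀ i, X i) → ℝ) → ℝ
  | 0, _, _, g => g default default
  | t + 1, X, _, g => 𝔼 x : (Fin t → Bool) → X (Fin.last t),
      boxMean t (fun i => X i.castSucc) (fun a b => g (Fin.snoc a false) (Fin.snoc b (x a))) *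
      boxMean t (fun i => X i.castSucc) (fun a b => g (Fin.snoc a true) (Fin.snoc b (x a)))

theorem boxMean_mem_Icc {t : ℕ} {X : Fin t → Type*} [∀ i, Fintype (X i)]
    {g : (Fin t → Bool) → (∀ i, X i) → ℝ} (hg : ∀ a b, g a b ∈ Set.Icc (0 : ℝ) 1) :
    boxMean t X g ∈ Set.Icc (0 : ℝ) 1 := by
  induction t with
  | zero => exact hg _ _
  | succ t ih =>
    rw [boxMean]
    refine expect_mem_Icc fun x => ?_
    have h1 := ih (X := fun i => X i.castSucc)
      (g := fun a b => g (Fin.snoc a false) (Fin.snoc b (x a))) (fun a b => hg _ _)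
    have h2 := ih (X := fun i => X i.castSucc)
      (g := fun a b => g (Fin.snoc a true) (Fin.snoc b (x a))) (fun a b => hg _ _)
    exact ⟨mul_nonneg h1.1 h2.1, mul_le_one₀ h1.2 h2.1 h2.2⟩

/-- The functional is linear in each member of the family separately, so every `g a` receives its
own independent copy of the averaged variable. -/
theorem boxMean_expect {t : ℕ} {X : Fin t → Type*} [∀ i, Fintype (X i)] {Z : Type*} [Fintype Z]
    (h : (Fin t → Bool) → Z → (∀ i, X i) → ℝ) :
    boxMean t X (fun a b => 𝔼 z, h a z b) = 𝔼 x : (Fin t → Bool) → Z, boxMean t X fun a => h a (x a) := by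
  induction t with
  | zero =>
    simp only [boxMean]
    refine (Fintype.expect_equiv (Equiv.funUnique (Fin 0 → Bool) Z) _
      (fun z => h default z default) fun x => ?_).symm
    rw [Equiv.funUnique_apply, Subsingleton.elim (@default (Fin 0 → Bool) Unique.instInhabited)]
  | succ t ih =>
    rw [expect_splitLastBit]
    simp only [boxMean, splitLastBit_symm_snoc_false, splitLastBit_symm_snoc_true]
    simp_rw [ih (X := fun i => X i.castSucc), Fintype.expect_mul_expect]
    rw [Finset.expect_comm]
    exact Finset.expect_congr rfl fun x _ => Finset.expect_comm _ _ _

theorem boxMean_mul {t : ℕ} {X : Fin t → Type*} [∀ i, Fintype (X i)]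
    (c : (Fin t → Bool) → ℝ) (g : (Fin t → Bool) → (∀ i, X i) → ℝ) :
    boxMean t X (fun a b => c a * g a b) = (∏ a, c a) * boxMean t X g := by
  induction t with
  | zero => simp only [boxMean]; rw [Fintype.prod_unique, Subsingleton.elim (@default (Fin 0 → Bool) Unique.instInhabited)]
  | succ t ih =>
    simp only [boxMean, prod_splitLastBit]
    rw [Finset.mul_expect]
    refine Finset.expect_congr rfl fun x _ => ?_
    rw [ih (X := fun i => X i.castSucc) (fun a => c (Fin.snoc a false))
        (fun a b => g (Fin.snoc a false) (Fin.snoc b (x a))),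
      ih (X := fun i => X i.castSucc) (fun a => c (Fin.snoc a true))
        (fun a b => g (Fin.snoc a true) (Fin.snoc b (x a)))]
    ring

theorem boxMean_weighted_expect {t : ℕ} {X : Fin t → Type*} [∀ i, Fintype (X i)] {Z : Type*}
    [Fintype Z] (f : Z → ℝ) (T : Z → (∀ i, X i) → ℝ) :
    boxMean t X (fun _ b => 𝔼 z, f z * T z b) =
      𝔼 x : (Fin t → Bool) → Z, (∏ a, f (x a)) * boxMean t X fun a => T (x a) := by
  rw [boxMean_expect fun _ z b => f z * T z b]
  exact Finset.expect_congr rfl fun x _ => boxMean_mul (fun a => f (x a)) fun a => T (x a)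

/-- For a constant family the two halves coincide. The resulting square supports both Cauchy–Schwarz
and the second-moment argument in `boxControlsDiscrepancy`. -/
theorem boxMean_const_succ {t : ℕ} {X : Fin (t + 1) → Type*} [∀ i, Fintype (X i)]
    (g : (∀ i, X i) → ℝ) :
    boxMean (t + 1) X (fun _ => g) = 𝔼 x : (Fin t → Bool) → X (Fin.last t),
      (boxMean t (fun i => X i.castSucc) fun a b => g (Fin.snoc b (x a))) ^ 2 := by
  simp only [boxMean, sq]

/-- Cauchy–Schwarz is applied one variable at a time: the last variable is averaged out by
`boxMean_expect`, and each squaring doubles the exponent. -/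
theorem pow_expect_le_boxMean {t : ℕ} {X : Fin t → Type*} [∀ i, Fintype (X i)]
    {g : (∀ i, X i) → ℝ} (hg : ∀ b, 0 ≤ g b) :
    (𝔼 b, g b) ^ 2 ^ t ≤ boxMean t X fun _ => g := by
  induction t with
  | zero => simp [boxMean]
  | succ t ih =>
    rw [boxMean_const_succ]
    refine le_trans ?_ (sq_expect_le _)
    rw [← boxMean_expect fun (_ : Fin t → Bool) x (b : ∀ i : Fin t, X i.castSucc) =>
      g (Fin.snoc b x), pow_succ, pow_mul, expect_snoc, Finset.expect_comm]
    refine pow_le_pow_left₀ (pow_nonneg ?_ _) (ih fun b => ?_) 2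
    · exact Finset.expect_nonneg fun b _ => Finset.expect_nonneg fun x _ => hg _
    · exact Finset.expect_nonneg fun x _ => hg _

end Box

/-! ### A nearly minimal box mean forces small discrepancy. -/

section Discrepancy

/-- The function `T` of several variables has discrepancy at most `ε` from the constant `q`: its
weighted means with respect to products of `[0, 1]`-valued functions of the single variables are
within `ε` of those of the constant `q`. -/
def DiscrepancyLE {ι : Type*} [Fintype ι] {X : ι → Type*} [∀ i, Fintype (X i)] [DecidableEq ι]
    (q ε : ℝ) (T : (∀ i, X i) → ℝ) : Prop :=
  ∀ f : ∀ i, X i → ℝ, (∀ i x, f i x ∈ Set.Icc (0 : ℝ) 1) →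
    |𝔼 b, (T b - q) * ∏ i, f i (b i)| ≤ ε

theorem le_add_of_pow_le_pow_add_pow {x q ε : ℝ} {N : ℕ} (hN : N ≠ 0) (hq : 0 ≤ q) (hε : 0 ≤ ε)
    (h : x ^ N ≤ q ^ N + ε ^ N) : x ≤ q + ε := by
  by_contra! hlt
  have h1 : (q + ε) ^ N < x ^ N := pow_lt_pow_left₀ hlt (by positivity) hN
  have h2 : q ^ N + ε ^ N ≤ (q + ε) ^ N := pow_add_pow_le hq hε hN
  linarith

theorem pow_sub_le_pow {x q δ : ℝ} (hx : 0 ≤ x) (hq0 : 0 ≤ q) (hq1 : q ≤ 1) (hδ : 0 ≤ δ)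
    (h : q - δ ≤ x) (N : ℕ) : q ^ N - N * δ ≤ x ^ N := by
  induction N with
  | zero => simp
  | succ N ih =>
    rcases le_or_gt q x with hqx | hqx
    · have h1 : q ^ (N + 1) ≤ x ^ (N + 1) := pow_le_pow_left₀ hq0 hqx _
      have h2 : (0 : ℝ) ≤ (N + 1 : ℕ) * δ := by positivity
      linarith
    · have h1 : x ^ N ≤ 1 := pow_le_one₀ hx (hqx.le.trans hq1)
      have h2 : q * (q ^ N - N * δ) ≤ q * x ^ N := mul_le_mul_of_nonneg_left ih hq0
      have h3 : q * (N * δ) ≤ N * δ := mul_le_of_le_one_left (by positivity) hq1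
      have h4 : (q - x) * x ^ N ≤ δ * 1 :=
        mul_le_mul (by linarith) h1 (by positivity) hδ
      push_cast
      rw [pow_succ, pow_succ]
      nlinarith

theorem expect_one_sub {α : Type*} [Fintype α] [Nonempty α] (f : α → ℝ) :
    𝔼 x, (1 - f x) = 1 - 𝔼 x, f x := by
  rw [Finset.expect_sub_distrib, Fintype.expect_const]

/-- The property that a nearly minimal box mean forces small discrepancy. -/
def BoxControlsDiscrepancy.{u} (t : ℕ) : Prop :=
  ∀ ε : ℝ, 0 < ε → ∃ δ : ℝ, 0 < δ ∧ ∀ (X : Fin t → Type u) [∀ i, Fintype (X i)]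
    [∀ i, Nonempty (X i)] (T : (∀ i, X i) → ℝ) (q : ℝ), (∀ b, T b ∈ Set.Icc (0 : ℝ) 1) →
    q ∈ Set.Icc (0 : ℝ) 1 → q - δ ≤ 𝔼 b, T b →
    boxMean t X (fun _ => T) ≤ q ^ 2 ^ t + δ → DiscrepancyLE q ε T

/-- If the contraction of `T` in one variable along every `[0, 1]`-valued function has a nearly
minimal box mean, then `T` has small discrepancy. -/
theorem discrepancy_of_contractions.{u, v} {t : ℕ} (ht : BoxControlsDiscrepancy.{u} t) {ε : ℝ} (hε : 0 < ε) :
    ∃ δ : ℝ, 0 < δ ∧ ∀ (Z : Type v) [Fintype Z] [Nonempty Z] (X : Fin t → Type u)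
      [∀ i, Fintype (X i)] [∀ i, Nonempty (X i)] (T : Z → (∀ i, X i) → ℝ) (q : ℝ),
      (∀ z b, T z b ∈ Set.Icc (0 : ℝ) 1) → q ∈ Set.Icc (0 : ℝ) 1 → q - δ ≤ 𝔼 z, 𝔼 b, T z b →
      (∀ f : Z → ℝ, (∀ z, f z ∈ Set.Icc (0 : ℝ) 1) →
        boxMean t X (fun _ b => 𝔼 z, f z * T z b) ≤ (q * 𝔼 z, f z) ^ 2 ^ t + δ) →
      ∀ (f₀ : Z → ℝ) (f : ∀ i, X i → ℝ), (∀ z, f₀ z ∈ Set.Icc (0 : ℝ) 1) →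
        (∀ i x, f i x ∈ Set.Icc (0 : ℝ) 1) →
        |𝔼 z, 𝔼 b, (T z b - q) * (f₀ z * ∏ i, f i (b i))| ≤ ε := by
  obtain ⟨δ, hδ, h⟩ := ht ε hε
  -- The power `(δ / 2) ^ 2 ^ t` becomes an additive error `δ / 2` when the `2 ^ t`-th root of the
  -- box bound is taken.
  refine ⟨min (δ / 2) ((δ / 2) ^ 2 ^ t), by positivity, ?_⟩
  intro Z _ _ X _ _ T q hT hq hmean hbox f₀ f hf₀ hf
  have hg : ∀ f : Z → ℝ, (∀ z, f z ∈ Set.Icc (0 : ℝ) 1) → ∀ b,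
      𝔼 z, f z * T z b ∈ Set.Icc (0 : ℝ) 1 := fun f hf b => expect_mem_Icc fun z =>
    ⟨mul_nonneg (hf z).1 (hT z b).1, mul_le_one₀ (hf z).2 (hT z b).1 (hT z b).2⟩
  have hqf : ∀ f : Z → ℝ, (∀ z, f z ∈ Set.Icc (0 : ℝ) 1) →
      q * 𝔼 z, f z ∈ Set.Icc (0 : ℝ) 1 := fun f hf =>
    ⟨mul_nonneg hq.1 (expect_mem_Icc hf).1,
      mul_le_one₀ hq.2 (expect_mem_Icc hf).1 (expect_mem_Icc hf).2⟩
  have upper : ∀ f : Z → ℝ, (∀ z, f z ∈ Set.Icc (0 : ℝ) 1) →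
      𝔼 b, 𝔼 z, f z * T z b ≤ q * (𝔼 z, f z) + δ / 2 := fun f hf =>
    le_add_of_pow_le_pow_add_pow (N := 2 ^ t) (by positivity) (hqf f hf).1 (by positivity)
      ((pow_expect_le_boxMean fun b => (hg f hf b).1).trans
        ((hbox f hf).trans (by gcongr; exact min_le_right _ _)))
  have hcompl : ∀ z, 1 - f₀ z ∈ Set.Icc (0 : ℝ) 1 := fun z =>
    ⟨by linarith [(hf₀ z).2], by linarith [(hf₀ z).1]⟩
  have hsum : 𝔼 b, 𝔼 z, f₀ z * T z b + 𝔼 b, 𝔼 z, (1 - f₀ z) * T z b = 𝔼 z, 𝔼 b, T z b := by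
    rw [← Finset.expect_add_distrib, Finset.expect_comm]
    refine Finset.expect_congr rfl fun b _ => ?_
    rw [← Finset.expect_add_distrib]
    exact Finset.expect_congr rfl fun z _ => by ring
  -- The upper bound for `1 - f₀`, subtracted from the lower bound for the total mean, is a lower
  -- bound for the mean of the contraction along `f₀`.
  have hup := upper _ hcompl
  rw [expect_one_sub] at hup
  have hmin := min_le_left (δ / 2) ((δ / 2) ^ 2 ^ t)
  have hdisc := h X (fun b => 𝔼 z, f₀ z * T z b) (q * 𝔼 z, f₀ z) (hg f₀ hf₀) (hqf f₀ hf₀)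
    (by linarith) ((hbox f₀ hf₀).trans (by linarith)) f hf
  convert hdisc using 2
  rw [Finset.expect_comm]
  refine Finset.expect_congr rfl fun b _ => ?_
  rw [Finset.mul_expect, ← Finset.expect_sub_distrib, Finset.expect_mul]
  exact Finset.expect_congr rfl fun z _ => by ring

theorem expect_prod_family {A Z : Type*} [Fintype A] [DecidableEq A] [Fintype Z] (f : Z → ℝ) :
    𝔼 x : A → Z, ∏ a, f (x a) = (𝔼 z, f z) ^ Fintype.card A := by
  rw [Fintype.expect_eq_sum_div_card, Fintype.expect_eq_sum_div_card, Fintype.card_fun,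
    div_pow, Nat.cast_pow]
  have : (∑ z, f z) ^ Fintype.card A = ∏ _a : A, ∑ z, f z := by simp
  rw [this, Finset.prod_univ_sum, Fintype.piFinset_univ]

/-- Induction on the number of variables. The box mean is the second moment of the box means `B x`
of slices, whose first moment is at least about `Q = q ^ 2 ^ t`. A second moment near `Q ^ 2` forces
`B` to concentrate at `Q`, so weighting by `∏ g (x a)` gives about `Q * (𝔼 g) ^ 2 ^ t`. This is the
box bound that `discrepancy_of_contractions` asks of every contraction. -/
theorem boxControlsDiscrepancy.{u} (t : ℕ) : BoxControlsDiscrepancy.{u} t := by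
  induction t with
  | zero =>
    refine fun ε hε => ⟨ε, hε, fun X _ _ T q hT hq h1 h2 f hf => ?_⟩
    simp only [boxMean, pow_zero, pow_one] at h2
    have hall : ∀ b, T b = T default := fun b => by rw [Subsingleton.elim b default]
    simp only [hall, univ_eq_empty, prod_empty, mul_one, Fintype.expect_const] at h1 ⊢
    rw [abs_le]; constructor <;> linarith
  | succ t ih =>
    intro ε hε
    obtain ⟨δ, hδ, h⟩ := discrepancy_of_contractions.{u, u} ih hε
    -- The factor comes from the mean square of `B - Q`: the second moment contributes `η`, and the
    -- term `-2 * Q * 𝔼 B` contributes at most `2 * 2 ^ t * η`.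
    have hc : (0 : ℝ) < 1 + 2 * 2 ^ t := by positivity
    refine ⟨min δ (δ ^ 2 / (1 + 2 * 2 ^ t)), by positivity, fun X _ _ T q hT hq h1 h2 f hf => ?_⟩
    set η := min δ (δ ^ 2 / (1 + 2 * 2 ^ t)) with hη
    have hη0 : 0 < η := by positivity
    have hη2 : (1 + 2 * 2 ^ t) * η ≤ δ ^ 2 := by
      have := min_le_right δ (δ ^ 2 / (1 + 2 * 2 ^ t))
      rw [← hη, le_div_iff₀ hc] at this
      linarith
    have key := h (X (Fin.last t)) (fun i => X i.castSucc) (fun x b => T (Fin.snoc b x)) q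
      (fun x b => hT _) hq (by rw [← expect_snoc]; linarith [min_le_left δ (δ ^ 2 / (1 + 2 * 2 ^ t))])
      ?_ (f (Fin.last t)) (fun i => f i.castSucc) (hf _) (fun i => hf _)
    · rw [expect_snoc]
      convert key using 7 with x _ b _
      rw [Fin.prod_univ_castSucc, mul_comm]
      simp
    · intro g hg
      rw [boxMean_weighted_expect]
      rw [boxMean_const_succ] at h2
      set B : ((Fin t → Bool) → X (Fin.last t)) → ℝ := fun x =>
        boxMean t (fun i => X i.castSucc) fun a b => T (Fin.snoc b (x a)) with hB
      set Q : ℝ := q ^ 2 ^ t with hQ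
      have hQ1 : Q ≤ 1 := pow_le_one₀ hq.1 hq.2
      have hQ0 : 0 ≤ Q := pow_nonneg hq.1 _
      have hEB : Q - 2 ^ t * η ≤ 𝔼 x, B x := by
        have e1 := pow_expect_le_boxMean (X := fun i : Fin t => X i.castSucc)
          (g := fun b => 𝔼 x, T (Fin.snoc b x))
          (fun b => Finset.expect_nonneg fun x _ => (hT _).1)
        rw [boxMean_expect fun (_ : Fin t → Bool) x (b : ∀ i : Fin t, X i.castSucc) =>
          T (Fin.snoc b x), Finset.expect_comm, ← expect_snoc] at e1
        have e2 := pow_sub_le_pow (Finset.expect_nonneg fun b _ => (hT b).1) hq.1 hq.2 hη0.le h1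
          (2 ^ t)
        push_cast at e2
        exact e2.trans e1
      have hvar : 𝔼 x, (B x - Q) ^ 2 ≤ δ ^ 2 := by
        have e1 : 𝔼 x, (B x - Q) ^ 2 = 𝔼 x, B x ^ 2 - 2 * Q * 𝔼 x, B x + Q ^ 2 := by
          simp only [sub_sq, Finset.expect_add_distrib, Finset.expect_sub_distrib,
            Fintype.expect_const, Finset.mul_expect]
          congr 2
          exact Finset.expect_congr rfl fun x _ => by ring
        have e2 : q ^ 2 ^ (t + 1) = Q ^ 2 := by rw [hQ, ← pow_mul, pow_succ]
        rw [e2] at h2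
        have e3 : Q * (Q - 2 ^ t * η) ≤ Q * 𝔼 x, B x := mul_le_mul_of_nonneg_left hEB hQ0
        have e4 : Q * (2 ^ t * η) ≤ 2 ^ t * η := mul_le_of_le_one_left (by positivity) hQ1
        nlinarith
      have hG : ∀ x : (Fin t → Bool) → X (Fin.last t), ∏ a, g (x a) ∈ Set.Icc (0 : ℝ) 1 := fun x =>
        ⟨Finset.prod_nonneg fun a _ => (hg _).1, Finset.prod_le_one (fun a _ => (hg _).1)
          fun a _ => (hg _).2⟩
      have hGdev : 𝔼 x, (∏ a, g (x a)) * (B x - Q) ≤ δ := by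
        refine le_of_sq_le_sq ((sq_expect_le _).trans (le_trans ?_ hvar)) hδ.le
        refine Finset.expect_le_expect fun x _ => ?_
        rw [mul_pow]
        exact mul_le_of_le_one_left (sq_nonneg _) (pow_le_one₀ (hG x).1 (hG x).2)
      have hsplit : 𝔼 x, (∏ a, g (x a)) * B x =
          𝔼 x, (∏ a, g (x a)) * (B x - Q) + (q * 𝔼 z, g z) ^ 2 ^ t := by
        have : (𝔼 z, g z) ^ 2 ^ t = 𝔼 x : (Fin t → Bool) → X (Fin.last t), ∏ a, g (x a) := by
          rw [expect_prod_family]; simp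
        rw [mul_pow, ← hQ, this, Finset.mul_expect, ← Finset.expect_add_distrib]
        exact Finset.expect_congr rfl fun x _ => by ring
      rw [hsplit]
      linarith

end Discrepancy

/-! ### Closed walks and traces of matrix powers. -/

section ClosedWalks

/-- The arbitrary weight `φ` on the two ends makes the induction work: the first edge is absorbed
into it. With `φ u v = M v u` it later closes the walk. -/
theorem sum_walks_eq_sum_pow {Y : Type*} [Fintype Y] [DecidableEq Y] (M : Matrix Y Y ℝ) (s : ℕ)
    (φ : Y → Y → ℝ) :
    ∑ y : Fin (s + 1) → Y, φ (y 0) (y (Fin.last s)) * ∏ i : Fin s, M (y i.castSucc) (y i.succ) =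
      ∑ u, ∑ v, φ u v * (M ^ s) u v := by
  induction s generalizing φ with
  | zero =>
    rw [← (Equiv.funUnique (Fin 1) Y).symm.sum_comp]
    simp [Matrix.one_apply]
  | succ s ih =>
    rw [← (Fin.consEquiv fun _ : Fin (s + 2) => Y).sum_comp, Fintype.sum_prod_type]
    refine Finset.sum_congr rfl fun u _ => ?_
    have h := ih fun w v => φ u v * M u w
    simp only [pow_succ', Matrix.mul_apply, Finset.mul_sum]
    rw [Finset.sum_comm]
    refine (Finset.sum_congr rfl fun y _ => ?_).trans (h.trans ?_)
    · rw [Fin.prod_univ_succ]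
      simp only [Fin.consEquiv_apply, Fin.cons_zero, Fin.castSucc_zero, Fin.cons_succ,
        ← Fin.succ_castSucc, ← Fin.succ_last]
      ring
    · exact Finset.sum_congr rfl fun w _ => Finset.sum_congr rfl fun v _ => by ring

theorem sum_closed_walks_eq_trace_pow {Y : Type*} [Fintype Y] [DecidableEq Y] (M : Matrix Y Y ℝ)
    (s : ℕ) :
    ∑ y : Fin (s + 1) → Y, ∏ i, M (y i) (y (finRotate (s + 1) i)) = (M ^ (s + 1)).trace := by
  have h := sum_walks_eq_sum_pow M s fun u v => M v u
  rw [pow_succ', Matrix.trace]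
  simp only [Matrix.diag, Matrix.mul_apply]
  rw [Finset.sum_comm, ← h]
  refine Finset.sum_congr rfl fun y _ => ?_
  rw [Fin.prod_univ_castSucc, finRotate_last, mul_comm]
  congr 1
  refine Finset.prod_congr rfl fun i _ => ?_
  congr 2
  rw [finRotate_apply, Fin.coeSucc_eq_succ]

end ClosedWalks

/-! ### Eigenvalue estimates from a trace bound. -/

section Spectral

/-- Weighted Hölder; the total weight may be less than one because its remaining exponent `1 - 1 /
ℓ` is nonnegative. -/
theorem sum_mul_le_of_sum_weight_pow_le {Y : Type*} [Fintype Y] {ℓ : ℕ} (hℓ : 1 ≤ ℓ)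
    {w f : Y → ℝ} (hw : ∀ i, 0 ≤ w i) (hf : ∀ i, 0 ≤ f i) (hw1 : ∑ i, w i ≤ 1) {c : ℝ}
    (hc : 0 ≤ c) (h : ∑ i, w i * f i ^ ℓ ≤ c ^ ℓ) : ∑ i, w i * f i ≤ c := by
  have h1 := Real.inner_le_weight_mul_Lp_of_nonneg univ (p := (ℓ : ℝ)) (by exact_mod_cast hℓ) w f
    hw hf
  have h2 : (∑ i, w i) ^ (1 - (ℓ : ℝ)⁻¹) ≤ 1 := by
    refine Real.rpow_le_one (Finset.sum_nonneg fun i _ => hw i) hw1 ?_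
    rw [sub_nonneg]
    exact inv_le_one_of_one_le₀ (by exact_mod_cast hℓ)
  simp only [Real.rpow_natCast] at h1
  have h0 : 0 ≤ ∑ i, w i * f i ^ ℓ :=
    Finset.sum_nonneg fun i _ => mul_nonneg (hw i) (pow_nonneg (hf i) _)
  have h3 : (∑ i, w i * f i ^ ℓ) ^ (ℓ : ℝ)⁻¹ ≤ c := by
    calc _ ≤ (c ^ ℓ) ^ (ℓ : ℝ)⁻¹ := Real.rpow_le_rpow h0 h (by positivity)
      _ = c := Real.pow_rpow_inv_natCast hc (by omega)
  calc _ ≤ _ := h1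
    _ ≤ 1 * c := mul_le_mul h2 h3 (Real.rpow_nonneg h0 _) zero_le_one
    _ = c := one_mul c

/-- Here `a` and `b` stand for the eigenbasis coordinates of the normalised constant vector and of a
vector orthogonal to it. Jensen shows that the weights `a i ^ 2` already account for nearly all of
`∑ μ i ^ (2 * ℓ)`; since `a i ^ 2 + b i ^ 2 ≤ 1`, little is left for the weights `b i ^ 2`. Hence `∑
b i ^ 2 * μ i ^ 2` is small, and Cauchy–Schwarz bounds every term of the quadratic form that
involves `b`. -/
theorem eigenvalue_sum_bound.{u} {ℓ : ℕ} (hℓ : 1 ≤ ℓ) {ε : ℝ} (hε : 0 < ε) :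
    ∃ δ : ℝ, 0 < δ ∧ ∀ (Y : Type u) [Fintype Y] (μ a b : Y → ℝ) (q m : ℝ),
      q ∈ Set.Icc (0 : ℝ) 1 → m ∈ Set.Icc (0 : ℝ) 1 → (∀ i, a i ^ 2 + b i ^ 2 ≤ 1) →
      ∑ i, a i ^ 2 = 1 → ∑ i, b i ^ 2 ≤ 1 → 0 ≤ ∑ i, a i ^ 2 * μ i →
      q - δ ≤ ∑ i, a i ^ 2 * μ i → ∑ i, μ i ^ (2 * ℓ) ≤ q ^ (2 * ℓ) + δ →
      ∑ i, μ i * (m * a i + b i) ^ 2 ≤ q * m ^ 2 + ε := by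
  set θ := ε / 4 with hθ
  have hθ0 : 0 < θ := by positivity
  have hℓ' : (0 : ℝ) < 2 * ℓ + 1 := by positivity
  -- The divisor `2 * ℓ + 1` collects a loss `2 * ℓ * δ` from raising the mean bound to the power `2
  -- * ℓ` and a loss `δ` from the trace bound.
  refine ⟨min (θ ^ (2 * ℓ)) ((θ ^ 2) ^ ℓ / (2 * ℓ + 1)), by positivity, ?_⟩
  intro Y _ μ a b q m hq hm hab ha hb h0 h1 h2
  set δ := min (θ ^ (2 * ℓ)) ((θ ^ 2) ^ ℓ / (2 * ℓ + 1)) with hδ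
  have hδ0 : 0 < δ := by positivity
  have hδ1 : δ ≤ θ ^ (2 * ℓ) := min_le_left _ _
  have hδ2 : (2 * ℓ + 1) * δ ≤ (θ ^ 2) ^ ℓ := by
    have := min_le_right (θ ^ (2 * ℓ)) ((θ ^ 2) ^ ℓ / (2 * ℓ + 1))
    rw [← hδ, le_div_iff₀ hℓ'] at this
    linarith
  have hpow : ∀ i, 0 ≤ μ i ^ (2 * ℓ) := fun i => (even_two_mul ℓ).pow_nonneg _
  have hjen : (∑ i, a i ^ 2 * μ i) ^ (2 * ℓ) ≤ ∑ i, a i ^ 2 * μ i ^ (2 * ℓ) :=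
    Real.pow_arith_mean_le_arith_mean_pow_of_even univ _ _ (fun i _ => sq_nonneg _) ha
      (even_two_mul ℓ)
  have hlow := pow_sub_le_pow h0 hq.1 hq.2 hδ0.le h1 (2 * ℓ)
  have htot : ∑ i, a i ^ 2 * μ i ^ (2 * ℓ) + ∑ i, b i ^ 2 * μ i ^ (2 * ℓ) ≤
      ∑ i, μ i ^ (2 * ℓ) := by
    rw [← Finset.sum_add_distrib]
    refine Finset.sum_le_sum fun i _ => ?_
    rw [← add_mul]
    exact mul_le_of_le_one_left (hpow i) (hab i)
  have hb0 : 0 ≤ ∑ i, b i ^ 2 * μ i ^ (2 * ℓ) :=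
    Finset.sum_nonneg fun i _ => mul_nonneg (sq_nonneg _) (hpow i)
  have htop : ∑ i, a i ^ 2 * μ i ≤ q + θ :=
    le_add_of_pow_le_pow_add_pow (N := 2 * ℓ) (by omega) hq.1 hθ0.le (by linarith)
  have hbμ : ∑ i, b i ^ 2 * μ i ^ 2 ≤ θ ^ 2 := by
    refine sum_mul_le_of_sum_weight_pow_le hℓ (fun i => sq_nonneg _) (fun i => sq_nonneg _) hb
      (by positivity) ?_
    simp only [← pow_mul (μ _)]
    refine le_trans ?_ hδ2
    push_cast at hlow
    linarith
  -- Taking `c = a` handles the mixed term, and `c = b` the pure one.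
  have hcs : ∀ c : Y → ℝ, ∑ i, c i ^ 2 ≤ 1 → ∑ i, c i * (b i * μ i) ≤ θ := fun c hc => by
    refine le_of_sq_le_sq ?_ hθ0.le
    refine (Finset.sum_mul_sq_le_sq_mul_sq univ c fun i => b i * μ i).trans ?_
    simp only [mul_pow]
    exact mul_le_of_le_one_left (Finset.sum_nonneg fun i _ => by positivity) hc |>.trans hbμ
  have e1 := hcs a ha.le
  have e2 := hcs b hb
  have hexp : ∑ i, μ i * (m * a i + b i) ^ 2 = m ^ 2 * ∑ i, a i ^ 2 * μ i +
      2 * m * ∑ i, a i * (b i * μ i) + ∑ i, b i * (b i * μ i) := by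
    rw [Finset.mul_sum, Finset.mul_sum, ← Finset.sum_add_distrib, ← Finset.sum_add_distrib]
    exact Finset.sum_congr rfl fun i _ => by ring
  rw [hexp]
  have e3 : m ^ 2 * ∑ i, a i ^ 2 * μ i ≤ m ^ 2 * (q + θ) :=
    mul_le_mul_of_nonneg_left htop (sq_nonneg m)
  have e4 : 2 * m * ∑ i, a i * (b i * μ i) ≤ 2 * m * θ :=
    mul_le_mul_of_nonneg_left e1 (by linarith [hm.1])
  have e5 : m ^ 2 * θ ≤ θ := mul_le_of_le_one_left hθ0.le (pow_le_one₀ hm.1 hm.2)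
  have e6 : m * θ ≤ θ := mul_le_of_le_one_left hθ0.le hm.2
  rw [show ε = 4 * θ by rw [hθ]; ring]
  linarith

theorem Matrix.IsHermitian.trace_pow_eq_sum_eigenvalues {Y : Type*} [Fintype Y] [DecidableEq Y]
    {M : Matrix Y Y ℝ} (hM : M.IsHermitian) (s : ℕ) :
    (M ^ s).trace = ∑ i, hM.eigenvalues i ^ s := by
  conv_lhs => rw [hM.spectral_theorem]
  rw [← map_pow, Matrix.diagonal_pow, Unitary.conjStarAlgAut_apply, Matrix.trace_mul_comm,
    ← mul_assoc, Unitary.coe_star_mul_self, one_mul, Matrix.trace_diagonal]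
  simp

theorem Matrix.IsHermitian.inner_toEuclideanLin_eq_sum {Y : Type*} [Fintype Y] [DecidableEq Y]
    {M : Matrix Y Y ℝ} (hM : M.IsHermitian) (x : EuclideanSpace ℝ Y) :
    ∑ u, ∑ v, x u * M u v * x v =
      ∑ i, hM.eigenvalues i * inner ℝ (hM.eigenvectorBasis i) x ^ 2 := by
  have h1 : ∑ u, ∑ v, x u * M u v * x v = inner ℝ x (Matrix.toEuclideanLin M x) := by
    rw [real_inner_comm, PiLp.inner_apply]
    refine Finset.sum_congr rfl fun u _ => ?_
    simp [Matrix.toLpLin_apply, Matrix.mulVec, dotProduct, Finset.mul_sum, mul_comm, mul_assoc, mul_left_comm]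
  rw [h1, ← hM.eigenvectorBasis.sum_inner_mul_inner x]
  refine Finset.sum_congr rfl fun i _ => ?_
  have hsymm := Matrix.isSymmetric_toEuclideanLin_iff.mpr hM
  rw [← hsymm (hM.eigenvectorBasis i) x]
  have : Matrix.toEuclideanLin M (hM.eigenvectorBasis i) =
      hM.eigenvalues i • hM.eigenvectorBasis i := by
    have := hM.mulVec_eigenvectorBasis i
    ext u
    simpa [Matrix.toLpLin_apply] using congrFun this u
  rw [this, real_inner_smul_left, real_inner_comm]
  ring

end Spectral

/-! ### From closed walk densities to quadratic forms. -/

section ClosedWalkBound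

/-- Bessel's inequality for two orthogonal vectors that need not be normalised. -/
theorem sq_inner_add_sq_inner_le_one {E : Type*} [NormedAddCommGroup E] [InnerProductSpace ℝ E]
    {v x y : E} (hv : ‖v‖ = 1) (hx : ‖x‖ ≤ 1) (hy : ‖y‖ ≤ 1) (hxy : inner ℝ x y = 0) :
    inner ℝ v x ^ 2 + inner ℝ v y ^ 2 ≤ 1 := by
  set a := inner ℝ v x with ha
  set b := inner ℝ v y with hb
  have h1 : inner ℝ v (a • x + b • y) = a ^ 2 + b ^ 2 := by
    rw [inner_add_right, real_inner_smul_right, real_inner_smul_right, ← ha, ← hb]; ring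
  have h2 : ‖a • x + b • y‖ ^ 2 ≤ a ^ 2 + b ^ 2 := by
    rw [norm_add_sq_real, real_inner_smul_left, real_inner_smul_right, hxy, norm_smul, norm_smul,
      mul_pow, mul_pow, Real.norm_eq_abs, Real.norm_eq_abs, sq_abs, sq_abs]
    have := mul_le_of_le_one_right (sq_nonneg a) (pow_le_one₀ (n := 2) (norm_nonneg x) hx)
    have := mul_le_of_le_one_right (sq_nonneg b) (pow_le_one₀ (n := 2) (norm_nonneg y) hy)
    linarith
  have h3 := real_inner_le_norm v (a • x + b • y)
  rw [h1, hv, one_mul] at h3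
  by_contra! h
  nlinarith [norm_nonneg (a • x + b • y)]

/-- The function `F` is split into its mean and an orthogonal remainder, and `eigenvalue_sum_bound`
is applied to the coordinates of both in the eigenbasis of `A`. -/
theorem closed_walk_bound.{u} {ℓ : ℕ} (hℓ : 1 ≤ ℓ) {ε : ℝ} (hε : 0 < ε) :
    ∃ δ : ℝ, 0 < δ ∧ ∀ (Y : Type u) [Fintype Y] [Nonempty Y] (A : Y → Y → ℝ) (q : ℝ),
      q ∈ Set.Icc (0 : ℝ) 1 → (∀ y z, A y z = A z y) → (∀ y z, 0 ≤ A y z) →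
      q - δ ≤ 𝔼 y, 𝔼 z, A y z →
      𝔼 y : Fin (2 * ℓ) → Y, ∏ i, A (y i) (y (finRotate (2 * ℓ) i)) ≤ q ^ (2 * ℓ) + δ →
      ∀ F : Y → ℝ, (∀ y, F y ∈ Set.Icc (0 : ℝ) 1) →
        𝔼 y, 𝔼 z, F y * F z * A y z ≤ q * (𝔼 y, F y) ^ 2 + ε := by
  classical
  obtain ⟨δ, hδ, h⟩ := eigenvalue_sum_bound.{u} hℓ hε
  refine ⟨δ, hδ, fun Y _ _ A q hq hsymm hA hmean hwalk F hF => ?_⟩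
  set N : ℝ := ((Fintype.card Y : ℕ) : ℝ) with hN
  have hN0 : 0 < N := by simp [hN, Fintype.card_pos]
  have hsq : (√N)⁻¹ * (√N)⁻¹ = N⁻¹ := by rw [← mul_inv, Real.mul_self_sqrt hN0.le]
  -- The factor `N⁻¹` turns the average over closed walks into a trace; test functions are scaled by
  -- `(√N)⁻¹`, so that the constant function `1` becomes a unit vector.
  set M : Matrix Y Y ℝ := Matrix.of fun y z => N⁻¹ * A y z with hMdef
  have hM : M.IsHermitian := by
    ext y z
    simp [hMdef, hsymm y z]
  have quad : ∀ G : Y → ℝ, 𝔼 y, 𝔼 z, G y * G z * A y z = ∑ i, hM.eigenvalues i *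
      inner ℝ (hM.eigenvectorBasis i) (WithLp.toLp 2 fun y => (√N)⁻¹ * G y) ^ 2 := fun G => by
    rw [← hM.inner_toEuclideanLin_eq_sum, Fintype.expect_eq_sum_div_card, ← hN, Finset.sum_div]
    refine Finset.sum_congr rfl fun y _ => ?_
    rw [Fintype.expect_eq_sum_div_card, ← hN, div_div, Finset.sum_div]
    refine Finset.sum_congr rfl fun z _ => ?_
    simp only [hMdef, Matrix.of_apply]
    calc _ = G y * G z * A y z * (N⁻¹ * N⁻¹) := by rw [div_eq_mul_inv, mul_inv]
      _ = (√N)⁻¹ * (√N)⁻¹ * (G y * G z * A y z * N⁻¹) := by rw [hsq]; ring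
      _ = _ := by ring
  set m : ℝ := 𝔼 y, F y with hm
  have hm1 : m ∈ Set.Icc (0 : ℝ) 1 := expect_mem_Icc hF
  have hmN : ∑ y, F y = N * m := by
    rw [hm, Fintype.expect_eq_sum_div_card, ← hN]; field_simp
  set e : EuclideanSpace ℝ Y := WithLp.toLp 2 fun _ => (√N)⁻¹ * 1 with he
  set w : EuclideanSpace ℝ Y := WithLp.toLp 2 fun y => (√N)⁻¹ * F y with hw
  have hee : inner ℝ e e = (1 : ℝ) := by
    rw [PiLp.inner_apply]
    simp only [he, mul_one, RCLike.inner_apply, conj_trivial, hsq, Finset.sum_const,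
      Finset.card_univ, nsmul_eq_mul, ← hN]
    exact mul_inv_cancel₀ hN0.ne'
  have hew : inner ℝ e w = m := by
    rw [PiLp.inner_apply]
    simp only [he, hw, mul_one, RCLike.inner_apply, conj_trivial]
    calc _ = ∑ y, (√N)⁻¹ * (√N)⁻¹ * F y := Finset.sum_congr rfl fun y _ => by ring
      _ = m := by rw [← Finset.mul_sum, hmN, hsq]; field_simp
  have hww : inner ℝ w w ≤ (1 : ℝ) := by
    rw [PiLp.inner_apply]
    simp only [hw, RCLike.inner_apply, conj_trivial]
    calc _ = ∑ y, N⁻¹ * (F y * F y) := Finset.sum_congr rfl fun y _ => by rw [← hsq]; ring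
      _ ≤ ∑ y : Y, N⁻¹ * 1 := Finset.sum_le_sum fun y _ => by
          have := mul_le_one₀ (hF y).2 (hF y).1 (hF y).2
          gcongr
      _ = 1 := by simp [← hN, hN0.ne']
  have hew' : inner ℝ e (w - m • e) = 0 := by
    rw [inner_sub_right, real_inner_smul_right, hee, hew]; ring
  have hw' : ‖w - m • e‖ ≤ 1 := by
    rw [← sq_le_one_iff₀ (norm_nonneg _), ← real_inner_self_eq_norm_sq, inner_sub_left,
      real_inner_smul_left, hew', inner_sub_right, real_inner_smul_right, real_inner_comm e w, hew]
    nlinarith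
  have hnorm : ‖e‖ = 1 := by
    rw [← sq_eq_sq₀ (norm_nonneg _) zero_le_one, ← real_inner_self_eq_norm_sq, hee, one_pow]
  have parseval : ∀ x : EuclideanSpace ℝ Y,
      ∑ i, inner ℝ (hM.eigenvectorBasis i) x ^ 2 = ‖x‖ ^ 2 := fun x => by
    rw [← hM.eigenvectorBasis.sum_sq_norm_inner_right x]
    simp
  have quad1 := quad fun _ => 1
  simp only [one_mul] at quad1
  have hcomm : ∑ i, inner ℝ (hM.eigenvectorBasis i) e ^ 2 * hM.eigenvalues i =
      𝔼 y, 𝔼 z, A y z := by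
    rw [quad1]
    exact Finset.sum_congr rfl fun i _ => mul_comm _ _
  have key := h Y hM.eigenvalues (fun i => inner ℝ (hM.eigenvectorBasis i) e)
    (fun i => inner ℝ (hM.eigenvectorBasis i) (w - m • e)) q m hq hm1
    (fun i => sq_inner_add_sq_inner_le_one (hM.eigenvectorBasis.norm_eq_one i) hnorm.le hw' hew')
    (by rw [parseval, hnorm, one_pow])
    (by rw [parseval]; exact pow_le_one₀ (norm_nonneg _) hw')
    (by rw [hcomm]; exact Finset.expect_nonneg fun y _ => Finset.expect_nonneg fun z _ => hA y z)
    (by rw [hcomm]; exact hmean) ?_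
  · rw [quad F]
    refine le_trans (le_of_eq (Finset.sum_congr rfl fun i _ => ?_)) key
    rw [inner_sub_right, real_inner_smul_right]
    ring
  · rw [← hM.trace_pow_eq_sum_eigenvalues]
    obtain ⟨s, hs⟩ : ∃ s, 2 * ℓ = s + 1 := ⟨2 * ℓ - 1, by omega⟩
    rw [hs] at hwalk ⊢
    refine le_trans (le_of_eq ?_) hwalk
    rw [← sum_closed_walks_eq_trace_pow, Fintype.expect_eq_sum_div_card, Finset.sum_div]
    refine Finset.sum_congr rfl fun y _ => ?_
    simp [hMdef, Finset.prod_mul_distrib, ← hN, div_eq_inv_mul]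

end ClosedWalkBound

/-! ### Cycle density controls discrepancy. -/

section CycleDiscrepancy

/-- The matrix of the step with parameters `T`: the mean, over the values of the inner variables,
of the product of `T` over the edges of the step whose outer variables are `y` and `z`. -/
noncomputable def stepMatrix {r : ℕ} {Z : Type*} {X : Fin (r + 1) → Type*} [∀ i, Fintype (X i)]
    (T : Z → (∀ i, X i) → ℝ) (y z : (Fin r → Bool) → Z) : ℝ :=
  boxMean (r + 1) X fun a => T ((splitLastBit r Z).symm (y, z) a)

/-- Exchanging `y` and `z` flips the last bit of the string, which exchanges the two factors in the
outermost average of the box. -/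
theorem stepMatrix_comm {r : ℕ} {Z : Type*} {X : Fin (r + 1) → Type*} [∀ i, Fintype (X i)]
    (T : Z → (∀ i, X i) → ℝ) (y z : (Fin r → Bool) → Z) :
    stepMatrix T y z = stepMatrix T z y := by
  simp only [stepMatrix, boxMean, splitLastBit_symm_snoc_false, splitLastBit_symm_snoc_true]
  exact Finset.expect_congr rfl fun x _ => mul_comm _ _

/-- This connects spectra with boxes: the quadratic form of the step matrix at the product function
`∏ a, f (y a)` is the box mean of the contraction along `f`. -/
theorem expect_stepMatrix {r : ℕ} {Z : Type*} [Fintype Z] {X : Fin (r + 1) → Type*}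
    [∀ i, Fintype (X i)] (f : Z → ℝ) (T : Z → (∀ i, X i) → ℝ) :
    𝔼 y : (Fin r → Bool) → Z, 𝔼 z : (Fin r → Bool) → Z,
      (∏ a, f (y a)) * (∏ a, f (z a)) * stepMatrix T y z =
    boxMean (r + 1) X fun _ b => 𝔼 z, f z * T z b := by
  rw [boxMean_weighted_expect, expect_splitLastBit]
  refine Finset.expect_congr rfl fun y _ => Finset.expect_congr rfl fun z _ => ?_
  rw [prod_splitLastBit]
  simp only [splitLastBit_symm_snoc_false, splitLastBit_symm_snoc_true, stepMatrix]

/-- The closed walk bound is applied to the step matrix with `q = p ^ 2 ^ (r + 1)` and product test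
functions; it yields the hypothesis on contractions in `discrepancy_of_contractions`. -/
theorem discrepancy_of_cycle_density.{u, v} (r : ℕ) {ℓ : ℕ} (hℓ : 1 ≤ ℓ) {ε : ℝ} (hε : 0 < ε) :
    ∃ δ : ℝ, 0 < δ ∧ ∀ (Z : Type v) [Fintype Z] [Nonempty Z] (X : Fin (r + 1) → Type u)
      [∀ i, Fintype (X i)] [∀ i, Nonempty (X i)] (T : Z → (∀ i, X i) → ℝ) (p : ℝ),
      (∀ z b, T z b ∈ Set.Icc (0 : ℝ) 1) → p ∈ Set.Icc (0 : ℝ) 1 → p - δ ≤ 𝔼 z, 𝔼 b, T z b →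
      𝔼 y : Fin (2 * ℓ) → (Fin r → Bool) → Z, ∏ i, stepMatrix T (y i) (y (finRotate (2 * ℓ) i)) ≤
        (p ^ 2 ^ (r + 1)) ^ (2 * ℓ) + δ →
      ∀ (f₀ : Z → ℝ) (f : ∀ i, X i → ℝ), (∀ z, f₀ z ∈ Set.Icc (0 : ℝ) 1) →
        (∀ i x, f i x ∈ Set.Icc (0 : ℝ) 1) →
        |𝔼 z, 𝔼 b, (T z b - p) * (f₀ z * ∏ i, f i (b i))| ≤ ε := by
  obtain ⟨δ₁, hδ₁, h₁⟩ := discrepancy_of_contractions.{u, v} (boxControlsDiscrepancy.{u} (r + 1)) hε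
  obtain ⟨δ₂, hδ₂, h₂⟩ := closed_walk_bound.{v} hℓ hδ₁
  set N : ℝ := 2 ^ (r + 1) with hN
  have hN1 : 1 ≤ N := one_le_pow₀ one_le_two
  -- Division by `N` pays for raising the density bound `p - δ` to the power `N = 2 ^ (r + 1)`.
  refine ⟨min δ₁ (δ₂ / N), by positivity, fun Z _ _ X _ _ T p hT hp hmean hcyc => ?_⟩
  set δ := min δ₁ (δ₂ / N) with hδ
  have hδ0 : 0 < δ := by positivity
  have hδ1 : δ ≤ δ₁ := min_le_left _ _
  have hδN : N * δ ≤ δ₂ := by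
    have : δ ≤ δ₂ / N := min_le_right _ _
    rwa [le_div_iff₀ (by positivity), mul_comm] at this
  have hδ2 : δ ≤ δ₂ := (le_mul_of_one_le_left hδ0.le hN1).trans hδN
  refine h₁ Z X T p hT hp (by linarith) fun f hf => ?_
  have hE : p ^ 2 ^ (r + 1) - δ₂ ≤ 𝔼 y : (Fin r → Bool) → Z, 𝔼 z, stepMatrix T y z := by
    have e1 := expect_stepMatrix (r := r) (fun _ => 1) T
    simp only [Finset.prod_const_one, one_mul] at e1
    rw [e1]
    refine le_trans ?_ (pow_expect_le_boxMean fun b => Finset.expect_nonneg fun z _ => (hT z b).1)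
    rw [Finset.expect_comm]
    have e2 := pow_sub_le_pow (Finset.expect_nonneg fun z _ =>
      Finset.expect_nonneg fun b _ => (hT z b).1) hp.1 hp.2 hδ0.le hmean (2 ^ (r + 1))
    push_cast at e2
    rw [← hN] at e2
    linarith
  have key := h₂ ((Fin r → Bool) → Z) (stepMatrix T) (p ^ 2 ^ (r + 1))
    ⟨pow_nonneg hp.1 _, pow_le_one₀ hp.1 hp.2⟩ (stepMatrix_comm T)
    (fun y z => (boxMean_mem_Icc fun a b => hT _ b).1) hE (hcyc.trans (by linarith))
    (fun y => ∏ a, f (y a)) (fun y => ⟨Finset.prod_nonneg fun a _ => (hf _).1,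
      Finset.prod_le_one (fun a _ => (hf _).1) fun a _ => (hf _).2⟩)
  rw [expect_stepMatrix, expect_prod_family] at key
  refine key.trans (le_of_eq ?_)
  rw [mul_pow, pow_succ 2 r, pow_mul (𝔼 z, f z)]
  simp

theorem removeNth_last_snoc {n : ℕ} {α : Type*} (a : Fin n → α) (c : α) :
    Fin.removeNth (Fin.last n) (Fin.snoc a c : Fin (n + 1) → α) = a := by
  funext i
  simp [Fin.removeNth]

theorem removeNth_castSucc_snoc {n : ℕ} {α : Type*} (j : Fin (n + 1)) (a : Fin (n + 1) → α)
    (c : α) : Fin.removeNth j.castSucc (Fin.snoc a c : Fin (n + 2) → α) =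
      Fin.snoc (Fin.removeNth j a) c := by
  funext i
  refine Fin.lastCases ?_ (fun i => ?_) i
  · simp [Fin.removeNth]
  · simp [Fin.removeNth]

theorem snoc_eval_removeNth_snoc_last {r : ℕ} {X : Fin (r + 1) → Type*}
    (b : ∀ j : Fin r, (Fin r → Bool) → X j.castSucc) (x : (Fin r → Bool) → X (Fin.last r))
    (a : Fin r → Bool) (c : Bool) :
    (fun j => (Fin.snoc b x : ∀ j : Fin (r + 1), (Fin r → Bool) → X j) j
        (Fin.removeNth j (Fin.snoc a c : Fin (r + 1) → Bool))) =
      Fin.snoc (fun j : Fin r => b j (Fin.removeNth j.castSucc (Fin.snoc a c : Fin (r + 1) → Bool)))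
        (x a) := by
  funext j
  refine Fin.lastCases ?_ (fun j => ?_) j
  · rw [Fin.snoc_last, Fin.snoc_last, removeNth_last_snoc]
  · rw [Fin.snoc_castSucc, Fin.snoc_castSucc]

theorem expect_mul_expect_eq_expect_prod {α β : Type*} [Fintype α] [Fintype β] (f : α → ℝ)
    (g : β → ℝ) : (𝔼 x, f x) * 𝔼 y, g y = 𝔼 w : α × β, f w.1 * g w.2 := by
  rw [Fintype.expect_mul_expect, expect_prod_type]

/-- The recursive box is unfolded into the combinatorial step: one inner variable for each direction
`j` and each string with bit `j` removed, and one factor per edge. -/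
theorem boxMean_eq_expect {r : ℕ} {X : Fin (r + 1) → Type*} [∀ i, Fintype (X i)]
    (g : (Fin (r + 1) → Bool) → (∀ i, X i) → ℝ) :
    boxMean (r + 1) X g = 𝔼 b : ∀ j, (Fin r → Bool) → X j,
      ∏ a, g a fun j => b j (Fin.removeNth j a) := by
  induction r with
  | zero =>
    rw [expect_snoc, boxMean]
    refine Finset.expect_congr rfl fun x _ => ?_
    rw [Fintype.expect_eq_sum_div_card]
    simp only [Fintype.card_unique, Nat.cast_one, div_one, Fintype.sum_unique,
      prod_splitLastBit, Fintype.prod_unique, boxMean, snoc_eval_removeNth_snoc_last]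
    rw [Subsingleton.elim (@default (Fin 0 → Bool) Unique.instInhabited) default]
    congr!
  | succ r ih =>
    rw [expect_snoc, boxMean]
    refine Finset.expect_congr rfl fun x _ => ?_
    rw [ih, ih, expect_mul_expect_eq_expect_prod]
    refine (Fintype.expect_equiv ((Equiv.piCongrRight fun j : Fin (r + 1) =>
      splitLastBit r (X j.castSucc)).trans (Equiv.arrowProdEquivProdArrow _ _ _)) _ _
      fun b => ?_).symm
    rw [prod_splitLastBit]
    simp only [snoc_eval_removeNth_snoc_last, removeNth_castSucc_snoc]
    rfl

end CycleDiscrepancy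

/-! ### Indexings of multisets and counts of non-injective maps. -/

section Counting

theorem symOfFamily_nodup_iff {V ι : Type*} [Fintype ι] {k : ℕ} (h : Fintype.card ι = k)
    (g : ι → V) : (symOfFamily h g : Multiset V).Nodup ↔ Function.Injective g := by
  refine ⟨fun hn i j hij => ?_, fun hg => Multiset.Nodup.map hg univ.nodup⟩
  exact Multiset.inj_on_of_nodup_map hn i (mem_univ i) j (mem_univ j) hij

theorem mem_symOfFamily {V ι : Type*} [Fintype ι] {k : ℕ} (h : Fintype.card ι = k)
    (g : ι → V) (v : V) : v ∈ symOfFamily h g ↔ ∃ i, g i = v := by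
  change v ∈ (univ : Finset ι).val.map g ↔ _
  simp

theorem map_symOfFamily {V W ι : Type*} [Fintype ι] {k : ℕ} (h : Fintype.card ι = k)
    (g : ι → V) (α : V → W) : Sym.map α (symOfFamily h g) = symOfFamily h (α ∘ g) := by
  apply Subtype.ext
  change ((univ : Finset ι).val.map g).map α = (univ : Finset ι).val.map (α ∘ g)
  rw [Multiset.map_map]

theorem symOfFamily_comp_equiv {V ι ι' : Type*} [Fintype ι] [Fintype ι'] {k : ℕ}
    (h : Fintype.card ι = k) (h' : Fintype.card ι' = k) (e : ι' ≃ ι) (g : ι → V) :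
    symOfFamily h' (g ∘ e) = symOfFamily h g := by
  apply Subtype.ext
  change (univ : Finset ι').val.map (g ∘ e) = (univ : Finset ι).val.map g
  rw [← Multiset.map_map]
  congr 1
  rw [← Finset.map_univ_equiv e]
  rfl

/-- The indexings of a finite set are its bijections with the index type. -/
noncomputable def indexingsEquiv {V ι : Type*} [Fintype ι] {k : ℕ} (h : Fintype.card ι = k)
    (s : Sym V k) (hs : (s : Multiset V).Nodup) :
    {g : ι → V // symOfFamily h g = s} ≃ (ι ≃ {v // v ∈ (⟨s, hs⟩ : Finset V)}) where
  toFun g := Equiv.ofBijective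
    (fun i => ⟨g.1 i, (congrArg (fun e => g.1 i ∈ e) g.2).mp
      ((mem_symOfFamily h g.1 _).mpr ⟨i, rfl⟩)⟩)
    ⟨fun i j hij => by
        have hg : Function.Injective g.1 := by
          rw [← symOfFamily_nodup_iff h, g.2]; exact hs
        exact hg (congrArg Subtype.val hij),
      fun v => by
        have hv : v.1 ∈ symOfFamily h g.1 := (congrArg (fun e => v.1 ∈ e) g.2).mpr v.2
        obtain ⟨i, hi⟩ := (mem_symOfFamily h g.1 _).mp hv
        exact ⟨i, Subtype.ext hi⟩⟩
  invFun e := ⟨fun i => (e i).1, by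
    apply Subtype.ext
    change (univ : Finset ι).val.map (fun i => (e i).1) = s
    have h1 : (univ : Finset ι).val.map (fun i => (e i).1) =
        ((univ : Finset ι).map (e.toEmbedding.trans (Function.Embedding.subtype _))).val := rfl
    rw [h1, ← Finset.map_map, Finset.map_univ_equiv]
    have h2 : (univ : Finset {v // v ∈ (⟨s, hs⟩ : Finset V)}).map (Function.Embedding.subtype _) =
      (⟨s, hs⟩ : Finset V) := Finset.attach_map_val
    rw [h2]⟩
  left_inv g := rfl
  right_inv e := by ext; rfl

open Classical in
theorem card_indexings {V ι : Type*} [Fintype ι] [DecidableEq ι] [Fintype V] {k : ℕ} (h : Fintype.card ι = k)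
    (s : Sym V k) (hs : (s : Multiset V).Nodup) :
    #{g : ι → V | symOfFamily h g = s} = k.factorial := by
  have h1 : Fintype.card {v // v ∈ (⟨s, hs⟩ : Finset V)} = k := by
    rw [Fintype.card_coe]
    exact s.2
  rw [← Fintype.card_subtype, Fintype.card_congr (indexingsEquiv h s hs),
    Fintype.card_equiv (Fintype.equivOfCardEq (h.trans h1.symm)), h]

open Classical in
theorem card_injective_functions {V ι : Type*} [Fintype ι] [DecidableEq ι] [Fintype V] :
    #{g : ι → V | Function.Injective g} = (Fintype.card V).descFactorial (Fintype.card ι) := by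
  rw [← Fintype.card_subtype, Fintype.card_congr (Equiv.subtypeInjectiveEquivEmbedding ι V),
    Fintype.card_embedding_eq]

open Classical in
theorem card_not_injective_functions {V ι : Type*} [Fintype ι] [DecidableEq ι] [Fintype V] :
    (#{g : ι → V | ¬ Function.Injective g} : ℝ) =
      (Fintype.card V : ℝ) ^ Fintype.card ι -
        ((Fintype.card V).descFactorial (Fintype.card ι) : ℝ) := by
  have h := Finset.card_filter_add_card_filter_not (s := (univ : Finset (ι → V)))
    (p := Function.Injective)
  rw [card_injective_functions, Finset.card_univ, Fintype.card_fun] at h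
  rw [← Nat.cast_pow, ← h]
  push_cast
  ring

theorem eventually_pow_sub_descFactorial_le (c : ℕ) {ε : ℝ} (hε : 0 < ε) :
    ∀ᶠ n : ℕ in atTop, (n : ℝ) ^ c - (n.descFactorial c : ℝ) ≤ ε * (n : ℝ) ^ c := by
  have h := (isEquivalent_descFactorial c).isLittleO
  filter_upwards [h.bound hε] with n hn
  rw [Real.norm_of_nonneg (by positivity : (0 : ℝ) ≤ (n : ℝ) ^ c)] at hn
  have := neg_abs_le ((n.descFactorial c : ℝ) - (n : ℝ) ^ c)
  simp only [Pi.sub_apply, Real.norm_eq_abs] at hn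
  linarith

theorem eventually_multichoose_le (k : ℕ) {ε : ℝ} (hε : 0 < ε) :
    ∀ᶠ n : ℕ in atTop, (k.factorial : ℝ) * (n.multichoose k : ℝ) ≤ (1 + ε) * (n : ℝ) ^ k := by
  have h1 : Tendsto (fun n : ℕ => (1 + (k : ℝ) / n) ^ k) atTop (nhds ((1 + 0) ^ k)) :=
    ((tendsto_const_div_atTop_nhds_zero_nat (k : ℝ)).const_add 1).pow k
  rw [add_zero, one_pow] at h1
  filter_upwards [h1.eventually (gt_mem_nhds (show (1 : ℝ) < 1 + ε by linarith)),
    eventually_gt_atTop 0] with n hn hn0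
  have hn0' : (0 : ℝ) < n := by exact_mod_cast hn0
  have h2 : k.factorial * n.multichoose k ≤ (n + k) ^ k := by
    rw [Nat.multichoose_eq, ← Nat.descFactorial_eq_factorial_mul_choose]
    exact (Nat.descFactorial_le_pow _ _).trans (Nat.pow_le_pow_left (Nat.sub_le _ _) _)
  calc (k.factorial : ℝ) * (n.multichoose k : ℝ) ≤ ((n : ℝ) + k) ^ k := by exact_mod_cast h2
    _ = (1 + (k : ℝ) / n) ^ k * (n : ℝ) ^ k := by
      rw [← mul_pow]; congr 1; field_simp
    _ ≤ (1 + ε) * (n : ℝ) ^ k := by gcongr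

end Counting

/-! ### Edge counts versus averages over tuples. -/

section Density

open Classical in
/-- The indicator function of the edge set. -/
noncomputable def LoopHypergraph.edgeIndicator {V : Type*} {k : ℕ} (H : LoopHypergraph V k)
    (e : Sym V k) : ℝ :=
  if e ∈ H.edges then 1 else 0

theorem LoopHypergraph.edgeIndicator_mem_Icc {V : Type*} {k : ℕ} (H : LoopHypergraph V k)
    (e : Sym V k) : H.edgeIndicator e ∈ Set.Icc (0 : ℝ) 1 := by
  unfold LoopHypergraph.edgeIndicator
  split_ifs <;> simp

theorem LoopHypergraph.sum_edgeIndicator {V : Type*} [Fintype V] {k : ℕ}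
    (H : LoopHypergraph V k) [Fintype (Sym V k)] :
    ∑ e, H.edgeIndicator e = (H.edges.ncard : ℝ) := by
  classical
  unfold LoopHypergraph.edgeIndicator
  rw [Finset.sum_boole, Set.ncard_eq_toFinset_card', ← Set.filter_mem_univ_eq_toFinset]

/-- A multiset without repetition has exactly `k !` indexings and contributes no error. Each
remaining one is charged its number of indexings plus `k !`; summing these charges over all repeated
multisets gives the right-hand side, which is `o(n ^ k)`. -/
theorem abs_sum_edgeIndicator_sub_le {V ι : Type*} [Fintype ι] [DecidableEq ι] [Fintype V] {k : ℕ}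
    (h : Fintype.card ι = k) (H : LoopHypergraph V k) :
    |∑ g : ι → V, H.edgeIndicator (symOfFamily h g) - k.factorial * (H.edges.ncard : ℝ)| ≤
      (Fintype.card V : ℝ) ^ k + k.factorial * ((Fintype.card V).multichoose k : ℝ) -
        2 * ((Fintype.card V).descFactorial k : ℝ) := by
  classical
  set c : Sym V k → ℝ := fun e => (#{g : ι → V | symOfFamily h g = e} : ℝ) with hc
  have hc1 : ∀ e : Sym V k, (e : Multiset V).Nodup → c e = k.factorial := fun e he => by
    simp only [hc]; exact_mod_cast card_indexings h e he
  have hfib : ∀ F : Sym V k → ℝ, ∑ g : ι → V, F (symOfFamily h g) = ∑ e, c e * F e := fun F => by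
    rw [← Finset.sum_fiberwise univ (fun g : ι → V => symOfFamily h g)]
    refine Finset.sum_congr rfl fun e _ => ?_
    rw [Finset.sum_congr rfl (g := fun _ => F e) fun g hg => by
      rw [(Finset.mem_filter.mp hg).2], Finset.sum_const, nsmul_eq_mul]
  have htot : ∑ e, c e = (Fintype.card V : ℝ) ^ k := by
    have := hfib fun _ => 1
    simp only [mul_one] at this
    rw [← this]
    simp [h]
  have hnodup : ∑ e : Sym V k, (if (e : Multiset V).Nodup then c e else 0) =
      ((Fintype.card V).descFactorial k : ℝ) := by
    have := hfib fun e => if (e : Multiset V).Nodup then 1 else 0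
    simp only [mul_ite, mul_one, mul_zero] at this
    rw [← this]
    simp only [symOfFamily_nodup_iff]
    rw [Finset.sum_boole, card_injective_functions, h]
  have hcard : ∑ _e : Sym V k, (k.factorial : ℝ) =
      k.factorial * ((Fintype.card V).multichoose k : ℝ) := by
    rw [Finset.sum_const, Finset.card_univ, Sym.card_sym_eq_multichoose, nsmul_eq_mul, mul_comm]
  rw [hfib, ← H.sum_edgeIndicator, Finset.mul_sum, ← Finset.sum_sub_distrib]
  calc _ ≤ ∑ e, |c e * H.edgeIndicator e - k.factorial * H.edgeIndicator e| :=
        Finset.abs_sum_le_sum_abs _ _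
    _ ≤ ∑ e : Sym V k, (c e + k.factorial - 2 * (if (e : Multiset V).Nodup then c e else 0)) := by
      refine Finset.sum_le_sum fun e _ => ?_
      rw [← sub_mul, abs_mul, abs_of_nonneg (H.edgeIndicator_mem_Icc e).1]
      refine (mul_le_of_le_one_right (abs_nonneg _) (H.edgeIndicator_mem_Icc e).2).trans ?_
      split_ifs with he
      · rw [hc1 e he]; simp; linarith
      · have h1 : 0 ≤ c e := Nat.cast_nonneg _
        have h2 : (0 : ℝ) ≤ k.factorial := Nat.cast_nonneg _
        rw [abs_le]; constructor <;> linarith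
    _ = _ := by
      rw [Finset.sum_sub_distrib, Finset.sum_add_distrib, ← Finset.mul_sum, htot, hcard, hnodup]

theorem eventually_abs_sum_edgeIndicator_sub_le {ι : Type*} [Fintype ι] [DecidableEq ι] {k : ℕ}
    (h : Fintype.card ι = k) {V : ℕ → Type*} [∀ n, Fintype (V n)]
    (hV : ∀ n, Fintype.card (V n) = n) (H : ∀ n, LoopHypergraph (V n) k) {ε : ℝ} (hε : 0 < ε) :
    ∀ᶠ n : ℕ in atTop, |∑ g : ι → V n, (H n).edgeIndicator (symOfFamily h g) -
      k.factorial * ((H n).edges.ncard : ℝ)| ≤ ε * (n : ℝ) ^ k := by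
  filter_upwards [eventually_multichoose_le k (half_pos hε),
    eventually_pow_sub_descFactorial_le k (show 0 < ε / 4 by positivity)] with n h1 h2
  refine (abs_sum_edgeIndicator_sub_le h (H n)).trans ?_
  rw [hV]
  linarith

theorem eventually_le_edge_density {k : ℕ} {V : ℕ → Type*} (H : ∀ n, LoopHypergraph (V n) k)
    {p : ℝ} (hp1 : p ≤ 1)
    (hH : ∃ err : ℕ → ℝ, (err =o[atTop] fun n : ℕ => (n : ℝ) ^ k) ∧
      ∀ n, p * (n.choose k : ℝ) + err n ≤ ((H n).edges.ncard : ℝ)) {ε : ℝ} (hε : 0 < ε) :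
    ∀ᶠ n : ℕ in atTop, p - ε ≤ (k.factorial : ℝ) * ((H n).edges.ncard : ℝ) / (n : ℝ) ^ k := by
  obtain ⟨err, herr, hle⟩ := hH
  have hk : (0 : ℝ) < k.factorial := by exact_mod_cast k.factorial_pos
  filter_upwards [herr.bound (show 0 < ε / 2 / k.factorial by positivity),
    eventually_pow_sub_descFactorial_le k (half_pos hε), eventually_gt_atTop 0] with n h1 h2 hn
  have hn0 : (0 : ℝ) < (n : ℝ) ^ k := by positivity
  rw [le_div_iff₀ hn0]
  rw [Real.norm_of_nonneg hn0.le, Real.norm_eq_abs] at h1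
  have h3 := mul_le_mul_of_nonneg_left h1 hk.le
  rw [← mul_assoc, mul_div_cancel₀ _ hk.ne'] at h3
  have h4 := mul_le_mul_of_nonneg_left (neg_abs_le (err n)) hk.le
  have h5 := mul_le_mul_of_nonneg_left (hle n) hk.le
  have h6 : (k.factorial : ℝ) * (n.choose k : ℝ) = (n.descFactorial k : ℝ) := by
    rw [Nat.descFactorial_eq_factorial_mul_choose]; push_cast; ring
  have h7 : p * ((n : ℝ) ^ k - n.descFactorial k) ≤ ε / 2 * (n : ℝ) ^ k := by
    have : (n.descFactorial k : ℝ) ≤ (n : ℝ) ^ k := by exact_mod_cast Nat.descFactorial_le_pow n k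
    refine le_trans (mul_le_of_le_one_left (by linarith) hp1) h2
  rw [mul_add, mul_left_comm, h6] at h5
  linarith

end Density

/-! ### Edges of the cycle and their intersections. -/

section CycleEdges

theorem PartOrdering.part_pos {k t : ℕ} {π : Nat.Partition k} (κ : PartOrdering π t) (i : Fin t) :
    0 < κ.part i :=
  π.parts_pos (by rw [← κ.map_part]; exact Multiset.mem_map_of_mem _ (mem_univ i))

/-- The vertex of the cycle in a given slot of the edge with string `a` of the `i`-th step. -/
def cycleSlot {k r : ℕ} {π : Nat.Partition k} (κ : PartOrdering π (r + 2)) (s : ℕ)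
    (e : Fin s × (Fin (r + 1) → Bool)) (x : Σ i : Fin (r + 2), Fin (κ.part i)) : CycleVertex κ s :=
  glueStep κ s e.1 (stepEdgeVertex κ e.2 x)

/-- The edge with string `a` of the `i`-th step of the cycle. -/
def cycleEdge {k r : ℕ} {π : Nat.Partition k} (κ : PartOrdering π (r + 2)) (s : ℕ)
    (e : Fin s × (Fin (r + 1) → Bool)) : Sym (CycleVertex κ s) k :=
  symOfFamily κ.card_slots (cycleSlot κ s e)

variable {k r : ℕ} {π : Nat.Partition k} (κ : PartOrdering π (r + 2)) (s : ℕ)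

theorem range_cycleEdge : Set.range (cycleEdge κ s) = (cycleHypergraph κ s).edges := by
  ext e
  constructor
  · rintro ⟨⟨i, a⟩, rfl⟩
    exact ⟨i, _, ⟨a, rfl⟩, (map_symOfFamily _ _ _).symm⟩
  · rintro ⟨i, _, ⟨a, rfl⟩, rfl⟩
    exact ⟨(i, a), (map_symOfFamily _ _ _).symm⟩

theorem cycleSlot_zero (e : Fin s × (Fin (r + 1) → Bool)) (c : Fin (κ.part 0)) :
    cycleSlot κ s e ⟨0, c⟩ =
      Sum.inl (if e.2 (Fin.last r) then finRotate s e.1 else e.1, Fin.init e.2, c) := rfl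

theorem cycleSlot_succ (e : Fin s × (Fin (r + 1) → Bool)) (j : Fin (r + 1))
    (c : Fin (κ.part j.succ)) :
    cycleSlot κ s e ⟨j.succ, c⟩ = Sum.inr (e.1, ⟨j, (Fin.removeNth j e.2, c)⟩) := rfl

theorem slot_cases {P : (Σ i : Fin (r + 2), Fin (κ.part i)) → Prop} (h0 : ∀ c, P ⟨0, c⟩)
    (hs : ∀ j c, P ⟨Fin.succ j, c⟩) (x) : P x := by
  obtain ⟨i, c⟩ := x
  induction i using Fin.cases with
  | zero => exact h0 c
  | succ j => exact hs j c

theorem cycleSlot_injective (e : Fin s × (Fin (r + 1) → Bool)) :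
    Function.Injective (cycleSlot κ s e) := by
  intro x
  induction x using slot_cases with
  | h0 c =>
    intro y
    induction y using slot_cases with
    | h0 d =>
      intro h
      simp only [cycleSlot_zero, Sum.inl.injEq, Prod.mk.injEq, true_and] at h
      rw [h]
    | hs j d => intro h; simp [cycleSlot_zero, cycleSlot_succ] at h
  | hs i c =>
    intro y
    induction y using slot_cases with
    | h0 d => intro h; simp [cycleSlot_zero, cycleSlot_succ] at h
    | hs j d =>
      intro h
      simp only [cycleSlot_succ, Sum.inr.injEq, Prod.mk.injEq, true_and, Sigma.mk.injEq] at h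
      obtain ⟨rfl, h⟩ := h
      simp only [heq_eq_eq, Prod.mk.injEq, true_and] at h
      rw [h]

theorem eq_of_removeNth_eq {n : ℕ} {α : Type*} {i j : Fin (n + 1)} (hij : i ≠ j)
    {a a' : Fin (n + 1) → α} (hi : Fin.removeNth i a = Fin.removeNth i a')
    (hj : Fin.removeNth j a = Fin.removeNth j a') : a = a' := by
  funext x
  by_cases hx : x = i
  · obtain ⟨m, hm⟩ := Fin.exists_succAbove_eq (show x ≠ j from hx ▸ hij)
    have := congrFun hj m
    simpa only [Fin.removeNth_apply, hm] using this
  · obtain ⟨m, hm⟩ := Fin.exists_succAbove_eq hx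
    have := congrFun hi m
    simpa only [Fin.removeNth_apply, hm] using this

theorem finRotate_ne_self {s : ℕ} (hs : 2 ≤ s) (i : Fin s) : finRotate s i ≠ i := by
  obtain ⟨m, rfl⟩ : ∃ m, s = m + 2 := ⟨s - 2, by omega⟩
  rw [finRotate_apply]
  simp

/-- Edges from different steps can share only outer vertices, which lie in part `0`. Within one
step, distinct strings agree after removal of a bit for at most one position, and they share no
outer vertex because the two ends of a step are disjoint when `2 ≤ s`. -/
theorem exists_common_slot (hs : 2 ≤ s) {e e' : Fin s × (Fin (r + 1) → Bool)} (hne : e ≠ e') :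
    ∃ i : Fin (r + 2), ∀ x x', cycleSlot κ s e x = cycleSlot κ s e' x' → x.1 = i ∧ x'.1 = i := by
  obtain ⟨m, a⟩ := e
  obtain ⟨m', a'⟩ := e'
  by_cases hm : m = m'
  · subst hm
    have haa : a ≠ a' := fun h => hne (by rw [h])
    have hmain : ∃ i : Fin (r + 2), ∀ j : Fin (r + 1),
        Fin.removeNth j a = Fin.removeNth j a' → j.succ = i := by
      by_cases h : ∃ j : Fin (r + 1), Fin.removeNth j a = Fin.removeNth j a'
      · obtain ⟨j, hj⟩ := h
        refine ⟨j.succ, fun j' hj' => ?_⟩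
        by_contra hjj
        exact haa (eq_of_removeNth_eq (fun h => hjj (by rw [h])) hj' hj)
      · exact ⟨0, fun j hj => absurd ⟨j, hj⟩ h⟩
    obtain ⟨i, hi⟩ := hmain
    refine ⟨i, fun x x' => ?_⟩
    induction x using slot_cases with
    | h0 c =>
      induction x' using slot_cases with
      | h0 d =>
        intro h
        simp only [cycleSlot_zero, Sum.inl.injEq, Prod.mk.injEq] at h
        obtain ⟨h1, h2, -⟩ := h
        refine absurd ?_ haa
        rw [← Fin.snoc_init_self a, ← Fin.snoc_init_self a', h2]
        congr 1
        have := finRotate_ne_self hs m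
        revert h1
        cases a (Fin.last r) <;> cases a' (Fin.last r) <;> intro h1
        exacts [rfl, absurd h1.symm this, absurd h1 this, rfl]
      | hs j d => intro h; simp [cycleSlot_zero, cycleSlot_succ] at h
    | hs j c =>
      induction x' using slot_cases with
      | h0 d => intro h; simp [cycleSlot_zero, cycleSlot_succ] at h
      | hs j' d =>
        intro h
        simp only [cycleSlot_succ, Sum.inr.injEq, Prod.mk.injEq, true_and, Sigma.mk.injEq] at h
        obtain ⟨rfl, h⟩ := h
        simp only [heq_eq_eq, Prod.mk.injEq] at h
        exact ⟨hi _ h.1, hi _ h.1⟩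
  · refine ⟨0, fun x x' => ?_⟩
    induction x using slot_cases with
    | h0 c =>
      induction x' using slot_cases with
      | h0 d => exact fun _ => ⟨rfl, rfl⟩
      | hs j d => intro h; simp [cycleSlot_zero, cycleSlot_succ] at h
    | hs j c =>
      induction x' using slot_cases with
      | h0 d => intro h; simp [cycleSlot_zero, cycleSlot_succ] at h
      | hs j' d => intro h; simp [cycleSlot_succ, hm] at h

theorem mem_cycleEdge (e : Fin s × (Fin (r + 1) → Bool)) (v : CycleVertex κ s) :
    v ∈ cycleEdge κ s e ↔ ∃ x, cycleSlot κ s e x = v :=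
  mem_symOfFamily _ _ _

/-- There are at least two parts, all nonempty, so equal edges would meet in more than one part. -/
theorem cycleEdge_injective (hs : 2 ≤ s) : Function.Injective (cycleEdge κ s) := by
  intro e e' h
  by_contra hne
  obtain ⟨i, hi⟩ := exists_common_slot κ s hs hne
  obtain ⟨j, hj⟩ := exists_ne i
  have hmem : cycleSlot κ s e ⟨j, ⟨0, κ.part_pos j⟩⟩ ∈ cycleEdge κ s e' := by
    rw [← h, mem_cycleEdge]; exact ⟨_, rfl⟩
  rw [mem_cycleEdge] at hmem
  obtain ⟨x', hx'⟩ := hmem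
  exact hj (hi _ _ hx'.symm).1

theorem ncard_cycleHypergraph_edges (hs : 2 ≤ s) :
    (cycleHypergraph κ s).edges.ncard = s * 2 ^ (r + 1) := by
  rw [← range_cycleEdge, ← Set.image_univ, Set.ncard_image_of_injective _ (cycleEdge_injective κ s hs),
    Set.ncard_univ, Nat.card_eq_fintype_card]
  simp

theorem cycleHypergraph_loopless : (cycleHypergraph κ s).Loopless := by
  intro e he
  rw [← range_cycleEdge] at he
  obtain ⟨e, rfl⟩ := he
  exact (symOfFamily_nodup_iff _ _).mpr (cycleSlot_injective κ s e)

end CycleEdges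

/-! ### Labeled copies versus homomorphisms. -/

section Homomorphisms

theorem LoopHypergraph.prod_edgeIndicator {U V J : Type*} [Fintype J] {k : ℕ}
    (F : LoopHypergraph U k) (H : LoopHypergraph V k) (E : J → Sym U k)
    (hE : Set.range E = F.edges) (α : U → V) [Decidable (∀ e ∈ F.edges, Sym.map α e ∈ H.edges)] :
    ∏ j, H.edgeIndicator (Sym.map α (E j)) =
      if ∀ e ∈ F.edges, Sym.map α e ∈ H.edges then 1 else 0 := by
  classical
  unfold LoopHypergraph.edgeIndicator
  rw [Finset.prod_boole]
  congr 1
  rw [← hE]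
  simp

/-- The numbers of homomorphisms and of labeled copies differ by at most the number of maps that
are not injective. -/
theorem LoopHypergraph.ncard_labeledCopies_bounds {U V J : Type*} [Fintype U] [DecidableEq U]
    [Fintype V] [Fintype J] {k : ℕ}
    (F : LoopHypergraph U k) (H : LoopHypergraph V k) (E : J → Sym U k)
    (hE : Set.range E = F.edges) :
    ((F.labeledCopies H).ncard : ℝ) ≤ ∑ α : U → V, ∏ j, H.edgeIndicator (Sym.map α (E j)) ∧
    ∑ α : U → V, ∏ j, H.edgeIndicator (Sym.map α (E j)) ≤ ((F.labeledCopies H).ncard : ℝ) +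
      ((Fintype.card V : ℝ) ^ Fintype.card U - (Fintype.card V).descFactorial (Fintype.card U)) := by
  classical
  have h1 : ((F.labeledCopies H).ncard : ℝ) = ∑ α : U → V,
      if Function.Injective α ∧ ∀ e ∈ F.edges, Sym.map α e ∈ H.edges then (1 : ℝ) else 0 := by
    rw [Finset.sum_boole, ← Set.ncard_coe_finset]
    congr 2
    ext α
    simp [LoopHypergraph.labeledCopies]
  have h2 : (Fintype.card V : ℝ) ^ Fintype.card U -
      (Fintype.card V).descFactorial (Fintype.card U) =
        ∑ α : U → V, if ¬ Function.Injective α then (1 : ℝ) else 0 := by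
    rw [Finset.sum_boole, card_not_injective_functions]
  simp only [F.prod_edgeIndicator H E hE]
  rw [h1, h2, ← Finset.sum_add_distrib]
  constructor <;> refine Finset.sum_le_sum fun α _ => ?_ <;> split_ifs <;>
    first | (exfalso; tauto) | norm_num

end Homomorphisms

/-! ### The central condition: discrepancy of the block tensor. -/

section Quasirandom

/-- The indicator function of the edges, as a function of `t` blocks of vertices. -/
noncomputable def blockTensor {V : Type*} {k t : ℕ} {π : Nat.Partition k} (κ : PartOrdering π t)
    (H : LoopHypergraph V k) (u : ∀ i, Fin (κ.part i) → V) : ℝ :=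
  H.edgeIndicator (symOfFamily κ.card_slots fun x => u x.1 x.2)

theorem blockTensor_mem_Icc {V : Type*} {k t : ℕ} {π : Nat.Partition k} (κ : PartOrdering π t)
    (H : LoopHypergraph V k) (u : ∀ i, Fin (κ.part i) → V) :
    blockTensor κ H u ∈ Set.Icc (0 : ℝ) 1 :=
  H.edgeIndicator_mem_Icc _

/-- The discrepancies of the block tensors from the constant `p` tend to zero. -/
def IsQuasirandom {k t : ℕ} {π : Nat.Partition k} (κ : PartOrdering π t) (p : ℝ)
    {V : ℕ → Type*} [∀ n, Fintype (V n)] (H : ∀ n, LoopHypergraph (V n) k) : Prop :=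
  ∀ ε : ℝ, 0 < ε → ∀ᶠ n in atTop, DiscrepancyLE p ε (blockTensor κ (H n))

theorem PartOrdering.card_blocks {k t : ℕ} {π : Nat.Partition k} (κ : PartOrdering π t)
    (V : Type*) [Fintype V] :
    Fintype.card (∀ i, Fin (κ.part i) → V) = Fintype.card V ^ k := by
  rw [Fintype.card_pi]
  simp [Finset.prod_pow_eq_pow_sum, κ.sum_part]

theorem sum_blockTensor {V : Type*} [Fintype V] {k t : ℕ} {π : Nat.Partition k}
    (κ : PartOrdering π t) (H : LoopHypergraph V k) :
    ∑ u, blockTensor κ H u = ∑ g : (Σ i, Fin (κ.part i)) → V,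
      H.edgeIndicator (symOfFamily κ.card_slots g) :=
  (Fintype.sum_equiv (Equiv.piCurry fun i (_ : Fin (κ.part i)) => V) _ _ fun _ => rfl).symm

theorem expect_blockTensor {V : Type*} [Fintype V] {k t : ℕ} {π : Nat.Partition k}
    (κ : PartOrdering π t) (H : LoopHypergraph V k) :
    𝔼 u, blockTensor κ H u = (∑ g : (Σ i, Fin (κ.part i)) → V,
      H.edgeIndicator (symOfFamily κ.card_slots g)) / (Fintype.card V : ℝ) ^ k := by
  rw [Fintype.expect_eq_sum_div_card, κ.card_blocks, sum_blockTensor, Nat.cast_pow]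

theorem eventually_abs_expect_blockTensor_sub_le {k t : ℕ} {π : Nat.Partition k}
    (κ : PartOrdering π t) {V : ℕ → Type*} [∀ n, Fintype (V n)]
    (hV : ∀ n, Fintype.card (V n) = n) (H : ∀ n, LoopHypergraph (V n) k) {ε : ℝ} (hε : 0 < ε) :
    ∀ᶠ n : ℕ in atTop, |𝔼 u, blockTensor κ (H n) u -
      k.factorial * ((H n).edges.ncard : ℝ) / (n : ℝ) ^ k| ≤ ε := by
  filter_upwards [eventually_abs_sum_edgeIndicator_sub_le κ.card_slots hV H hε,
    eventually_gt_atTop 0] with n h hn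
  have hn0 : (0 : ℝ) < (n : ℝ) ^ k := by positivity
  rwa [expect_blockTensor, hV, ← sub_div, abs_div, abs_of_pos hn0, div_le_iff₀ hn0]

end Quasirandom

/-! ### Few cycles imply quasirandomness. -/

section CycleCounts

theorem expect_prod_expect {J B : Type*} [Fintype J] [DecidableEq J] [Fintype B]
    (f : J → B → ℝ) : ∏ j, 𝔼 b, f j b = 𝔼 b : J → B, ∏ j, f j (b j) := by
  simp only [Fintype.expect_eq_sum_div_card]
  rw [Finset.prod_div_distrib, Finset.prod_univ_sum, Fintype.piFinset_univ]
  simp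

/-- A map from the vertices of the cycle, as its values on the outer and inner vertices. -/
def cycleMapEquiv {k r : ℕ} {π : Nat.Partition k} (κ : PartOrdering π (r + 2)) (s : ℕ)
    (V : Type*) : (CycleVertex κ s → V) ≃
      (Fin s → (Fin r → Bool) → Fin (κ.part 0) → V) ×
      (Fin s → ∀ j : Fin (r + 1), (Fin r → Bool) → Fin (κ.part j.succ) → V) where
  toFun α := (fun i x c => α (Sum.inl (i, x, c)), fun i j x c => α (Sum.inr (i, ⟨j, (x, c)⟩)))
  invFun w := Sum.elim (fun v => w.1 v.1 v.2.1 v.2.2) fun v => w.2 v.1 v.2.1 v.2.2.1 v.2.2.2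
  left_inv α := by funext v; rcases v with ⟨_, _, _⟩ | ⟨_, _, _, _⟩ <;> rfl
  right_inv w := rfl

/-- Once the outer vertices are fixed, different steps involve disjoint sets of inner vertices, so
the average factors into entries of the step matrix. -/
theorem expect_cycle_hom {V : Type*} [Fintype V] {k r : ℕ} {π : Nat.Partition k}
    (κ : PartOrdering π (r + 2)) (s : ℕ) [DecidableEq (CycleVertex κ s)] (H : LoopHypergraph V k) :
    𝔼 α : CycleVertex κ s → V, ∏ e, H.edgeIndicator (Sym.map α (cycleEdge κ s e)) =
      𝔼 y : Fin s → (Fin r → Bool) → Fin (κ.part 0) → V, ∏ i,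
        stepMatrix (X := fun j : Fin (r + 1) => Fin (κ.part j.succ) → V)
          (fun z b => blockTensor κ H (Fin.cons z b)) (y i) (y (finRotate s i)) := by
  simp only [stepMatrix, boxMean_eq_expect, expect_prod_expect]
  rw [← expect_prod_type (fun w : (Fin s → (Fin r → Bool) → Fin (κ.part 0) → V) ×
      (Fin s → ∀ j : Fin (r + 1), (Fin r → Bool) → Fin (κ.part j.succ) → V) =>
    ∏ i, ∏ a, blockTensor κ H (Fin.cons ((splitLastBit r _).symm (w.1 i, w.1 (finRotate s i)) a)
      fun j => w.2 i j (Fin.removeNth j a)))]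
  refine Fintype.expect_equiv (cycleMapEquiv κ s V) _ _ fun α => ?_
  rw [Fintype.prod_prod_type]
  refine Finset.prod_congr rfl fun i _ => Finset.prod_congr rfl fun a _ => ?_
  rw [cycleEdge, map_symOfFamily, blockTensor]
  congr 2
  funext x
  induction x using slot_cases with
  | h0 c =>
    simp only [Function.comp_apply, cycleSlot_zero, Fin.cons_zero, splitLastBit, cycleMapEquiv,
      Equiv.coe_fn_symm_mk]
    split_ifs <;> rfl
  | hs j c => rfl

theorem eventually_le_of_isLittleO_bound {a b : ℕ → ℝ} {f : ℕ}
    (h : ∃ err : ℕ → ℝ, (err =o[atTop] fun n : ℕ => (n : ℝ) ^ f) ∧ ∀ n, a n ≤ b n + err n)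
    {ε : ℝ} (hε : 0 < ε) : ∀ᶠ n : ℕ in atTop, a n ≤ b n + ε * (n : ℝ) ^ f := by
  obtain ⟨err, herr, hle⟩ := h
  filter_upwards [herr.bound hε] with n hn
  rw [Real.norm_of_nonneg (by positivity : (0 : ℝ) ≤ (n : ℝ) ^ f), Real.norm_eq_abs] at hn
  linarith [hle n, le_abs_self (err n)]

theorem isQuasirandom_of_propCycle {k r : ℕ} {π : Nat.Partition k} (κ : PartOrdering π (r + 2))
    {ℓ : ℕ} (hℓ : 1 ≤ ℓ) {p : ℝ} (hp : p ∈ Set.Icc (0 : ℝ) 1)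
    {V : ℕ → Type*} [∀ n, Fintype (V n)] (hV : ∀ n, Fintype.card (V n) = n)
    (H : ∀ n, LoopHypergraph (V n) k)
    (hH : ∃ err : ℕ → ℝ, (err =o[atTop] fun n : ℕ => (n : ℝ) ^ k) ∧
      ∀ n, p * (n.choose k : ℝ) + err n ≤ ((H n).edges.ncard : ℝ))
    (h : PropCycle κ ℓ p H) : IsQuasirandom κ p H := by
  classical
  intro ε hε
  obtain ⟨δ, hδ, hdisc⟩ := discrepancy_of_cycle_density r hℓ hε
  filter_upwards [eventually_le_of_isLittleO_bound h (half_pos hδ),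
    eventually_pow_sub_descFactorial_le (Fintype.card (CycleVertex κ (2 * ℓ))) (half_pos hδ),
    eventually_le_edge_density H hp.2 hH (half_pos hδ),
    eventually_abs_expect_blockTensor_sub_le κ hV H (half_pos hδ), eventually_gt_atTop 0]
    with n h1 h2 h3 h4 hn
  have : Nonempty (V n) := Fintype.card_pos_iff.mp (by rw [hV]; exact hn)
  have hn0 : (0 : ℝ) < n := by exact_mod_cast hn
  intro f hf
  rw [expect_cons]
  have key := hdisc (Fin (κ.part 0) → V n) (fun j : Fin (r + 1) => Fin (κ.part j.succ) → V n)
    (fun z b => blockTensor κ (H n) (Fin.cons z b)) p (fun z b => blockTensor_mem_Icc _ _ _) hp ?_ ?_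
    (f 0) (fun j => f j.succ) (hf 0) (fun j => hf _)
  · convert key using 7 with z _ b _
    rw [Fin.prod_univ_succ]
    rfl
  · rw [← expect_cons (X := fun i : Fin (r + 2) => Fin (κ.part i) → V n) (blockTensor κ (H n))]
    linarith [(abs_le.mp h4).1]
  -- The hypothesis bounds injective copies only; non-injective maps add at most `δ / 2` to the
  -- density.
  · rw [← expect_cycle_hom, Fintype.expect_eq_sum_div_card, Fintype.card_fun, hV, Nat.cast_pow,
      div_le_iff₀ (by positivity)]
    have h5 := ((cycleHypergraph κ (2 * ℓ)).ncard_labeledCopies_bounds (H n) _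
      (range_cycleEdge κ (2 * ℓ))).2
    rw [hV] at h5
    rw [ncard_cycleHypergraph_edges κ (2 * ℓ) (by omega), mul_comm (2 * ℓ), pow_mul] at h1
    linarith

end CycleCounts

/-! ### Quasirandomness gives the counts of `π`-linear hypergraphs. -/

section CountingLemma

/-- A map on `U`, as its values outside of the range of an injective family of slots and its
values on the blocks of slots. -/
noncomputable def slotSplit {U V : Type*} {t : ℕ} {c : Fin t → ℕ} (e : (Σ i, Fin (c i)) → U)
    (he : Function.Injective e) :
    (U → V) ≃ ({v // v ∉ Set.range e} → V) × (∀ i, Fin (c i) → V) := by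
  classical
  exact
  { toFun := fun α => (fun v => α v.1, fun i x => α (e ⟨i, x⟩))
    invFun := fun w v => if h : v ∈ Set.range e then w.2 h.choose.1 h.choose.2 else w.1 ⟨v, h⟩
    left_inv := fun α => by
      funext v
      by_cases h : v ∈ Set.range e
      · simp only [h, dif_pos]
        exact congrArg α h.choose_spec
      · simp [h]
    right_inv := fun w => by
      refine Prod.ext (funext fun v => by simp [v.2]) (funext fun i => funext fun x => ?_)
      have h : e ⟨i, x⟩ ∈ Set.range e := ⟨_, rfl⟩
      have h2 : h.choose = ⟨i, x⟩ := he h.choose_spec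
      simp only [h, dif_pos]
      rw [h2] }

theorem slotSplit_symm_apply_slot {U V : Type*} {t : ℕ} {c : Fin t → ℕ}
    (e : (Σ i, Fin (c i)) → U) (he : Function.Injective e)
    (w : ({v // v ∉ Set.range e} → V) × (∀ i, Fin (c i) → V)) (x : Σ i, Fin (c i)) :
    (slotSplit e he).symm w (e x) = w.2 x.1 x.2 :=
  congrFun (congrFun (congrArg Prod.snd ((slotSplit e he).apply_symm_apply w)) x.1) x.2

theorem slotSplit_symm_apply_of_notMem {U V : Type*} {t : ℕ} {c : Fin t → ℕ}
    (e : (Σ i, Fin (c i)) → U) (he : Function.Injective e)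
    (w : ({v // v ∉ Set.range e} → V) × (∀ i, Fin (c i) → V)) (v : U) (hv : v ∉ Set.range e) :
    (slotSplit e he).symm w v = w.1 ⟨v, hv⟩ :=
  congrFun (congrArg Prod.fst ((slotSplit e he).apply_symm_apply w)) ⟨v, hv⟩

/-- Edges that meet a given edge within single blocks do not correlate with it. -/
theorem abs_expect_mul_prod_le {U V : Type*} [Fintype U] [DecidableEq U] [Fintype V] [Nonempty V]
    {k t m : ℕ} {π : Nat.Partition k} (κ : PartOrdering π t) (H : LoopHypergraph V k) {p ε : ℝ}
    (hd : DiscrepancyLE p ε (blockTensor κ H)) (e : (Σ i, Fin (κ.part i)) → U)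
    (he : Function.Injective e) (E : Fin m → Sym U k) (σ : Fin m → Fin t)
    (hσ : ∀ j x, e x ∈ E j → x.1 = σ j) :
    |𝔼 α : U → V, (H.edgeIndicator (Sym.map α (symOfFamily κ.card_slots e)) - p) *
      ∏ j, H.edgeIndicator (Sym.map α (E j))| ≤ ε := by
  classical
  rw [show 𝔼 α : U → V, (H.edgeIndicator (Sym.map α (symOfFamily κ.card_slots e)) - p) *
      ∏ j, H.edgeIndicator (Sym.map α (E j)) = 𝔼 w : {v // v ∉ Set.range e} → V,
      𝔼 u : ∀ i, Fin (κ.part i) → V, (H.edgeIndicator (Sym.map ((slotSplit e he).symm (w, u))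
        (symOfFamily κ.card_slots e)) - p) *
          ∏ j, H.edgeIndicator (Sym.map ((slotSplit e he).symm (w, u)) (E j)) by
    rw [← expect_prod_type (fun w : ({v // v ∉ Set.range e} → V) × (∀ i, Fin (κ.part i) → V) =>
      (H.edgeIndicator (Sym.map ((slotSplit e he).symm w) (symOfFamily κ.card_slots e)) - p) *
          ∏ j, H.edgeIndicator (Sym.map ((slotSplit e he).symm w) (E j)))]
    exact Fintype.expect_equiv (slotSplit e he) _ _ fun α => by simp]
  -- The values `w` outside the edge are frozen. An edge `E j` then depends only on block `σ j`, so
  -- the product over all `j` is a product of functions of single blocks.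
  refine (abs_expect_le_expect_abs _).trans (Finset.expect_le univ_nonempty fun w _ => ?_)
  -- Arbitrary filler for the other blocks, on which the factors collected for block `i` do not
  -- depend.
  have u₀ : ∀ i, Fin (κ.part i) → V := fun i _ => Classical.arbitrary V
  refine (le_of_eq (congrArg abs (Finset.expect_congr rfl fun u _ => ?_))).trans
    (hd (fun i z => ∏ j with σ j = i, H.edgeIndicator
      (Sym.map ((slotSplit e he).symm (w, Function.update u₀ i z)) (E j)))
    (fun i z => ⟨Finset.prod_nonneg fun j _ => (H.edgeIndicator_mem_Icc _).1,
      Finset.prod_le_one (fun j _ => (H.edgeIndicator_mem_Icc _).1)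
        fun j _ => (H.edgeIndicator_mem_Icc _).2⟩))
  congr 1
  · rw [map_symOfFamily, blockTensor]
    congr 3
    funext x
    exact slotSplit_symm_apply_slot e he _ x
  · rw [← Finset.prod_fiberwise univ σ]
    refine Finset.prod_congr rfl fun i _ => Finset.prod_congr rfl fun j hj => ?_
    congr 1
    refine Sym.map_congr fun v hv => ?_
    by_cases hve : v ∈ Set.range e
    · obtain ⟨x, rfl⟩ := hve
      rw [slotSplit_symm_apply_slot, slotSplit_symm_apply_slot]
      have hx : x.1 = i := (hσ j x hv).trans (Finset.mem_filter.mp hj).2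
      subst hx
      simp
    · rw [slotSplit_symm_apply_of_notMem _ _ _ _ hve, slotSplit_symm_apply_of_notMem _ _ _ _ hve]

theorem exists_slots {U : Type*} {k t : ℕ} {π : Nat.Partition k} (κ : PartOrdering π t)
    {e : Sym U k} (hn : (e : Multiset U).Nodup) {A : Fin t → Finset U}
    (hcard : ∀ s, (A s).card = κ.part s) (hdisj : ∀ s s', s ≠ s' → Disjoint (A s) (A s'))
    (hmem : ∀ v, v ∈ e ↔ ∃ s, v ∈ A s) :
    ∃ g : (Σ i, Fin (κ.part i)) → U, Function.Injective g ∧ symOfFamily κ.card_slots g = e ∧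
      ∀ x, g x ∈ A x.1 := by
  set g : (Σ i, Fin (κ.part i)) → U := fun x =>
    ((Finset.equivFinOfCardEq (hcard x.1)).symm x.2 : U) with hg
  have hgA : ∀ x, g x ∈ A x.1 := fun x => ((Finset.equivFinOfCardEq (hcard x.1)).symm x.2).2
  have hinj : Function.Injective g := by
    rintro ⟨i, x⟩ ⟨j, y⟩ hxy
    by_cases hij : i = j
    · subst hij
      have h1 := (Finset.equivFinOfCardEq (hcard i)).symm.injective (Subtype.ext hxy)
      exact congrArg (Sigma.mk i) h1
    · exact absurd hxy (Finset.disjoint_iff_ne.mp (hdisj i j hij) _ (hgA ⟨i, x⟩) _ (hgA ⟨j, y⟩))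
  refine ⟨g, hinj, Subtype.ext ?_, hgA⟩
  refine (Multiset.Nodup.ext ((symOfFamily_nodup_iff _ _).mpr hinj) hn).mpr fun v => ?_
  refine (mem_symOfFamily κ.card_slots g v).trans (Iff.trans ?_ (hmem v).symm)
  constructor
  · rintro ⟨x, rfl⟩; exact ⟨x.1, hgA x⟩
  · rintro ⟨s, hs⟩
    exact ⟨⟨s, Finset.equivFinOfCardEq (hcard s) ⟨v, hs⟩⟩, by simp [hg]⟩

/-- The last edge is replaced by the constant `p` at cost `ε`, and the remaining edges are handled
by induction. -/
theorem abs_expect_prod_sub_pow_le {U V : Type*} [Fintype U] [DecidableEq U] [Fintype V]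
    [Nonempty V] {k t : ℕ} {π : Nat.Partition k} (κ : PartOrdering π t) (H : LoopHypergraph V k)
    {p ε : ℝ} (hp : p ∈ Set.Icc (0 : ℝ) 1) (hd : DiscrepancyLE p ε (blockTensor κ H)) (m : ℕ)
    (E : Fin m → Sym U k) (hn : ∀ i, (E i : Multiset U).Nodup)
    (hE : ∀ i, ∃ A : Fin t → Finset U,
      (∀ s, (A s).card = κ.part s) ∧
      (∀ s s', s ≠ s' → Disjoint (A s) (A s')) ∧
      (∀ v, v ∈ E i ↔ ∃ s, v ∈ A s) ∧
      ∀ j, j < i → ∃ s, ∀ v, v ∈ E j → v ∈ E i → v ∈ A s) :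
    |𝔼 α : U → V, ∏ j, H.edgeIndicator (Sym.map α (E j)) - p ^ m| ≤ m * ε := by
  induction m with
  | zero => simp
  | succ m ih =>
    have ih' := ih (fun j => E j.castSucc) (fun j => hn _) fun i => by
      obtain ⟨A, h1, h2, h3, h4⟩ := hE i.castSucc
      exact ⟨A, h1, h2, h3, fun j hj => h4 j.castSucc (Fin.castSucc_lt_castSucc_iff.mpr hj)⟩
    obtain ⟨A, h1, h2, h3, h4⟩ := hE (Fin.last m)
    obtain ⟨g, hg, hgE, hgA⟩ := exists_slots κ (hn _) h1 h2 h3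
    choose σ hσ using fun j : Fin m => h4 j.castSucc (Fin.castSucc_lt_last j)
    have hloc := abs_expect_mul_prod_le κ H hd g hg (fun j => E j.castSucc) σ fun j x hx => by
      by_contra hne
      have hx2 := hσ j (g x) hx (by rw [← hgE, mem_symOfFamily]; exact ⟨x, rfl⟩)
      exact Finset.disjoint_left.mp (h2 _ _ hne) (hgA x) hx2
    rw [hgE] at hloc
    have hsplit : 𝔼 α : U → V, ∏ j, H.edgeIndicator (Sym.map α (E j)) =
        𝔼 α : U → V, (H.edgeIndicator (Sym.map α (E (Fin.last m))) - p) *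
          ∏ j : Fin m, H.edgeIndicator (Sym.map α (E j.castSucc)) +
        p * 𝔼 α : U → V, ∏ j : Fin m, H.edgeIndicator (Sym.map α (E j.castSucc)) := by
      rw [Finset.mul_expect, ← Finset.expect_add_distrib]
      refine Finset.expect_congr rfl fun α _ => ?_
      rw [Fin.prod_univ_castSucc]
      ring
    rw [hsplit, pow_succ']
    set x := 𝔼 α : U → V, (H.edgeIndicator (Sym.map α (E (Fin.last m))) - p) *
          ∏ j : Fin m, H.edgeIndicator (Sym.map α (E j.castSucc))
    set y := 𝔼 α : U → V, ∏ j : Fin m, H.edgeIndicator (Sym.map α (E j.castSucc))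
    have h5 : |p * (y - p ^ m)| ≤ m * ε := by
      rw [abs_mul, abs_of_nonneg hp.1]
      exact (mul_le_of_le_one_left (abs_nonneg _) hp.2).trans ih'
    calc |x + p * y - p * p ^ m| = |x + p * (y - p ^ m)| := by ring_nf
      _ ≤ |x| + |p * (y - p ^ m)| := abs_add_le _ _
      _ ≤ ε + m * ε := add_le_add hloc h5
      _ = _ := by push_cast; ring

theorem IsQuasirandom.propCount {k t : ℕ} {π : Nat.Partition k} {κ : PartOrdering π t} {p : ℝ}
    (hp : p ∈ Set.Icc (0 : ℝ) 1) {V : ℕ → Type*} [∀ n, Fintype (V n)]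
    (hV : ∀ n, Fintype.card (V n) = n) {H : ∀ n, LoopHypergraph (V n) k}
    (h : IsQuasirandom κ p H) : PropCount κ p H := by
  rintro f F hF ⟨m, E, hEinj, hErange, hE⟩
  have hm : F.edges.ncard = m := by
    rw [← hErange, ← Set.image_univ, Set.ncard_image_of_injective _ hEinj, Set.ncard_univ,
      Nat.card_eq_fintype_card, Fintype.card_fin]
  rw [isLittleO_iff]
  intro c hc
  have hm0 : (0 : ℝ) < m + 1 := by positivity
  filter_upwards [h (c / 2 / (m + 1)) (by positivity),
    eventually_pow_sub_descFactorial_le f (half_pos hc), eventually_gt_atTop 0] with n h1 h2 hn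
  have : Nonempty (V n) := Fintype.card_pos_iff.mp (by rw [hV]; exact hn)
  have hn0 : (0 : ℝ) < (n : ℝ) ^ f := by positivity
  have h3 := abs_expect_prod_sub_pow_le (U := Fin f) κ (H n) hp h1 m E
    (fun i => hF _ (hErange ▸ ⟨i, rfl⟩)) hE
  have h4 : (m : ℝ) * (c / 2 / (m + 1)) ≤ c / 2 := by
    rw [mul_div_assoc', div_le_iff₀ hm0]
    nlinarith
  obtain ⟨h5, h6⟩ := F.ncard_labeledCopies_bounds (H n) E hErange
  rw [Fintype.expect_eq_sum_div_card, Fintype.card_fun, hV, Fintype.card_fin, Nat.cast_pow] at h3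
  rw [hV, Fintype.card_fin] at h6
  rw [Real.norm_of_nonneg hn0.le, Real.norm_eq_abs, hm]
  set S := ∑ α : Fin f → V n, ∏ j, (H n).edgeIndicator (Sym.map α (E j))
  have h7 : |S - p ^ m * (n : ℝ) ^ f| ≤ c / 2 * (n : ℝ) ^ f := by
    have : S - p ^ m * (n : ℝ) ^ f = (S / (n : ℝ) ^ f - p ^ m) * (n : ℝ) ^ f := by
      field_simp
    rw [this, abs_mul, abs_of_pos hn0]
    exact mul_le_mul_of_nonneg_right (h3.trans h4) hn0.le
  rw [abs_le] at h7 ⊢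
  constructor <;> linarith

end CountingLemma

/-! ### `π`-linearity: independence of the ordering, relabelling, and cycles. -/

section PiLinear

/-- Equal multisets of values mean that corresponding fibres have equal size; bijections between the
fibres are glued. -/
theorem exists_perm_of_map_univ_eq {α β : Type*} [Fintype α] [DecidableEq β] {f g : α → β}
    (h : (univ : Finset α).val.map f = (univ : Finset α).val.map g) :
    ∃ σ : Equiv.Perm α, f = g ∘ σ := by
  have hcard : ∀ c, Fintype.card {a // f a = c} = Fintype.card {a // g a = c} := fun c => by
    have := congrArg (Multiset.count c) h
    rw [Multiset.count_map, Multiset.count_map] at this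
    rw [Fintype.card_subtype, Fintype.card_subtype]
    simp only [eq_comm (b := c)]
    exact this
  exact ⟨Equiv.ofFiberEquiv fun c => Fintype.equivOfCardEq (hcard c),
    funext fun a => (Equiv.ofFiberEquiv_map _ a).symm⟩

theorem IsPiLinear.of_ordering {U : Type*} {k t : ℕ} {π : Nat.Partition k}
    {κ κ' : PartOrdering π t} {F : LoopHypergraph U k} (h : IsPiLinear κ F) : IsPiLinear κ' F := by
  obtain ⟨σ, hσ⟩ : ∃ σ : Equiv.Perm (Fin t), κ'.part = κ.part ∘ σ := by
    exact exists_perm_of_map_univ_eq (κ'.map_part.trans κ.map_part.symm)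
  obtain ⟨m, E, h1, h2, h3⟩ := h
  refine ⟨m, E, h1, h2, fun i => ?_⟩
  obtain ⟨A, a1, a2, a3, a4⟩ := h3 i
  refine ⟨A ∘ σ, fun s => by rw [hσ]; exact a1 _, fun s s' hs => a2 _ _ fun h => hs (σ.injective h),
    fun v => (a3 v).trans ⟨fun ⟨s, hs⟩ => ⟨σ.symm s, by simpa using hs⟩, fun ⟨s, hs⟩ => ⟨σ s, hs⟩⟩,
    fun j hj => ?_⟩
  obtain ⟨s, hs⟩ := a4 j hj
  exact ⟨σ.symm s, by simpa using hs⟩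

/-- The hypergraph with the vertices renamed. -/
def LoopHypergraph.relabel {U W : Type*} {k : ℕ} (F : LoopHypergraph U k) (φ : U ≃ W) :
    LoopHypergraph W k where
  edges := Sym.map φ '' F.edges

theorem IsPiLinear.relabel {U W : Type*} {k t : ℕ} {π : Nat.Partition k} {κ : PartOrdering π t}
    {F : LoopHypergraph U k} (h : IsPiLinear κ F) (φ : U ≃ W) : IsPiLinear κ (F.relabel φ) := by
  obtain ⟨m, E, h1, h2, h3⟩ := h
  have hmem : ∀ i w, w ∈ Sym.map φ (E i) ↔ φ.symm w ∈ E i := fun i w => by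
    rw [Sym.mem_map]
    exact ⟨fun ⟨u, hu, huw⟩ => by rw [← huw]; simpa using hu, fun h => ⟨_, h, by simp⟩⟩
  refine ⟨m, fun i => Sym.map φ (E i), (Sym.map_injective φ.injective k).comp h1, ?_, fun i => ?_⟩
  · rw [LoopHypergraph.relabel, ← h2, ← Set.range_comp]; rfl
  obtain ⟨A, a1, a2, a3, a4⟩ := h3 i
  refine ⟨fun s => (A s).map φ.toEmbedding, fun s => by simp [a1], fun s s' hs => ?_, fun w => ?_,
    fun j hj => ?_⟩
  · rw [Finset.disjoint_map]; exact a2 s s' hs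
  · rw [hmem, a3]; simp [Finset.mem_map_equiv]
  · obtain ⟨s, hs⟩ := a4 j hj
    refine ⟨s, fun w h4 h5 => ?_⟩
    rw [hmem] at h4 h5
    rw [Finset.mem_map_equiv]
    exact hs _ h4 h5

theorem LoopHypergraph.Loopless.relabel {U W : Type*} {k : ℕ} {F : LoopHypergraph U k}
    (h : F.Loopless) (φ : U ≃ W) : (F.relabel φ).Loopless := by
  rintro _ ⟨e, he, rfl⟩
  exact Multiset.Nodup.map φ.injective (h e he)

theorem LoopHypergraph.ncard_relabel_edges {U W : Type*} {k : ℕ} (F : LoopHypergraph U k)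
    (φ : U ≃ W) : (F.relabel φ).edges.ncard = F.edges.ncard :=
  Set.ncard_image_of_injective _ (Sym.map_injective φ.injective k)

theorem LoopHypergraph.ncard_labeledCopies_relabel {U W V : Type*} {k : ℕ}
    (F : LoopHypergraph U k) (φ : U ≃ W) (H : LoopHypergraph V k) :
    ((F.relabel φ).labeledCopies H).ncard = (F.labeledCopies H).ncard := by
  have : (F.labeledCopies H) = (φ.symm.arrowCongr (Equiv.refl V)) '' (F.relabel φ).labeledCopies H := by
    rw [Equiv.image_eq_preimage_symm]
    ext α
    simp only [LoopHypergraph.labeledCopies, LoopHypergraph.relabel, Set.mem_ofPred_eq,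
      Set.mem_preimage, Set.forall_mem_image, Sym.map_map]
    refine and_congr ?_ (forall₂_congr fun e _ => ?_)
    · exact ⟨fun h => h.comp φ.symm.injective, fun h => by
        have := h.comp φ.injective
        simpa [Function.comp_def] using this⟩
    · have : ((φ.symm.arrowCongr (Equiv.refl V)).symm α ∘ φ) = α := by
        funext u; simp
      rw [this]
  rw [this, Set.ncard_image_of_injective _ (Equiv.injective _)]

/-- Any two distinct edges meet inside a single part, so any ordering of the edges works, with the
slots of an edge as its partition. -/
theorem cycleHypergraph_isPiLinear {k r : ℕ} {π : Nat.Partition k} (κ : PartOrdering π (r + 2))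
    {s : ℕ} (hs : 2 ≤ s) : IsPiLinear κ (cycleHypergraph κ s) := by
  classical
  set φ := (Fintype.equivFin (Fin s × (Fin (r + 1) → Bool))).symm
  refine ⟨_, fun i => cycleEdge κ s (φ i), (cycleEdge_injective κ s hs).comp φ.injective, ?_,
    fun i => ?_⟩
  · rw [← range_cycleEdge]
    exact φ.surjective.range_comp (cycleEdge κ s)
  · refine ⟨fun a => univ.image fun c => cycleSlot κ s (φ i) ⟨a, c⟩, fun a => ?_, fun a a' ha => ?_,
      fun v => ?_, fun j hj => ?_⟩
    · rw [Finset.card_image_of_injective _ fun c c' hc => by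
        simpa using cycleSlot_injective κ s _ hc]
      simp
    · rw [Finset.disjoint_left]
      intro v hv hv'
      obtain ⟨c, -, rfl⟩ := Finset.mem_image.mp hv
      obtain ⟨c', -, h⟩ := Finset.mem_image.mp hv'
      exact ha (congrArg Sigma.fst (cycleSlot_injective κ s _ h)).symm
    · rw [mem_cycleEdge]
      simp
    · obtain ⟨a, ha⟩ := exists_common_slot κ s hs
        (show φ j ≠ φ i from fun h => hj.ne (φ.injective h))
      refine ⟨a, fun v hv hv' => ?_⟩
      rw [mem_cycleEdge] at hv hv'
      obtain ⟨x, rfl⟩ := hv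
      obtain ⟨⟨b, c⟩, hx'⟩ := hv'
      obtain rfl : b = a := (ha _ _ hx'.symm).2
      exact Finset.mem_image.mpr ⟨c, mem_univ _, hx'⟩

theorem PropCount.propCycle {k r : ℕ} {π : Nat.Partition k} {κ' : PartOrdering π (r + 2)} {p : ℝ}
    {V : ℕ → Type*} {H : ∀ n, LoopHypergraph (V n) k} (h : PropCount κ' p H)
    (κ : PartOrdering π (r + 2)) {ℓ : ℕ} (hℓ : 1 ≤ ℓ) : PropCycle κ ℓ p H := by
  set φ := Fintype.equivFin (CycleVertex κ (2 * ℓ))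
  have key := h _ ((cycleHypergraph κ (2 * ℓ)).relabel φ)
    ((cycleHypergraph_loopless κ (2 * ℓ)).relabel φ)
    ((cycleHypergraph_isPiLinear κ (by omega)).of_ordering.relabel φ)
  simp only [LoopHypergraph.ncard_relabel_edges, LoopHypergraph.ncard_labeledCopies_relabel] at key
  exact ⟨_, key, fun n => by linarith⟩

end PiLinear

/-! ### Multilinear forms are extremal at indicator functions. -/

section Extremal

/-- It isolates the linear dependence on the function in one coordinate, so that this function can
be exchanged while the others stay fixed. -/
theorem sum_mul_prod_update {ι : Type*} [Fintype ι] [DecidableEq ι] {Y : ι → Type*}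
    [∀ i, Fintype (Y i)] [∀ i, DecidableEq (Y i)] (c : (∀ i, Y i) → ℝ) (f : ∀ i, Y i → ℝ) (a : ι)
    (g : Y a → ℝ) :
    ∑ s, c s * ∏ i, Function.update f a g i (s i) =
      ∑ y, g y * ∑ s with s a = y, c s * ∏ i ∈ univ.erase a, f i (s i) := by
  rw [← Finset.sum_fiberwise univ (fun s : ∀ i, Y i => s a)]
  refine Finset.sum_congr rfl fun y _ => ?_
  rw [Finset.mul_sum]
  refine Finset.sum_congr rfl fun s hs => ?_
  rw [← Finset.mul_prod_erase univ _ (mem_univ a), Function.update_self,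
    (Finset.mem_filter.mp hs).2, Finset.prod_congr rfl fun i hi => by
      rw [Function.update_of_ne (Finset.ne_of_mem_erase hi)]]
  ring

/-- A form that is multilinear in functions with values in `[0, 1]` is extremal at indicator
functions. -/
theorem abs_sum_mul_prod_le_of_indicators {ι : Type*} [Fintype ι] [DecidableEq ι] {Y : ι → Type*}
    [∀ i, Fintype (Y i)] [∀ i, DecidableEq (Y i)] (c : (∀ i, Y i) → ℝ) (D : ∀ i, Finset (Y i))
    {B : ℝ} (h : ∀ S : ∀ i, Finset (Y i), (∀ i, S i ⊆ D i) →
      |∑ s, c s * ∏ i, (if s i ∈ S i then (1 : ℝ) else 0)| ≤ B)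
    (f : ∀ i, Y i → ℝ) (hf : ∀ i y, f i y ∈ Set.Icc (0 : ℝ) 1)
    (hD : ∀ i, ∀ y ∉ D i, f i y = 0) : |∑ s, c s * ∏ i, f i (s i)| ≤ B := by
  -- The set `A` holds the coordinates not yet known to be indicators; the induction removes one of
  -- them at a time.
  suffices H : ∀ (A : Finset ι) (f : ∀ i, Y i → ℝ), (∀ i y, f i y ∈ Set.Icc (0 : ℝ) 1) →
      (∀ i, ∀ y ∉ D i, f i y = 0) →
      (∀ i ∉ A, ∃ S ⊆ D i, f i = fun y => if y ∈ S then (1 : ℝ) else 0) →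
      |∑ s, c s * ∏ i, f i (s i)| ≤ B from
    H univ f hf hD fun i hi => absurd (mem_univ i) hi
  intro A
  induction A using Finset.induction_on with
  | empty =>
    intro f hf hD hA
    choose S hS hfS using fun i => hA i (Finset.notMem_empty i)
    convert h S hS using 6 with s _ i _
    rw [hfS]
  | insert a A ha ih =>
    intro f hf hD hA
    set K : Y a → ℝ := fun y => ∑ s with s a = y, c s * ∏ i ∈ univ.erase a, f i (s i) with hK
    have hupd : ∀ S ⊆ D a, |∑ y, (if y ∈ S then (1 : ℝ) else 0) * K y| ≤ B := fun S hS => by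
      rw [hK, ← sum_mul_prod_update c f a fun y => if y ∈ S then (1 : ℝ) else 0]
      refine ih _ (fun i y => ?_) (fun i y hy => ?_) (fun i hi => ?_)
      · by_cases hia : i = a
        · subst hia; rw [Function.update_self]; split_ifs <;> simp
        · rw [Function.update_of_ne hia]; exact hf i y
      · by_cases hia : i = a
        · subst hia; rw [Function.update_self, if_neg fun h => hy (hS h)]
        · rw [Function.update_of_ne hia]; exact hD i y hy
      · by_cases hia : i = a
        · subst hia; exact ⟨S, hS, by rw [Function.update_self]⟩
        · rw [Function.update_of_ne hia]
          exact hA i fun h => (Finset.mem_insert.mp h).elim hia hi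
    have hself : ∑ s, c s * ∏ i, f i (s i) = ∑ y, f a y * K y := by
      rw [hK, ← sum_mul_prod_update c f a (f a), Function.update_eq_self]
    rw [hself, abs_le]
    constructor
    -- A linear form in `f a` is smallest at the indicator of the set where its coefficients are
    -- negative, and below it is largest where they are positive. Intersecting with `D a` is
    -- harmless since `f a` vanishes outside.
    · refine (abs_le.mp (hupd {y ∈ D a | K y < 0} (Finset.filter_subset _ _))).1.trans
        (Finset.sum_le_sum fun y _ => ?_)
      by_cases hy : y ∈ D a <;> by_cases hK0 : K y < 0
      · simp only [Finset.mem_filter, hy, hK0, and_self, if_true]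
        exact mul_le_mul_of_nonpos_right (hf a y).2 hK0.le
      · simp only [Finset.mem_filter, hK0, and_false, if_false, zero_mul]
        exact mul_nonneg (hf a y).1 (not_lt.mp hK0)
      all_goals simp [hD a y hy, hy]
    · refine (Finset.sum_le_sum fun y _ => ?_).trans
        (abs_le.mp (hupd {y ∈ D a | 0 < K y} (Finset.filter_subset _ _))).2
      by_cases hy : y ∈ D a <;> by_cases hK0 : 0 < K y
      · simp only [Finset.mem_filter, hy, hK0, and_self, if_true]
        exact mul_le_mul_of_nonneg_right (hf a y).2 hK0.le
      · simp only [Finset.mem_filter, hK0, and_false, if_false, zero_mul]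
        exact mul_nonpos_of_nonneg_of_nonpos (hf a y).1 (not_lt.mp hK0)
      all_goals simp [hD a y hy, hy]

theorem sum_comp_mul_prod {ι : Type*} [Fintype ι] [DecidableEq ι] {X Y : ι → Type*}
    [∀ i, Fintype (X i)] [∀ i, Fintype (Y i)] [∀ i, DecidableEq (Y i)] (m : ∀ i, X i → Y i)
    (c : (∀ i, Y i) → ℝ) (f : ∀ i, X i → ℝ) :
    ∑ u : ∀ i, X i, c (fun i => m i (u i)) * ∏ i, f i (u i) =
      ∑ s, c s * ∏ i, ∑ x with m i x = s i, f i x := by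
  rw [← Finset.sum_fiberwise univ (fun u : ∀ i, X i => fun i => m i (u i))]
  refine Finset.sum_congr rfl fun s _ => ?_
  rw [Finset.prod_univ_sum, Finset.mul_sum]
  refine Finset.sum_congr ?_ fun u hu => ?_
  · ext u
    simp [funext_iff]
  · rw [Fintype.mem_piFinset] at hu
    rw [show (fun i => m i (u i)) = s from funext fun i => (Finset.mem_filter.mp (hu i)).2]

end Extremal

/-! ### From tuples of vertices to sets of vertices. -/

section SetTensor

open Classical in
/-- The indicator function of the edges, as a function of `t` sets of vertices. -/
noncomputable def setTensor {V : Type*} {k t : ℕ} (H : LoopHypergraph V k)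
    (s : Fin t → Finset V) : ℝ :=
  if ∃ e ∈ H.edges, (e : Multiset V) = (univ.biUnion s).val then 1 else 0

theorem setTensor_mem_Icc {V : Type*} {k t : ℕ} (H : LoopHypergraph V k) (s : Fin t → Finset V) :
    setTensor H s ∈ Set.Icc (0 : ℝ) 1 := by
  unfold setTensor
  split_ifs <;> simp

open Classical in
theorem blockTensor_eq_setTensor {V : Type*} {k t : ℕ} {π : Nat.Partition k}
    (κ : PartOrdering π t) (H : LoopHypergraph V k) (u : ∀ i, Fin (κ.part i) → V)
    (hu : Function.Injective fun x : Σ i, Fin (κ.part i) => u x.1 x.2) :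
    blockTensor κ H u = setTensor H fun i => univ.image (u i) := by
  have hval : (symOfFamily κ.card_slots (fun x => u x.1 x.2) : Multiset V) =
      (univ.biUnion fun i => univ.image (u i)).val := by
    refine (Multiset.Nodup.ext ((symOfFamily_nodup_iff _ _).mpr hu) (Finset.nodup _)).mpr fun v => ?_
    refine (mem_symOfFamily κ.card_slots _ v).trans ?_
    rw [Finset.mem_val]
    simp
  unfold blockTensor LoopHypergraph.edgeIndicator setTensor
  congr 1
  rw [← hval]
  exact propext ⟨fun h => ⟨_, h, rfl⟩, fun ⟨e, he, h⟩ => by rwa [← Subtype.ext h]⟩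

open Classical in
theorem edgeTuples_sub_eq_sum {V : Type*} [Fintype V] {k t : ℕ} (H : LoopHypergraph V k) (p : ℝ)
    (S : Fin t → Finset (Finset V)) :
    (edgeTuples H S : ℝ) - p * ∏ i, ((S i).card : ℝ) =
      ∑ s, (setTensor H s - p) * ∏ i, (if s i ∈ S i then (1 : ℝ) else 0) := by
  simp only [sub_mul, Finset.sum_sub_distrib, ← Finset.mul_sum]
  congr 1
  · have h1 : ∀ s : Fin t → Finset V, setTensor H s * ∏ i, (if s i ∈ S i then (1 : ℝ) else 0) =
        if (∀ i, s i ∈ S i) ∧ ∃ e ∈ H.edges, (e : Multiset V) = (univ.biUnion s).val then 1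
          else 0 := fun s => by
      rw [Finset.prod_boole, setTensor]
      simp only [mem_univ, forall_const]
      rw [ite_and]
      by_cases h : ∀ i, s i ∈ S i
      · rw [if_pos h, if_pos h, mul_one]; congr
      · rw [if_neg h, if_neg h, mul_zero]
    simp only [h1]
    rw [Finset.sum_boole, ← Set.ncard_coe_finset, edgeTuples]
    congr 2
    ext s
    simp only [Finset.coe_filter, mem_univ, true_and]
  · congr 1
    have : ∀ i, ((S i).card : ℝ) = ∑ y : Finset V, (if y ∈ S i then (1 : ℝ) else 0) := fun i => by
      simp
    simp only [this]
    rw [Finset.prod_univ_sum, Fintype.piFinset_univ]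

open Classical in
theorem card_image_eq {V : Type*} [Fintype V] {m : ℕ} (s : Finset V) (hs : s.card = m) :
    #{z : Fin m → V | univ.image z = s} = m.factorial := by
  rw [← card_indexings (Fintype.card_fin m) (⟨s.val, hs⟩ : Sym V m) s.nodup]
  congr 1
  ext z
  simp only [Finset.mem_filter, mem_univ, true_and]
  constructor
  · intro h
    have hz : Function.Injective z := by
      rw [← Set.injOn_univ, ← Finset.coe_univ, ← Finset.card_image_iff, h, hs, Finset.card_univ,
        Fintype.card_fin]
    refine Subtype.ext ((Multiset.Nodup.ext ((symOfFamily_nodup_iff _ _).mpr hz) s.nodup).mpr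
      fun v => (mem_symOfFamily _ _ v).trans ?_)
    rw [Finset.mem_val, ← h]
    simp
  · intro h
    ext v
    have h1 : v ∈ symOfFamily (Fintype.card_fin m) z ↔ v ∈ s := by rw [h]; rfl
    rw [← h1, mem_symOfFamily]
    simp

open Classical in
/-- Passing from the block tensor to the set tensor changes only the terms in which some vertex is
repeated. -/
theorem abs_sum_blockTensor_sub_sum_setTensor_le {V : Type*} [Fintype V] {k t : ℕ}
    {π : Nat.Partition k} (κ : PartOrdering π t) (H : LoopHypergraph V k) {p : ℝ}
    (hp : p ∈ Set.Icc (0 : ℝ) 1) (f g : ∀ i, (Fin (κ.part i) → V) → ℝ)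
    (hf : ∀ i x, f i x ∈ Set.Icc (0 : ℝ) 1) (hg : ∀ i x, g i x ∈ Set.Icc (0 : ℝ) 1)
    (hfg : ∀ i x, Function.Injective x → f i x = g i x) :
    |∑ u, (blockTensor κ H u - p) * ∏ i, f i (u i) -
      ∑ u : ∀ i, Fin (κ.part i) → V, (setTensor H (fun i => univ.image (u i)) - p) *
        ∏ i, g i (u i)| ≤
      2 * ((Fintype.card V : ℝ) ^ k - (Fintype.card V).descFactorial k) := by
  have hone : ∀ (c : ℝ), c ∈ Set.Icc (0 : ℝ) 1 → ∀ f : ∀ i, (Fin (κ.part i) → V) → ℝ,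
      (∀ i x, f i x ∈ Set.Icc (0 : ℝ) 1) → ∀ u : ∀ i, Fin (κ.part i) → V,
      |(c - p) * ∏ i, f i (u i)| ≤ 1 := fun c hc f hf u => by
    rw [abs_mul]
    refine mul_le_one₀ ?_ (abs_nonneg _) ?_
    · rw [abs_le]; constructor <;> linarith [hc.1, hc.2, hp.1, hp.2]
    · rw [abs_of_nonneg (Finset.prod_nonneg fun i _ => (hf i _).1)]
      exact Finset.prod_le_one (fun i _ => (hf i _).1) fun i _ => (hf i _).2
  have hcount : ∑ u : ∀ i, Fin (κ.part i) → V,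
      (if ¬ Function.Injective (fun x : Σ i, Fin (κ.part i) => u x.1 x.2) then (1 : ℝ) else 0) =
      (Fintype.card V : ℝ) ^ k - (Fintype.card V).descFactorial k := by
    have := card_not_injective_functions (V := V) (ι := Σ i, Fin (κ.part i))
    rw [κ.card_slots] at this
    rw [← this, ← Finset.sum_boole]
    exact (Fintype.sum_equiv (Equiv.piCurry fun i (_ : Fin (κ.part i)) => V) _ _ fun _ => rfl).symm
  rw [← hcount, Finset.mul_sum, ← Finset.sum_sub_distrib]
  refine (Finset.abs_sum_le_sum_abs _ _).trans (Finset.sum_le_sum fun u _ => ?_)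
  by_cases hu : Function.Injective fun x : Σ i, Fin (κ.part i) => u x.1 x.2
  · have hi : ∀ i, Function.Injective (u i) := fun i x y hxy => by
      have := @hu ⟨i, x⟩ ⟨i, y⟩ hxy
      simpa using this
    rw [blockTensor_eq_setTensor κ H u hu, Finset.prod_congr rfl fun i _ => hfg i _ (hi i)]
    simp [hu]
  · simp only [hu, not_false_eq_true, if_true]
    have h1 := hone _ (blockTensor_mem_Icc κ H u) f hf u
    have h2 := hone _ (setTensor_mem_Icc H fun i => univ.image (u i)) g hg u
    refine (abs_sub _ _).trans ?_
    linarith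

end SetTensor

/-! ### Expansion is equivalent to quasirandomness. -/

section Expand

theorem propExpand_iff {k t : ℕ} {π : Nat.Partition k} {κ : PartOrdering π t} {p : ℝ}
    {V : ℕ → Type*} [∀ n, Fintype (V n)] {H : ∀ n, LoopHypergraph (V n) k} :
    PropExpand κ p H ↔ ∀ ε : ℝ, 0 < ε → ∀ᶠ n : ℕ in atTop,
      ∀ S : Fin t → Finset (Finset (V n)), (∀ i, ∀ s ∈ S i, s.card = κ.part i) →
        |(edgeTuples (H n) S : ℝ) - p * ∏ i, ((S i).card : ℝ)| ≤ ε * (n : ℝ) ^ k := by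
  classical
  constructor
  · rintro ⟨err, herr, hle⟩ ε hε
    filter_upwards [herr.bound hε] with n hn S hS
    rw [Real.norm_of_nonneg (by positivity : (0 : ℝ) ≤ (n : ℝ) ^ k), Real.norm_eq_abs] at hn
    exact (hle n S hS).trans ((le_abs_self _).trans hn)
  · intro h
    set dev : ∀ n, {S : Fin t → Finset (Finset (V n)) // ∀ i, ∀ s ∈ S i, s.card = κ.part i} → ℝ :=
      fun n S => |(edgeTuples (H n) S.1 : ℝ) - p * ∏ i, ((S.1 i).card : ℝ)| with hdev
    have hfin : ∀ n, BddAbove (Set.range (dev n)) := fun n => (Set.finite_range _).bddAbove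
    -- The uniform error is the largest deviation; for each `n` there are only finitely many choices
    -- of `S`.
    refine ⟨fun n => ⨆ S, dev n S, isLittleO_iff.mpr fun c hc => ?_, fun n S hS =>
      le_ciSup (hfin n) ⟨S, hS⟩⟩
    filter_upwards [h c hc] with n hn
    have hnonneg : 0 ≤ ⨆ S, dev n S := Real.iSup_nonneg fun S => abs_nonneg _
    rw [Real.norm_of_nonneg hnonneg, Real.norm_of_nonneg (by positivity : (0 : ℝ) ≤ (n : ℝ) ^ k)]
    exact Real.iSup_le (fun S => hn S.1 S.2) (by positivity)

theorem DiscrepancyLE.abs_sum_le {ι : Type*} [Fintype ι] {X : ι → Type*} [∀ i, Fintype (X i)]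
    [DecidableEq ι] {q ε : ℝ} {T : (∀ i, X i) → ℝ} (h : DiscrepancyLE q ε T)
    (hX : 0 < Fintype.card (∀ i, X i)) (f : ∀ i, X i → ℝ)
    (hf : ∀ i x, f i x ∈ Set.Icc (0 : ℝ) 1) :
    |∑ b, (T b - q) * ∏ i, f i (b i)| ≤ ε * Fintype.card (∀ i, X i) := by
  have h1 := h f hf
  have h2 : (0 : ℝ) < Fintype.card (∀ i, X i) := by exact_mod_cast hX
  rwa [Fintype.expect_eq_sum_div_card, abs_div, abs_of_pos h2, div_le_iff₀ h2] at h1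

theorem IsQuasirandom.propExpand {k t : ℕ} {π : Nat.Partition k} {κ : PartOrdering π t} {p : ℝ}
    (hp : p ∈ Set.Icc (0 : ℝ) 1) {V : ℕ → Type*} [∀ n, Fintype (V n)]
    (hV : ∀ n, Fintype.card (V n) = n) {H : ∀ n, LoopHypergraph (V n) k}
    (h : IsQuasirandom κ p H) : PropExpand κ p H := by
  classical
  rw [propExpand_iff]
  intro ε hε
  filter_upwards [h (ε / 2) (half_pos hε),
    eventually_pow_sub_descFactorial_le k (show 0 < ε / 4 by positivity),
    eventually_gt_atTop 0] with n h1 h2 hn S hS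
  have hcard : Fintype.card (∀ i, Fin (κ.part i) → V n) = n ^ k := by rw [κ.card_blocks, hV]
  set f : ∀ i, (Fin (κ.part i) → V n) → ℝ := fun i x => if univ.image x ∈ S i then 1 else 0 with hf
  have hf01 : ∀ i x, f i x ∈ Set.Icc (0 : ℝ) 1 := fun i x => by
    rw [hf]; dsimp only; split_ifs <;> simp
  have h3 := h1.abs_sum_le (by rw [hcard]; positivity) f hf01
  have h4 := abs_sum_blockTensor_sub_sum_setTensor_le κ (H n) hp f f hf01 hf01 fun _ _ _ => rfl
  rw [hcard, Nat.cast_pow] at h3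
  rw [hV] at h4
  have hfact : (1 : ℝ) ≤ ∏ i, ((κ.part i).factorial : ℝ) := by
    exact_mod_cast Finset.prod_pos fun i _ => (κ.part i).factorial_pos
  -- Each `k_i`-set is the image of exactly `k_i !` tuples, which produces the product of
  -- factorials.
  have hid : ∑ u : ∀ i, Fin (κ.part i) → V n, (setTensor (H n) (fun i => univ.image (u i)) - p) *
        ∏ i, f i (u i) = (∏ i, ((κ.part i).factorial : ℝ)) *
      ((edgeTuples (H n) S : ℝ) - p * ∏ i, ((S i).card : ℝ)) := by
    rw [sum_comp_mul_prod (fun i (x : Fin (κ.part i) → V n) => univ.image x)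
      (fun s => setTensor (H n) s - p) f, edgeTuples_sub_eq_sum, Finset.mul_sum]
    refine Finset.sum_congr rfl fun s _ => ?_
    rw [mul_left_comm, ← Finset.prod_mul_distrib]
    congr 1
    refine Finset.prod_congr rfl fun i _ => ?_
    rw [Finset.sum_congr rfl (g := fun _ => if s i ∈ S i then (1 : ℝ) else 0) fun x hx => by
      rw [hf]; dsimp only; rw [(Finset.mem_filter.mp hx).2], Finset.sum_const, nsmul_eq_mul]
    by_cases hs : s i ∈ S i
    · rw [card_image_eq _ (hS i _ hs)]
    · simp [hs]
  have h5 : |(edgeTuples (H n) S : ℝ) - p * ∏ i, ((S i).card : ℝ)| ≤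
      |∑ u : ∀ i, Fin (κ.part i) → V n, (setTensor (H n) (fun i => univ.image (u i)) - p) *
        ∏ i, f i (u i)| := by
    rw [hid, abs_mul, abs_of_nonneg (zero_le_one.trans hfact)]
    exact le_mul_of_one_le_left (abs_nonneg _) hfact
  refine h5.trans ?_
  rw [abs_le] at h3 h4 ⊢
  constructor <;> linarith

theorem PropExpand.isQuasirandom {k t : ℕ} {π : Nat.Partition k} {κ : PartOrdering π t} {p : ℝ}
    (hp : p ∈ Set.Icc (0 : ℝ) 1) {V : ℕ → Type*} [∀ n, Fintype (V n)]
    (hV : ∀ n, Fintype.card (V n) = n) {H : ∀ n, LoopHypergraph (V n) k}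
    (h : PropExpand κ p H) : IsQuasirandom κ p H := by
  classical
  rw [propExpand_iff] at h
  intro ε hε
  set M : ℝ := ∏ i, ((κ.part i).factorial : ℝ) with hM
  have hM0 : 0 < M := Finset.prod_pos fun i _ => by exact_mod_cast (κ.part i).factorial_pos
  filter_upwards [h (ε / 2 / M) (by positivity),
    eventually_pow_sub_descFactorial_le k (show 0 < ε / 4 by positivity),
    eventually_gt_atTop 0] with n h1 h2 hn f hf
  have hcard : Fintype.card (∀ i, Fin (κ.part i) → V n) = n ^ k := by rw [κ.card_blocks, hV]
  have hn0 : (0 : ℝ) < (n : ℝ) ^ k := by positivity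
  rw [Fintype.expect_eq_sum_div_card, hcard, Nat.cast_pow, abs_div, abs_of_pos hn0,
    div_le_iff₀ hn0]
  set g : ∀ i, (Fin (κ.part i) → V n) → ℝ := fun i x =>
    if Function.Injective x then f i x else 0 with hg
  have hg01 : ∀ i x, g i x ∈ Set.Icc (0 : ℝ) 1 := fun i x => by
    rw [hg]; dsimp only; split_ifs
    · exact hf i x
    · simp
  have h4 := abs_sum_blockTensor_sub_sum_setTensor_le κ (H n) hp f g hf hg01
    fun i x hx => by rw [hg]; exact (if_pos hx).symm
  rw [hV] at h4
  set D : Fin t → Finset (Finset (V n)) := fun i => univ.powersetCard (κ.part i) with hD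
  -- The test function is averaged over the orderings of a set. Restricting to injective tuples
  -- first makes `G i` vanish off the sets of size `k_i`, the only ones that expansion controls.
  set G : Fin t → Finset (V n) → ℝ := fun i s =>
    (∑ x : Fin (κ.part i) → V n with univ.image x = s, g i x) / (κ.part i).factorial with hG
  have hfac : ∀ i, (0 : ℝ) < (κ.part i).factorial := fun i => by
    exact_mod_cast (κ.part i).factorial_pos
  have hGD : ∀ i, ∀ s ∉ D i, G i s = 0 := fun i s hs => by
    rw [hG]
    dsimp only
    rw [Finset.sum_eq_zero, zero_div]
    intro x hx
    rw [hg]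
    refine if_neg fun hinj => hs ?_
    rw [hD, Finset.mem_powersetCard_univ, ← (Finset.mem_filter.mp hx).2,
      Finset.card_image_of_injective _ hinj, Finset.card_univ, Fintype.card_fin]
  have hG01 : ∀ i s, G i s ∈ Set.Icc (0 : ℝ) 1 := fun i s => by
    by_cases hs : s ∈ D i
    · refine ⟨div_nonneg (Finset.sum_nonneg fun x _ => (hg01 i x).1) (hfac i).le, ?_⟩
      rw [div_le_one (hfac i)]
      refine (Finset.sum_le_sum fun x _ => (hg01 i x).2).trans ?_
      rw [Finset.sum_const, card_image_eq s (Finset.mem_powersetCard_univ.mp hs), nsmul_one]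
    · rw [hGD i s hs]; simp
  have h5 := abs_sum_mul_prod_le_of_indicators (fun s => setTensor (H n) s - p) D
    (fun S hS => by
      rw [← edgeTuples_sub_eq_sum]
      exact h1 S fun i s hs => Finset.mem_powersetCard_univ.mp (hS i hs)) G hG01 hGD
  have hid : ∑ u : ∀ i, Fin (κ.part i) → V n, (setTensor (H n) (fun i => univ.image (u i)) - p) *
        ∏ i, g i (u i) = M * ∑ s, (setTensor (H n) s - p) * ∏ i, G i (s i) := by
    rw [sum_comp_mul_prod (fun i (x : Fin (κ.part i) → V n) => univ.image x)
      (fun s => setTensor (H n) s - p) g, Finset.mul_sum]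
    refine Finset.sum_congr rfl fun s _ => ?_
    rw [mul_left_comm, hM, ← Finset.prod_mul_distrib]
    congr 1
    exact Finset.prod_congr rfl fun i _ => (mul_div_cancel₀ _ (hfac i).ne').symm
  have h6 : |∑ u : ∀ i, Fin (κ.part i) → V n,
      (setTensor (H n) (fun i => univ.image (u i)) - p) * ∏ i, g i (u i)| ≤ ε / 2 * (n : ℝ) ^ k := by
    rw [hid, abs_mul, abs_of_pos hM0]
    calc _ ≤ M * (ε / 2 / M * (n : ℝ) ^ k) := mul_le_mul_of_nonneg_left h5 hM0.le
      _ = _ := by field_simp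
  rw [abs_le] at h4 h6 ⊢
  constructor <;> linarith

end Expand

/-! ### From cut bounds to bounds on unit vectors. -/

section Truncation

theorem sum_abs_le_sqrt_card {α : Type*} [Fintype α] {x : α → ℝ} (hx : ∑ w, x w ^ 2 ≤ 1) :
    ∑ w, |x w| ≤ √(Fintype.card α) := by
  refine Real.le_sqrt_of_sq_le ?_
  have h := Finset.sum_mul_sq_le_sq_mul_sq univ (fun w => |x w|) fun _ => (1 : ℝ)
  simp only [mul_one, sq_abs, one_pow, Finset.sum_const, Finset.card_univ, nsmul_eq_mul] at h
  exact h.trans (mul_le_of_le_one_left (Nat.cast_nonneg _) hx)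

theorem abs_sum_mul_prod_le_prod_sum {ι : Type*} [Fintype ι] [DecidableEq ι] {X : ι → Type*}
    [∀ i, Fintype (X i)] (c : (∀ i, X i) → ℝ) (hc : ∀ u, |c u| ≤ 1) (x : ∀ i, X i → ℝ) :
    |∑ u, c u * ∏ i, x i (u i)| ≤ ∏ i, ∑ w, |x i w| := by
  rw [Finset.prod_univ_sum, Fintype.piFinset_univ]
  refine (Finset.abs_sum_le_sum_abs _ _).trans (Finset.sum_le_sum fun u _ => ?_)
  rw [abs_mul, Finset.abs_prod]
  exact mul_le_of_le_one_left (Finset.prod_nonneg fun i _ => abs_nonneg _) (hc u)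

/-- A form with bounded coefficients that is small on products of `[0, 1]`-valued functions is
small on products of unit vectors. -/
theorem abs_sum_mul_prod_le_of_cut_bound {ι : Type*} [Fintype ι] [DecidableEq ι] {X : ι → Type*}
    [∀ i, Fintype (X i)] [∀ i, Nonempty (X i)] (c : (∀ i, X i) → ℝ) (hc : ∀ u, |c u| ≤ 1)
    {δ L : ℝ} (hL : 0 < L)
    (h : ∀ f : ∀ i, X i → ℝ, (∀ i w, f i w ∈ Set.Icc (0 : ℝ) 1) →
      |∑ u, c u * ∏ i, f i (u i)| ≤ δ * ∏ i, (Fintype.card (X i) : ℝ))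
    (x : ∀ i, X i → ℝ) (hx : ∀ i, ∑ w, x i w ^ 2 ≤ 1) :
    |∑ u, c u * ∏ i, x i (u i)| ≤
      (2 ^ Fintype.card ι * (δ * L ^ Fintype.card ι + 1 / L) - 1 / L) *
        ∏ i, √(Fintype.card (X i)) := by
  classical
  set P : ℝ := ∏ i, √(Fintype.card (X i)) with hP
  have hs : ∀ i, 0 < √(Fintype.card (X i) : ℝ) := fun i =>
    Real.sqrt_pos.mpr (by exact_mod_cast Fintype.card_pos)
  -- The cutoff is `L` times the typical size of a coordinate of a unit vector.
  set C : ι → ℝ := fun i => L / √(Fintype.card (X i)) with hC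
  have hC0 : ∀ i, 0 < C i := fun i => div_pos hL (hs i)
  -- The set `A` holds the coordinates not yet truncated. Splitting such a vector into positive
  -- part, negative part and tail gives the recursion `b ↦ 2 * b + 1 / L` with start `δ * L ^ t`,
  -- whose solution is the stated bound.
  suffices H : ∀ (A : Finset ι) (x : ∀ i, X i → ℝ), (∀ i, ∑ w, x i w ^ 2 ≤ 1) →
      (∀ i ∉ A, ∀ w, x i w ∈ Set.Icc 0 (C i)) → |∑ u, c u * ∏ i, x i (u i)| ≤
        (2 ^ #A * (δ * L ^ Fintype.card ι + 1 / L) - 1 / L) * P by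
    have := H univ x hx fun i hi => absurd (mem_univ i) hi
    rwa [Finset.card_univ] at this
  intro A
  induction A using Finset.induction_on with
  | empty =>
    intro x hx hA
    have h1 := h (fun i w => x i w / C i) fun i w => by
      have := hA i (Finset.notMem_empty i) w
      exact ⟨div_nonneg this.1 (hC0 i).le, (div_le_one (hC0 i)).mpr this.2⟩
    have h2 : ∑ u, c u * ∏ i, x i (u i) = (∏ i, C i) * ∑ u, c u * ∏ i, x i (u i) / C i := by
      rw [Finset.mul_sum]
      refine Finset.sum_congr rfl fun u _ => ?_
      rw [mul_left_comm, ← Finset.prod_mul_distrib]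
      congr 1
      exact Finset.prod_congr rfl fun i _ => (mul_div_cancel₀ _ (hC0 i).ne').symm
    have h3 : (∏ i, C i) * ∏ i, (Fintype.card (X i) : ℝ) = L ^ Fintype.card ι * P := by
      rw [← Finset.prod_mul_distrib, hP, ← Finset.card_univ, ← Finset.prod_const,
        ← Finset.prod_mul_distrib]
      refine Finset.prod_congr rfl fun i _ => ?_
      rw [hC, div_mul_eq_mul_div, div_eq_iff (hs i).ne', mul_assoc,
        Real.mul_self_sqrt (Nat.cast_nonneg _)]
    rw [h2, abs_mul, abs_of_pos (Finset.prod_pos fun i _ => hC0 i)]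
    refine (mul_le_mul_of_nonneg_left h1 (Finset.prod_nonneg fun i _ => (hC0 i).le)).trans
      (le_of_eq ?_)
    rw [mul_left_comm, h3, Finset.card_empty, pow_zero]
    ring
  | insert a A ha ih =>
    intro x hx hA
    set K : X a → ℝ := fun y => ∑ s with s a = y, c s * ∏ i ∈ univ.erase a, x i (s i) with hK
    have hform : ∀ g : X a → ℝ, ∑ u, c u * ∏ i, Function.update x a g i (u i) = ∑ y, g y * K y :=
      fun g => sum_mul_prod_update c x a g
    have hself : ∑ s, c s * ∏ i, x i (s i) = ∑ y, x a y * K y := by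
      rw [← hform, Function.update_eq_self]
    have hbdd : ∀ g : X a → ℝ, (∀ y, g y ∈ Set.Icc 0 (C a)) → (∀ y, g y ^ 2 ≤ x a y ^ 2) →
        |∑ y, g y * K y| ≤ (2 ^ #A * (δ * L ^ Fintype.card ι + 1 / L) - 1 / L) * P := by
      intro g hg hgx
      rw [← hform]
      refine ih _ (fun i => ?_) (fun i hi w => ?_)
      · by_cases hia : i = a
        · subst hia
          rw [Function.update_self]
          exact (Finset.sum_le_sum fun y _ => hgx y).trans (hx i)
        · rw [Function.update_of_ne hia]; exact hx i
      · by_cases hia : i = a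
        · subst hia; rw [Function.update_self]; exact hg w
        · rw [Function.update_of_ne hia]
          exact hA i (fun h => (Finset.mem_insert.mp h).elim hia hi) w
    -- The tail satisfies `|z| ≤ x ^ 2 / C`, so its `ℓ¹`-norm is at most `√(card) / L`; this
    -- replaces the trivial `√(card)` and gains the factor `1 / L`.
    set z : X a → ℝ := fun y => if C a < |x a y| then x a y else 0 with hz
    have hzsum : ∑ y, |z y| ≤ √(Fintype.card (X a)) / L := by
      have h1 : ∀ y, |z y| ≤ x a y ^ 2 / C a := fun y => by
        rw [hz, le_div_iff₀ (hC0 a)]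
        dsimp only
        split_ifs with hy
        · rw [← sq_abs (x a y), sq]
          exact mul_le_mul_of_nonneg_left hy.le (abs_nonneg _)
        · simp [sq_nonneg]
      refine (Finset.sum_le_sum fun y _ => h1 y).trans ?_
      rw [← Finset.sum_div]
      calc _ ≤ 1 / C a := div_le_div_of_nonneg_right (hx a) (hC0 a).le
        _ = _ := by rw [hC, one_div_div]
    have hzK : |∑ y, z y * K y| ≤ P / L := by
      rw [← hform]
      refine (abs_sum_mul_prod_le_prod_sum c hc _).trans ?_
      rw [hP, ← Finset.mul_prod_erase univ _ (mem_univ a), ← Finset.mul_prod_erase univ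
        (fun i => √(Fintype.card (X i) : ℝ)) (mem_univ a), Function.update_self, mul_div_right_comm]
      refine mul_le_mul hzsum ?_ ?_ (div_nonneg (hs a).le hL.le)
      · refine Finset.prod_le_prod (fun i _ => Finset.sum_nonneg fun w _ => abs_nonneg _)
          fun i hi => ?_
        rw [Function.update_of_ne (Finset.ne_of_mem_erase hi)]
        exact sum_abs_le_sqrt_card (hx i)
      · exact Finset.prod_nonneg fun i _ => Finset.sum_nonneg fun w _ => abs_nonneg _
    have hplus := hbdd (fun y => if 0 ≤ x a y ∧ x a y ≤ C a then x a y else 0)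
      (fun y => by
        split_ifs with hy
        · exact hy
        · exact ⟨le_rfl, (hC0 a).le⟩)
      (fun y => by split_ifs <;> simp [sq_nonneg])
    have hminus := hbdd (fun y => if x a y < 0 ∧ -x a y ≤ C a then -x a y else 0)
      (fun y => by
        split_ifs with hy
        · exact ⟨by linarith [hy.1], hy.2⟩
        · exact ⟨le_rfl, (hC0 a).le⟩)
      (fun y => by split_ifs <;> simp [sq_nonneg])
    have hsplit : ∑ y, x a y * K y =
        ∑ y, (if 0 ≤ x a y ∧ x a y ≤ C a then x a y else 0) * K y -
        ∑ y, (if x a y < 0 ∧ -x a y ≤ C a then -x a y else 0) * K y + ∑ y, z y * K y := by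
      rw [← Finset.sum_sub_distrib, ← Finset.sum_add_distrib]
      refine Finset.sum_congr rfl fun y _ => ?_
      rw [← sub_mul, ← add_mul]
      congr 1
      rw [hz]
      dsimp only
      rcases le_or_gt 0 (x a y) with h0 | h0
      · rw [abs_of_nonneg h0]
        rcases le_or_gt (x a y) (C a) with h1 | h1
        · simp [h0, h1, h0.not_gt, h1.not_gt]
        · simp [h0.not_gt, h1, h1.not_ge]
      · rw [abs_of_neg h0]
        rcases le_or_gt (-x a y) (C a) with h1 | h1
        · simp [h0, h1, h0.not_ge, h1.not_gt]
        · simp [h0.not_ge, h1, h1.not_ge]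
    rw [hself, hsplit, Finset.card_insert_of_notMem ha, pow_succ]
    have hPL : P / L = 1 / L * P := by ring
    rw [hPL] at hzK
    rw [abs_le] at hplus hminus hzK ⊢
    constructor <;> nlinarith

end Truncation

/-! ### Spectral norms in coordinates. -/

section SpectralNorm

theorem multilinearSpectralNorm_nonneg {ι : Type*} {E : ι → Type*}
    [∀ i, NormedAddCommGroup (E i)] [∀ i, NormedSpace ℝ (E i)] (φ : MultilinearMap ℝ E ℝ) :
    0 ≤ multilinearSpectralNorm φ := by
  refine Real.sSup_nonneg ?_
  rintro _ ⟨x, -, rfl⟩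
  exact abs_nonneg _

theorem multilinearSpectralNorm_le {ι : Type*} {E : ι → Type*}
    [∀ i, NormedAddCommGroup (E i)] [∀ i, NormedSpace ℝ (E i)] {φ : MultilinearMap ℝ E ℝ} {B : ℝ}
    (hB : 0 ≤ B) (h : ∀ x : ∀ i, E i, (∀ i, ‖x i‖ = 1) → |φ x| ≤ B) :
    multilinearSpectralNorm φ ≤ B := by
  refine Real.sSup_le ?_ hB
  rintro _ ⟨x, hx, rfl⟩
  exact h x hx

variable {ι : Type*} [Fintype ι] [DecidableEq ι] {X : ι → Type*} [∀ i, Fintype (X i)]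

/-- By homogeneity. The coordinate formula `hφ` is what bounds the set under the supremum: a real
`sSup` of an unbounded set would be `0`. -/
theorem abs_le_multilinearSpectralNorm_mul_prod_norm {c : (∀ i, X i) → ℝ}
    {φ : MultilinearMap ℝ (fun i => EuclideanSpace ℝ (X i)) ℝ}
    (hφ : ∀ x, φ x = ∑ u, c u * ∏ i, x i (u i)) (x : ∀ i, EuclideanSpace ℝ (X i)) :
    |φ x| ≤ multilinearSpectralNorm φ * ∏ i, ‖x i‖ := by
  have hbdd : BddAbove {c : ℝ | ∃ x : ∀ i, EuclideanSpace ℝ (X i),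
      (∀ i, ‖x i‖ = 1) ∧ c = |φ x|} := by
    refine ⟨∑ u, |c u|, ?_⟩
    rintro _ ⟨x, hx, rfl⟩
    rw [hφ]
    refine (Finset.abs_sum_le_sum_abs _ _).trans (Finset.sum_le_sum fun u _ => ?_)
    rw [abs_mul, Finset.abs_prod]
    refine mul_le_of_le_one_right (abs_nonneg _)
      (Finset.prod_le_one (fun i _ => abs_nonneg _) fun i _ => ?_)
    rw [← hx i, ← Real.norm_eq_abs]
    exact PiLp.norm_apply_le (x i) (u i)
  by_cases h0 : ∃ i, x i = 0
  · obtain ⟨i, hi⟩ := h0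
    rw [φ.map_coord_zero i hi, abs_zero]
    exact mul_nonneg (multilinearSpectralNorm_nonneg φ)
      (Finset.prod_nonneg fun i _ => norm_nonneg _)
  · push Not at h0
    have hpos : ∀ i, 0 < ‖x i‖ := fun i => norm_pos_iff.mpr (h0 i)
    have h1 : φ x = (∏ i, ‖x i‖) * φ fun i => ‖x i‖⁻¹ • x i := by
      rw [← smul_eq_mul, ← φ.map_smul_univ]
      congr 1
      funext i
      rw [smul_smul, mul_inv_cancel₀ (hpos i).ne', one_smul]
    rw [h1, abs_mul, abs_of_pos (Finset.prod_pos fun i _ => hpos i), mul_comm]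
    refine mul_le_mul_of_nonneg_right (le_csSup hbdd ⟨_, fun i => ?_, rfl⟩)
      (Finset.prod_nonneg fun i _ => norm_nonneg _)
    rw [norm_smul, norm_inv, norm_norm, inv_mul_cancel₀ (hpos i).ne']

theorem multilinearOfBasis_single {B : ι → Type*} [∀ i, Fintype (B i)] [∀ i, DecidableEq (B i)]
    (c : (∀ i, B i) → ℝ) (w : ∀ i, B i) :
    multilinearOfBasis c (fun i => EuclideanSpace.single (w i) (1 : ℝ)) = c w := by
  rw [multilinearOfBasis_apply, Finset.sum_eq_single w]
  · simp
  · intro u _ hu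
    obtain ⟨i, hi⟩ := Function.ne_iff.mp hu
    rw [Finset.prod_eq_zero (mem_univ i), mul_zero]
    simp [hi]
  · exact fun h => absurd (mem_univ w) h

theorem groupSlots_adjacencyMap_apply {V : Type*} [Fintype V] {k t : ℕ} {π : Nat.Partition k}
    (κ : PartOrdering π t) (H : LoopHypergraph V k)
    (x : ∀ i : Fin t, EuclideanSpace ℝ (Fin (κ.part i) → V)) :
    groupSlots κ (adjacencyMap H) x = ∑ u, blockTensor κ H u * ∏ i, x i (u i) := by
  classical
  rw [groupSlots, multilinearOfBasis_apply]
  refine Finset.sum_congr rfl fun u _ => ?_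
  congr 1
  rw [adjacencyMap, multilinearOfBasis_single]
  unfold blockTensor LoopHypergraph.edgeIndicator
  congr 2
  exact symOfFamily_comp_equiv κ.card_slots (Fintype.card_fin k) κ.slotEquiv.symm
    fun x => u x.1 x.2

theorem groupSlots_allOnesMap_apply {V : Type*} [Fintype V] {k t : ℕ} {π : Nat.Partition k}
    (κ : PartOrdering π t) (x : ∀ i : Fin t, EuclideanSpace ℝ (Fin (κ.part i) → V)) :
    groupSlots κ (allOnesMap V k) x =
      ∑ u : ∀ i : Fin t, Fin (κ.part i) → V, ∏ i, x i (u i) := by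
  classical
  rw [groupSlots, multilinearOfBasis_apply]
  refine Finset.sum_congr rfl fun u _ => ?_
  rw [allOnesMap, multilinearOfBasis_single, one_mul]

theorem groupSlots_sub_apply {V : Type*} [Fintype V] {k t : ℕ} {π : Nat.Partition k}
    (κ : PartOrdering π t) (H : LoopHypergraph V k) (d : ℝ)
    (x : ∀ i : Fin t, EuclideanSpace ℝ (Fin (κ.part i) → V)) :
    (groupSlots κ (adjacencyMap H) - d • groupSlots κ (allOnesMap V k)) x =
      ∑ u, (blockTensor κ H u - d) * ∏ i, x i (u i) := by
  rw [sub_apply, smul_apply, groupSlots_adjacencyMap_apply,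
    groupSlots_allOnesMap_apply, smul_eq_mul, Finset.mul_sum, ← Finset.sum_sub_distrib]
  exact Finset.sum_congr rfl fun u _ => by ring

theorem prod_sqrt_card_blocks {V : Type*} [Fintype V] {k t : ℕ} {π : Nat.Partition k}
    (κ : PartOrdering π t) :
    ∏ i, √(Fintype.card (Fin (κ.part i) → V)) = √((Fintype.card V : ℝ) ^ k) := by
  rw [← Real.sqrt_prod _ fun i _ => Nat.cast_nonneg _]
  congr 1
  rw [← Nat.cast_pow, ← κ.card_blocks, Fintype.card_pi, Nat.cast_prod]

theorem rpow_half_eq_sqrt_pow (n k : ℕ) : (n : ℝ) ^ ((k : ℝ) / 2) = √((n : ℝ) ^ k) := by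
  rw [Real.sqrt_eq_rpow, ← Real.rpow_natCast, ← Real.rpow_mul (Nat.cast_nonneg _)]
  congr 1
  ring

end SpectralNorm

/-! ### Eigenvalues, density and discrepancy. -/

section Eigenvalues

variable {V : Type*} [Fintype V] {k t : ℕ} {π : Nat.Partition k} (κ : PartOrdering π t)

theorem norm_toLp_le_sqrt_card {α : Type*} [Fintype α] {f : α → ℝ}
    (hf : ∀ w, f w ∈ Set.Icc (0 : ℝ) 1) :
    ‖(WithLp.toLp 2 f : EuclideanSpace ℝ α)‖ ≤ √(Fintype.card α) := by
  rw [EuclideanSpace.norm_eq]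
  refine Real.sqrt_le_sqrt ?_
  calc _ ≤ ∑ _w : α, (1 : ℝ) := Finset.sum_le_sum fun w _ => by
        rw [Real.norm_of_nonneg (hf w).1]
        exact pow_le_one₀ (hf w).1 (hf w).2
    _ = _ := by simp

theorem sum_sq_eq_one_of_norm_eq_one {α : Type*} [Fintype α] {x : EuclideanSpace ℝ α}
    (hx : ‖x‖ = 1) : ∑ w, x w ^ 2 = 1 := by
  have := EuclideanSpace.norm_sq_eq x
  rw [hx, one_pow] at this
  simpa using this.symm

theorem abs_sum_mul_prod_le_spectralNorm {c : (∀ i, Fin (κ.part i) → V) → ℝ}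
    {φ : MultilinearMap ℝ (fun i => EuclideanSpace ℝ (Fin (κ.part i) → V)) ℝ}
    (hφ : ∀ x, φ x = ∑ u, c u * ∏ i, x i (u i)) {f : ∀ i, (Fin (κ.part i) → V) → ℝ}
    (hf : ∀ i w, f i w ∈ Set.Icc (0 : ℝ) 1) :
    |∑ u, c u * ∏ i, f i (u i)| ≤ multilinearSpectralNorm φ * √((Fintype.card V : ℝ) ^ k) := by
  have h := abs_le_multilinearSpectralNorm_mul_prod_norm hφ fun i => WithLp.toLp 2 (f i)
  rw [hφ] at h
  refine h.trans (mul_le_mul_of_nonneg_left ?_ (multilinearSpectralNorm_nonneg φ))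
  rw [← prod_sqrt_card_blocks κ]
  exact Finset.prod_le_prod (fun i _ => norm_nonneg _) fun i _ => norm_toLp_le_sqrt_card (hf i)

/-- The form is evaluated at the all-ones vectors. -/
theorem expect_blockTensor_mul_le_lambda1 [Nonempty V] (H : LoopHypergraph V k) :
    (𝔼 u, blockTensor κ H u) * √((Fintype.card V : ℝ) ^ k) ≤ lambda1 κ H := by
  have h := abs_sum_mul_prod_le_spectralNorm κ (groupSlots_adjacencyMap_apply κ H)
    (f := fun _ _ => 1) fun _ _ => ⟨zero_le_one, le_rfl⟩
  simp only [Finset.prod_const_one, mul_one] at h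
  have hV : (0 : ℝ) < Fintype.card V := by exact_mod_cast Fintype.card_pos
  have hs : 0 < √((Fintype.card V : ℝ) ^ k) := Real.sqrt_pos.mpr (by positivity)
  have h1 : ∑ u, blockTensor κ H u = (𝔼 u, blockTensor κ H u) * √((Fintype.card V : ℝ) ^ k) *
      √((Fintype.card V : ℝ) ^ k) := by
    rw [mul_assoc, Real.mul_self_sqrt (by positivity), Fintype.expect_eq_sum_div_card,
      κ.card_blocks, Nat.cast_pow, div_mul_cancel₀ _ (by positivity)]
  rw [h1] at h
  exact le_of_mul_le_mul_right ((le_abs_self _).trans h) hs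

theorem lambda2_nonneg (H : LoopHypergraph V k) : 0 ≤ lambda2 κ H :=
  multilinearSpectralNorm_nonneg _

theorem abs_sum_prod_le_sqrt_pow (x : ∀ i, EuclideanSpace ℝ (Fin (κ.part i) → V))
    (hx : ∀ i, ‖x i‖ = 1) :
    |∑ u : ∀ i, Fin (κ.part i) → V, ∏ i, x i (u i)| ≤ √((Fintype.card V : ℝ) ^ k) := by
  have h := abs_sum_mul_prod_le_prod_sum (fun _ : ∀ i, Fin (κ.part i) → V => (1 : ℝ)) (by simp)
    fun i => x i
  simp only [one_mul] at h
  refine h.trans ?_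
  rw [← prod_sqrt_card_blocks κ]
  exact Finset.prod_le_prod (fun i _ => Finset.sum_nonneg fun w _ => abs_nonneg _)
    fun i _ => sum_abs_le_sqrt_card (sum_sq_eq_one_of_norm_eq_one (hx i)).le

theorem exists_discrepancy_bound_spectral {p : ℝ} (hp : p ∈ Set.Icc (0 : ℝ) 1) {ε : ℝ}
    (hε : 0 < ε) : ∃ δ : ℝ, 0 < δ ∧ ∀ (V : Type*) [Fintype V] [Nonempty V]
      (H : LoopHypergraph V k), DiscrepancyLE p δ (blockTensor κ H) →
      ∀ x : ∀ i, EuclideanSpace ℝ (Fin (κ.part i) → V), (∀ i, ‖x i‖ = 1) →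
        |∑ u, (blockTensor κ H u - p) * ∏ i, x i (u i)| ≤ ε * √((Fintype.card V : ℝ) ^ k) := by
  -- With this `L` and the `δ` below, both terms of the truncation bound, the cut bound and the
  -- tail, equal `ε / 2`.
  set L : ℝ := 2 * 2 ^ t / ε with hL
  have hL0 : 0 < L := by positivity
  refine ⟨ε / (2 * 2 ^ t * L ^ t), by positivity, fun V _ _ H hd x hx => ?_⟩
  have hV : (0 : ℝ) < Fintype.card V := by exact_mod_cast Fintype.card_pos
  have hcard : Fintype.card (∀ i, Fin (κ.part i) → V) = Fintype.card V ^ k := κ.card_blocks V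
  have h := abs_sum_mul_prod_le_of_cut_bound (fun u => blockTensor κ H u - p)
    (fun u => by
      have := blockTensor_mem_Icc κ H u
      rw [abs_le]; constructor <;> linarith [this.1, this.2, hp.1, hp.2]) hL0
    (fun f hf => by
      have := hd.abs_sum_le Fintype.card_pos f hf
      rwa [Fintype.card_pi, Nat.cast_prod] at this)
    (fun i => x i) fun i => (sum_sq_eq_one_of_norm_eq_one (hx i)).le
  rw [prod_sqrt_card_blocks κ, Fintype.card_fin] at h
  refine h.trans (mul_le_mul_of_nonneg_right ?_ (Real.sqrt_nonneg _))
  have h1 : 2 ^ t * (ε / (2 * 2 ^ t * L ^ t) * L ^ t + 1 / L) = ε := by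
    have e1 : ε / (2 * 2 ^ t * L ^ t) * L ^ t = ε / (2 * 2 ^ t) := by field_simp
    rw [e1, hL]
    field_simp
    ring
  rw [h1]
  linarith [one_div_pos.mpr hL0]

end Eigenvalues

/-! ### Eigenvalues are equivalent to quasirandomness. -/

section EigEquivalence

variable {k t : ℕ} {π : Nat.Partition k} {κ : PartOrdering π t} {p : ℝ}
  {V : ℕ → Type*} [∀ n, Fintype (V n)] {H : ∀ n, LoopHypergraph (V n) k}

theorem IsQuasirandom.eventually_abs_expect_sub_le (h : IsQuasirandom κ p H)
    (hV : ∀ n, Fintype.card (V n) = n) {ε : ℝ} (hε : 0 < ε) :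
    ∀ᶠ n in atTop, |𝔼 u, blockTensor κ (H n) u - p| ≤ ε := by
  filter_upwards [h ε hε, eventually_gt_atTop 0] with n hn hn0
  have : Nonempty (V n) := Fintype.card_pos_iff.mp (by rw [hV]; exact hn0)
  have h1 := hn (fun _ _ => 1) fun _ _ => ⟨zero_le_one, le_rfl⟩
  simpa only [Finset.prod_const_one, mul_one, Finset.expect_sub_distrib,
    Fintype.expect_const] using h1

theorem IsQuasirandom.propEig (hp : p ∈ Set.Icc (0 : ℝ) 1) (hV : ∀ n, Fintype.card (V n) = n)
    (h : IsQuasirandom κ p H) : PropEig κ p H := by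
  simp only [PropEig, rpow_half_eq_sqrt_pow]
  constructor
  · rw [isLittleO_iff]
    intro c hc
    obtain ⟨δ, hδ, hspec⟩ := exists_discrepancy_bound_spectral κ hp hc
    filter_upwards [h δ hδ, h.eventually_abs_expect_sub_le hV hc, eventually_gt_atTop 0]
      with n h1 h2 hn
    have : Nonempty (V n) := Fintype.card_pos_iff.mp (by rw [hV]; exact hn)
    have h3 := hspec (V n) (H n) h1
    have hlow := expect_blockTensor_mul_le_lambda1 κ (H n)
    have hup : lambda1 κ (H n) ≤ (p + c) * √((Fintype.card (V n) : ℝ) ^ k) := by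
      refine multilinearSpectralNorm_le
        (mul_nonneg (add_nonneg hp.1 hc.le) (Real.sqrt_nonneg _)) fun x hx => ?_
      have e1 := h3 x hx
      have e2 := abs_sum_prod_le_sqrt_pow κ x hx
      rw [groupSlots_adjacencyMap_apply]
      have e3 : ∑ u, blockTensor κ (H n) u * ∏ i, x i (u i) =
          ∑ u, (blockTensor κ (H n) u - p) * ∏ i, x i (u i) +
            p * ∑ u : ∀ i, Fin (κ.part i) → V n, ∏ i, x i (u i) := by
        rw [Finset.mul_sum, ← Finset.sum_add_distrib]
        exact Finset.sum_congr rfl fun u _ => by ring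
      rw [e3]
      refine (abs_add_le _ _).trans ?_
      rw [abs_mul p, abs_of_nonneg hp.1]
      linarith [mul_le_mul_of_nonneg_left e2 hp.1]
    rw [hV] at hlow hup
    have hs : 0 ≤ √((n : ℝ) ^ k) := Real.sqrt_nonneg _
    rw [Real.norm_of_nonneg hs, Real.norm_eq_abs, abs_le]
    have h4 := mul_le_mul_of_nonneg_right (abs_le.mp h2).1 hs
    constructor <;> linarith
  · rw [isLittleO_iff]
    intro c hc
    obtain ⟨δ, hδ, hspec⟩ := exists_discrepancy_bound_spectral κ hp (half_pos hc)
    have hc4 : 0 < c / 4 := by positivity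
    filter_upwards [h δ hδ, h.eventually_abs_expect_sub_le hV hc4,
      eventually_abs_expect_blockTensor_sub_le κ hV H hc4, eventually_gt_atTop 0]
      with n h1 h2 h2' hn
    have : Nonempty (V n) := Fintype.card_pos_iff.mp (by rw [hV]; exact hn)
    have h3 := hspec (V n) (H n) h1
    rw [Real.norm_of_nonneg (lambda2_nonneg κ _),
      Real.norm_of_nonneg (Real.sqrt_nonneg _)]
    refine multilinearSpectralNorm_le (mul_nonneg hc.le (Real.sqrt_nonneg _)) fun x hx => ?_
    have e1 := h3 x hx
    have e2 := abs_sum_prod_le_sqrt_pow κ x hx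
    rw [groupSlots_sub_apply]
    rw [hV] at e1 e2 ⊢
    set d : ℝ := (k.factorial : ℝ) * ((H n).edges.ncard : ℝ) / (n : ℝ) ^ k
    have hpd : |p - d| ≤ c / 2 := by
      rw [abs_le] at h2 h2' ⊢
      constructor <;> linarith
    have e3 : ∑ u, (blockTensor κ (H n) u - d) * ∏ i, x i (u i) =
        ∑ u, (blockTensor κ (H n) u - p) * ∏ i, x i (u i) +
          (p - d) * ∑ u : ∀ i, Fin (κ.part i) → V n, ∏ i, x i (u i) := by
      rw [Finset.mul_sum, ← Finset.sum_add_distrib]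
      exact Finset.sum_congr rfl fun u _ => by ring
    rw [e3]
    refine (abs_add_le _ _).trans ?_
    rw [abs_mul (p - d)]
    have e4 := mul_le_mul hpd e2 (abs_nonneg _) (by positivity)
    linarith

/-- The bound on `lambda2` gives small discrepancy from the actual density `d`. The all-ones vectors
and `lambda1` give `d ≤ p + o(1)`, and the assumed number of edges gives the reverse. -/
theorem PropEig.isQuasirandom (hp1 : p ≤ 1) (hV : ∀ n, Fintype.card (V n) = n)
    (hH : ∃ err : ℕ → ℝ, (err =o[atTop] fun n : ℕ => (n : ℝ) ^ k) ∧
      ∀ n, p * (n.choose k : ℝ) + err n ≤ ((H n).edges.ncard : ℝ))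
    (h : PropEig κ p H) : IsQuasirandom κ p H := by
  simp only [PropEig, rpow_half_eq_sqrt_pow] at h
  obtain ⟨hl1, hl2⟩ := h
  intro ε hε
  have hε4 : 0 < ε / 4 := by positivity
  filter_upwards [hl1.bound hε4, hl2.bound hε4, eventually_le_edge_density H hp1 hH hε4,
    eventually_abs_expect_blockTensor_sub_le κ hV H hε4, eventually_gt_atTop 0]
    with n h1 h2 h3 h4 hn f hf
  have : Nonempty (V n) := Fintype.card_pos_iff.mp (by rw [hV]; exact hn)
  have hn0 : (0 : ℝ) < (n : ℝ) ^ k := by positivity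
  have hs : 0 < √((n : ℝ) ^ k) := Real.sqrt_pos.mpr hn0
  rw [Real.norm_of_nonneg hs.le] at h1 h2
  rw [Real.norm_eq_abs] at h1
  rw [Real.norm_of_nonneg (lambda2_nonneg κ _)] at h2
  have hlow := expect_blockTensor_mul_le_lambda1 κ (H n)
  rw [hV] at hlow
  have hmean : 𝔼 u, blockTensor κ (H n) u ≤ p + ε / 4 := by
    refine le_of_mul_le_mul_right ?_ hs
    linarith [(abs_le.mp h1).2]
  have hspec := abs_sum_mul_prod_le_spectralNorm κ (groupSlots_sub_apply κ (H n)
    ((k.factorial : ℝ) * ((H n).edges.ncard : ℝ) / (Fintype.card (V n) : ℝ) ^ k)) hf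
  change _ ≤ lambda2 κ (H n) * _ at hspec
  rw [hV] at hspec
  set d : ℝ := (k.factorial : ℝ) * ((H n).edges.ncard : ℝ) / (n : ℝ) ^ k
  have hdp : |d - p| ≤ ε / 2 := by
    rw [abs_le] at h4 ⊢
    constructor <;> linarith
  have hcard : Fintype.card (∀ i, Fin (κ.part i) → V n) = n ^ k := by rw [κ.card_blocks, hV]
  have hbig : |∑ u, (blockTensor κ (H n) u - d) * ∏ i, f i (u i)| ≤ ε / 4 * (n : ℝ) ^ k := by
    refine hspec.trans ((mul_le_mul_of_nonneg_right h2 hs.le).trans (le_of_eq ?_))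
    rw [mul_assoc, Real.mul_self_sqrt hn0.le]
  have hones : |∑ u : ∀ i, Fin (κ.part i) → V n, ∏ i, f i (u i)| ≤ (n : ℝ) ^ k := by
    refine (Finset.abs_sum_le_sum_abs _ _).trans ?_
    refine (Finset.sum_le_sum (g := fun _ => (1 : ℝ)) fun u _ => ?_).trans (le_of_eq ?_)
    · rw [abs_of_nonneg (Finset.prod_nonneg fun i _ => (hf i _).1)]
      exact Finset.prod_le_one (fun i _ => (hf i _).1) fun i _ => (hf i _).2
    · rw [Finset.sum_const, Finset.card_univ, hcard, nsmul_one, Nat.cast_pow]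
  rw [Fintype.expect_eq_sum_div_card, hcard, Nat.cast_pow, abs_div, abs_of_pos hn0,
    div_le_iff₀ hn0]
  have e3 : ∑ u, (blockTensor κ (H n) u - p) * ∏ i, f i (u i) =
      ∑ u, (blockTensor κ (H n) u - d) * ∏ i, f i (u i) +
        (d - p) * ∑ u : ∀ i, Fin (κ.part i) → V n, ∏ i, f i (u i) := by
    rw [Finset.mul_sum, ← Finset.sum_add_distrib]
    exact Finset.sum_congr rfl fun u _ => by ring
  rw [e3]
  refine (abs_add_le _ _).trans ?_
  rw [abs_mul (d - p)]
  have e4 := mul_le_mul hdp hones (abs_nonneg _) (by positivity)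
  nlinarith

end EigEquivalence

theorem theorem2 {k r : ℕ} (π : Nat.Partition k) (κ₁ κ₂ κ₃ κ₄ κ₅ : PartOrdering π (r + 2))
    (ℓ : ℕ) (hℓ : 1 ≤ ℓ) (p : ℝ) (hp0 : 0 < p) (hp1 : p < 1)
    {V : ℕ → Type*} [∀ n, Fintype (V n)] (hV : ∀ n, Fintype.card (V n) = n)
    (H : ∀ n, LoopHypergraph (V n) k)
    (hH : ∃ err : ℕ → ℝ, (err =o[atTop] fun n : ℕ => (n : ℝ) ^ k) ∧
      ∀ n, p * (n.choose k : ℝ) + err n ≤ ((H n).edges.ncard : ℝ)) :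
    [PropEig κ₁ p H,
     PropExpand κ₂ p H,
     PropCount κ₃ p H,
     PropCycle κ₄ 1 p H,
     PropCycle κ₅ ℓ p H].TFAE := by
  have hp : p ∈ Set.Icc (0 : ℝ) 1 := ⟨hp0.le, hp1.le⟩
  -- Counts of `π`-linear hypergraphs do not see the ordering, so the passage goes through the
  -- 4-cycle of the new ordering.
  have change_ordering : ∀ κ κ' : PartOrdering π (r + 2), IsQuasirandom κ p H →
      IsQuasirandom κ' p H := fun κ κ' h =>
    isQuasirandom_of_propCycle κ' le_rfl hp hV H hH ((h.propCount hp hV).propCycle κ' le_rfl)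
  tfae_have 1 → 2 := fun h =>
    (change_ordering κ₁ κ₂ (h.isQuasirandom hp1.le hV hH)).propExpand hp hV
  tfae_have 2 → 3 := fun h =>
    (change_ordering κ₂ κ₃ (h.isQuasirandom hp hV)).propCount hp hV
  tfae_have 3 → 4 := fun h => h.propCycle κ₄ le_rfl
  tfae_have 4 → 5 := fun h =>
    ((isQuasirandom_of_propCycle κ₄ le_rfl hp hV H hH h).propCount hp hV).propCycle κ₅ hℓ
  tfae_have 5 → 1 := fun h =>
    (change_ordering κ₅ κ₁ (isQuasirandom_of_propCycle κ₅ hℓ hp hV H hH h)).propEig hp hV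
  tfae_finish
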